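/- Let $R$ be a (not necessarily commutative) ring with unit. For a discrete projective right $R$-module $Q$ let $Q^*=\operatorname{Hom}_R(Q,R)$ be its dual, a left $R$-module with the topology for which the annihilators of finite subsets of $Q$ form a base of neighbourhoods of $0$. An \emph{elementary Tate $R$-module} is a topological left $R$-module isomorphic to $P\oplus Q^*$, where $P$ is a discrete projective left $R$-module and $Q$ is a discrete projective right $R$-module. A \emph{Tate $R$-module} is a direct summand of an elementary Tate $R$-module; a Tate $R$-module $M$ is \emph{quasi-elementary} if $M\oplus R^n$ ($R^n$ discrete) is elementary for some $n\in\mathbb N$. Let $\mathcal T_R$ be the additive category of Tate $R$-modules and continuous homomorphisms. Let $\mathcal C_R$ be the category whose objects are the projective left $R$-modules and whose morphisms are $\operatorname{Hom}_R(M,M')/\operatorname{Hom}_f(M,M')$, where $\operatorname{Hom}_f(M,M')$ is the group of homomorphisms whose image is contained in a finitely generated submodule of $M'$. The \emph{Calkin category} $\mathcal C_R^{\mathrm{Kar}}$ is the idempotent completion of $\mathcal C_R$, and $K_{-1}(R):=K_0(\mathcal C_R^{\mathrm{Kar}})$. Here $K_0$ of an additive category is the universal abelian group receiving a function on objects that takes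 direct sums to sums. Let $\Phi:\mathcal T_R\to\mathcal C_R^{\mathrm{Kar}}$ be the functor that extends (uniquely up to isomorphism) the functor which takes $P\oplus Q^*$ to $P$ and a continuous homomorphism $P\oplus Q^*\to P_1\oplus Q_1^*$ to the class of its component $P\to P_1$. The class of a Tate module $M$ in $K_{-1}(R)$ is $[M]:=[\Phi(M)]$. \textbf{Theorem.} (i) A Tate $R$-module has zero class in $K_{-1}(R)$ if and only if it is quasi-elementary. (ii) $K_0(\mathcal T_R)$ is well-defined, i.e. there is an abelian group which is a set (and not merely a proper class) with the universal property above. (iii) The homomorphism $K_0(\mathcal T_R)\to K_0(\mathcal C_R^{\mathrm{Kar}})=K_{-1}(R)$ induced by $\Phi$ is an isomorphism. (iv) Every element of $K_0(\mathcal T_R)=K_{-1}(R)$ is the class of $R((t))\otimes_{R[t,t^{-1}]}P$ for some finitely generated projective left $R[t,t^{-1}]$-module $P$ (with $t$ central). Here a finitely generated projective $R((t))$-module carries its standard topology, i.e. the topology induced from the product topology when it is realised as a direct summand of $R((t))^n$ (equivalently, the weakest topology for which all $R((t))$-linear maps to $R((t))$ are continuous); with this topology $R((t))\otimes_{R[t,t^{-1}]}P$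 is a Tate $R$-module. -/

import Mathlib

open CategoryTheory CategoryTheory.Limits

universe u v w

noncomputable section

namespace TateK

section GrothendieckGroup

variable {A : Type*} [Category A] [Preadditive A]

/-- A function on the objects of an additive category with values in an abelian group is additive
if it takes direct sums to sums. (Since `X` is a direct sum of `X'` and a zero object whenever
`X` and `X'` are isomorphic, such a function is invariant under isomorphism.) -/
def IsAdditiveInvariant {G : Type*} [AddCommGroup G] (φ : A → G) : Prop :=
  ∀ (X Y : A) (b : BinaryBicone X Y), Nonempty b.IsBilimit → φ b.pt = φ X + φ Y

/-- `cls : A → K` is a Grothendieck group of the additive category `A`: it is the universal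
additive function on objects. -/
def IsGrothendieckGroup {A : Type v} [Category A] [Preadditive A]
    {K : Type u} [AddCommGroup K] (cls : A → K) : Prop :=
  IsAdditiveInvariant cls ∧
    ∀ (G : Type w) [AddCommGroup G] (φ : A → G), IsAdditiveInvariant φ →
      ∃! h : K →+ G, ∀ X, h (cls X) = φ X

variable (A) in
/-- The relations `[X ⊕ Y] = [X] + [Y]`. -/
def K0Relations : AddSubgroup (FreeAbelianGroup A) :=
  AddSubgroup.closure {z | ∃ (X Y : A) (b : BinaryBicone X Y), Nonempty b.IsBilimit ∧
    z = FreeAbelianGroup.of b.pt - FreeAbelianGroup.of X - FreeAbelianGroup.of Y}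

variable (A) in
/-- The Grothendieck group of an additive category, by generators and relations. If the objects
of `A` form a type in a higher universe, then so does this group. -/
def K0 : Type _ := FreeAbelianGroup A ⧸ K0Relations A

instance : AddCommGroup (K0 A) := inferInstanceAs (AddCommGroup (FreeAbelianGroup A ⧸ _))

namespace K0

/-- The class of an object. -/
def of (X : A) : K0 A := QuotientAddGroup.mk' (K0Relations A) (FreeAbelianGroup.of X)

theorem isAdditiveInvariant_of : IsAdditiveInvariant (of : A → K0 A) := by
  intro X Y b hb
  have h : FreeAbelianGroup.of b.pt - FreeAbelianGroup.of X - FreeAbelianGroup.of Y ∈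
      K0Relations A := AddSubgroup.subset_closure ⟨X, Y, b, hb, rfl⟩
  have h' := (QuotientAddGroup.eq_zero_iff _).2 h
  have h2 : of b.pt - of X - of Y = 0 := h'
  rw [sub_sub, sub_eq_zero] at h2
  exact h2

/-- The homomorphism out of `K0 A` defined by an additive function. -/
def lift {G : Type*} [AddCommGroup G] (φ : A → G) (hφ : IsAdditiveInvariant φ) : K0 A →+ G :=
  QuotientAddGroup.lift (K0Relations A) (FreeAbelianGroup.lift φ) (by
    refine (AddSubgroup.closure_le _).2 ?_
    rintro z ⟨X, Y, b, hb, rfl⟩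
    have := hφ X Y b hb
    simp [this])

@[simp] theorem lift_of {G : Type*} [AddCommGroup G] (φ : A → G) (hφ : IsAdditiveInvariant φ)
    (X : A) : lift φ hφ (of X) = φ X := by
  change FreeAbelianGroup.lift φ (FreeAbelianGroup.of X) = φ X
  simp

theorem hom_ext {G : Type*} [AddCommGroup G] {g h : K0 A →+ G} (H : ∀ X, g (of X) = h (of X)) :
    g = h := by
  refine QuotientAddGroup.addMonoidHom_ext _ ?_
  ext X
  exact H X

theorem isGrothendieckGroup {A : Type v} [Category A] [Preadditive A] :
    IsGrothendieckGroup.{_, _, w} (of : A → K0 A) :=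
  ⟨isAdditiveInvariant_of, fun _ _ φ hφ =>
    ⟨lift φ hφ, lift_of φ hφ, fun _ hh => hom_ext fun X => by rw [hh X, lift_of]⟩⟩

/-- The homomorphism of Grothendieck groups induced by an additive functor, `[X] ↦ [F X]`. -/
def map {B : Type*} [Category B] [Preadditive B] (F : A ⥤ B) [F.Additive] : K0 A →+ K0 B :=
  lift (fun X => of (F.obj X)) (by
    rintro X Y b ⟨hb⟩
    have := preservesBinaryBiproduct_of_preservesBiproduct F X Y
    exact isAdditiveInvariant_of _ _ (F.mapBinaryBicone b) ⟨isBinaryBilimitOfPreserves F hb⟩)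

@[simp] theorem map_of {B : Type*} [Category B] [Preadditive B] (F : A ⥤ B) [F.Additive] (X : A) :
    map F (of X) = of (F.obj X) := lift_of _ _ _

end K0

end GrothendieckGroup

section Calkin

variable (R : Type u) [Ring R]

variable {R} in
/-- The image of `f` is contained in a finitely generated submodule. -/
def HasFGImage {M N : Type*} [AddCommGroup M] [Module R M] [AddCommGroup N] [Module R N]
    (f : M →ₗ[R] N) : Prop :=
  ∃ F : Submodule R N, F.FG ∧ LinearMap.range f ≤ F

namespace HasFGImage

variable {R}
variable {M N N' : Type*} [AddCommGroup M] [Module R M] [AddCommGroup N] [Module R N]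
  [AddCommGroup N'] [Module R N']

theorem zero : HasFGImage (0 : M →ₗ[R] N) := ⟨⊥, Submodule.fg_bot, by simp⟩

theorem add {f g : M →ₗ[R] N} (hf : HasFGImage f) (hg : HasFGImage g) : HasFGImage (f + g) := by
  obtain ⟨F, hF, h1⟩ := hf
  obtain ⟨F', hF', h2⟩ := hg
  refine ⟨F ⊔ F', hF.sup hF', ?_⟩
  rintro _ ⟨x, rfl⟩
  exact Submodule.add_mem_sup (h1 ⟨x, rfl⟩) (h2 ⟨x, rfl⟩)

theorem neg {f : M →ₗ[R] N} (hf : HasFGImage f) : HasFGImage (-f) := by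
  obtain ⟨F, hF, h1⟩ := hf
  refine ⟨F, hF, ?_⟩
  rintro _ ⟨x, rfl⟩
  exact F.neg_mem (h1 ⟨x, rfl⟩)

theorem comp_left {f : M →ₗ[R] N} (hf : HasFGImage f) (g : N →ₗ[R] N') :
    HasFGImage (g ∘ₗ f) := by
  obtain ⟨F, hF, h1⟩ := hf
  refine ⟨F.map g, hF.map g, ?_⟩
  rintro _ ⟨x, rfl⟩
  exact Submodule.mem_map_of_mem (h1 ⟨x, rfl⟩)

theorem comp_right {f : N →ₗ[R] N'} (hf : HasFGImage f) (g : M →ₗ[R] N) :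
    HasFGImage (f ∘ₗ g) := by
  obtain ⟨F, hF, h1⟩ := hf
  refine ⟨F, hF, ?_⟩
  rintro _ ⟨x, rfl⟩
  exact h1 ⟨g x, rfl⟩

end HasFGImage

/-- Two homomorphisms of `R`-modules are identified in the category `CalkinAll R` if the image of
their difference is contained in a finitely generated submodule. -/
def calkinRel : HomRel (ModuleCat.{u} R) := fun _ _ f g => HasFGImage (f.hom - g.hom)

instance : Congruence (calkinRel R) where
  equivalence :=
    { refl := fun f => by
        change HasFGImage (f.hom - f.hom)
        rw [sub_self]
        exact HasFGImage.zero
      symm := fun {f g} h => by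
        have := HasFGImage.neg h
        rwa [neg_sub] at this
      trans := fun {f g k} h h' => by
        have := HasFGImage.add h h'
        rwa [sub_add_sub_cancel] at this }
  comp_left f g g' h := by
    have := HasFGImage.comp_right h f.hom
    rwa [LinearMap.sub_comp] at this
  comp_right g h := by
    have := HasFGImage.comp_left h g.hom
    rwa [LinearMap.comp_sub] at this

/-- The category whose objects are all `R`-modules and whose morphisms are
`Hom(M, M') / Hom_f(M, M')`, where `Hom_f` is the group of homomorphisms whose image is contained
in a finitely generated submodule. -/
abbrev CalkinAll : Type (u + 1) := CategoryTheory.Quotient (calkinRel R)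

theorem calkinRel_add ⦃X Y : ModuleCat.{u} R⦄ (f₁ f₂ g₁ g₂ : X ⟶ Y) (h : calkinRel R f₁ f₂)
    (h' : calkinRel R g₁ g₂) : calkinRel R (f₁ + g₁) (f₂ + g₂) := by
  have := HasFGImage.add h h'
  rwa [← add_sub_add_comm] at this

instance : Preadditive (CalkinAll R) := Quotient.preadditive (calkinRel R) (calkinRel_add R)

/-- The full subcategory of `CalkinAll R` formed by the projective modules. -/
abbrev CalkinProj : Type (u + 1) :=
  ObjectProperty.FullSubcategory (C := CalkinAll R) fun X => Module.Projective R X.as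

/-- The Calkin category of `R`: the idempotent completion of `CalkinProj R`. -/
abbrev CalkinCategory : Type (u + 1) := Idempotents.Karoubi (CalkinProj R)

/-- `K_{-1}(R)`, the Grothendieck group of the Calkin category. -/
abbrev KMinusOne : Type (u + 1) := K0 (CalkinCategory R)

variable {R} in
/-- The morphism of `CalkinProj R` represented by a linear map of projective modules. -/
def CalkinProj.mk {X Y : CalkinProj R} (f : X.obj.as →ₗ[R] Y.obj.as) : X ⟶ Y :=
  ObjectProperty.homMk ((Quotient.functor (calkinRel R)).map (ModuleCat.ofHom f))

end Calkin

section Tate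

variable (R : Type u) [Ring R]

/-- The dual `Q* = Hom_R(Q, R)` of a right `R`-module `Q`; it is a left `R`-module by
`(r f)(q) = r f(q)`. -/
def Dual (Q : Type u) [AddCommGroup Q] [Module Rᵐᵒᵖ Q] : Type u := Q →ₗ[Rᵐᵒᵖ] R

section Dual

variable (Q : Type u) [AddCommGroup Q] [Module Rᵐᵒᵖ Q]

instance : AddCommGroup (Dual R Q) := inferInstanceAs (AddCommGroup (Q →ₗ[Rᵐᵒᵖ] R))

instance : Module R (Dual R Q) := inferInstanceAs (Module R (Q →ₗ[Rᵐᵒᵖ] R))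

instance : FunLike (Dual R Q) Q R := inferInstanceAs (FunLike (Q →ₗ[Rᵐᵒᵖ] R) Q R)

/-- The topology on the dual of a discrete module: a base of neighbourhoods of `0` is formed by
the annihilators of finite subsets (equivalently, of finitely generated submodules) of `Q`, i.e.
it is the topology of pointwise convergence, where `R` is discrete. -/
instance : TopologicalSpace (Dual R Q) :=
  TopologicalSpace.induced (fun (f : Dual R Q) (q : Q) => f q)
    (@Pi.topologicalSpace Q (fun _ => R) fun _ => ⊥)

end Dual

/-- A pair of discrete projective modules: a left module `P` and a right module `Q`. -/
structure ElementaryData : Type (u + 1) where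
  P : Type u
  Q : Type u
  [addCommGroupP : AddCommGroup P]
  [moduleP : Module R P]
  [projectiveP : Module.Projective R P]
  [addCommGroupQ : AddCommGroup Q]
  [moduleQ : Module Rᵐᵒᵖ Q]
  [projectiveQ : Module.Projective Rᵐᵒᵖ Q]

attribute [instance] ElementaryData.addCommGroupP ElementaryData.moduleP
  ElementaryData.projectiveP ElementaryData.addCommGroupQ ElementaryData.moduleQ
  ElementaryData.projectiveQ

variable {R} in
/-- The topological module `P ⊕ Q*`, with `P` discrete. -/
def ElementaryData.Space (D : ElementaryData R) : Type u := D.P × Dual R D.Q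

namespace ElementaryData

variable {R} (D : ElementaryData R)

instance : AddCommGroup D.Space := inferInstanceAs (AddCommGroup (D.P × Dual R D.Q))

instance : Module R D.Space := inferInstanceAs (Module R (D.P × Dual R D.Q))

instance : TopologicalSpace D.Space := @instTopologicalSpaceProd D.P (Dual R D.Q) ⊥ inferInstance

end ElementaryData

/-- An elementary Tate module: a topological module isomorphic to some `P ⊕ Q*`. -/
def IsElementary (M : Type u) [AddCommGroup M] [Module R M] [TopologicalSpace M] : Prop :=
  ∃ D : ElementaryData R, Nonempty (M ≃L[R] D.Space)

/-- A Tate module: a direct summand of an elementary Tate module. -/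
def IsTate (M : Type u) [AddCommGroup M] [Module R M] [TopologicalSpace M] : Prop :=
  ∃ (N : Type u) (_ : AddCommGroup N) (_ : Module R N) (_ : TopologicalSpace N),
    IsElementary R (M × N)

/-- The free module `R^n` with the discrete topology. -/
def DiscreteFree (n : ℕ) : Type u := Fin n → R

instance (n : ℕ) : AddCommGroup (DiscreteFree R n) := inferInstanceAs (AddCommGroup (Fin n → R))

instance (n : ℕ) : Module R (DiscreteFree R n) := inferInstanceAs (Module R (Fin n → R))

instance (n : ℕ) : TopologicalSpace (DiscreteFree R n) := ⊥

/-- `M` is quasi-elementary if `M ⊕ R^n` is elementary for some `n`. -/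
def IsQuasiElementary (M : Type u) [AddCommGroup M] [Module R M] [TopologicalSpace M] : Prop :=
  ∃ n : ℕ, IsElementary R (M × DiscreteFree R n)

/-- A Tate `R`-module. -/
structure TateModule : Type (u + 1) where
  carrier : Type u
  [addCommGroup : AddCommGroup carrier]
  [module : Module R carrier]
  [topologicalSpace : TopologicalSpace carrier]
  isTate : IsTate R carrier

instance : CoeSort (TateModule R) (Type u) := ⟨TateModule.carrier⟩

attribute [instance] TateModule.addCommGroup TateModule.module TateModule.topologicalSpace

variable {R}

instance (Q : Type u) [AddCommGroup Q] [Module Rᵐᵒᵖ Q] : IsTopologicalAddGroup (Dual R Q) := by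
  let _ : TopologicalSpace R := ⊥
  have : DiscreteTopology R := ⟨rfl⟩
  let φ : Dual R Q →+ (Q → R) :=
    { toFun := fun f q => f q, map_zero' := rfl, map_add' := fun _ _ => rfl }
  exact Topology.IsInducing.topologicalAddGroup φ ⟨rfl⟩

instance (D : ElementaryData R) : IsTopologicalAddGroup D.Space := by
  let _ : TopologicalSpace D.P := ⊥
  have : DiscreteTopology D.P := ⟨rfl⟩
  exact inferInstanceAs (IsTopologicalAddGroup (D.P × Dual R D.Q))

/-- A Tate module is a retract of some `P ⊕ Q*`. -/
theorem IsTate.exists_retract {M : Type u} [AddCommGroup M] [Module R M] [TopologicalSpace M]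
    (h : IsTate R M) : ∃ (D : ElementaryData R) (i : M →L[R] D.Space) (r : D.Space →L[R] M),
      r.comp i = ContinuousLinearMap.id R M ∧ Topology.IsInducing i := by
  obtain ⟨N, _, _, _, D, ⟨e⟩⟩ := h
  refine ⟨D, (e : (M × N) →L[R] D.Space).comp (ContinuousLinearMap.inl R M N),
    (ContinuousLinearMap.fst R M N).comp (e.symm : D.Space →L[R] (M × N)), ?_, ?_⟩
  · ext x
    simp
  · exact e.toHomeomorph.isInducing.comp (isInducing_prodMkLeft (0 : N))

instance (M : TateModule R) : IsTopologicalAddGroup M := by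
  obtain ⟨D, i, r, -, hi⟩ := M.isTate.exists_retract
  exact Topology.IsInducing.topologicalAddGroup i hi

/-- The category of Tate modules: morphisms are the continuous homomorphisms. -/
instance : Category (TateModule R) where
  Hom M N := M →L[R] N
  id M := ContinuousLinearMap.id R M
  comp f g := g.comp f

instance : Preadditive (TateModule R) where
  homGroup M N := inferInstanceAs (AddCommGroup (M →L[R] N))
  add_comp _ _ _ f f' g := ContinuousLinearMap.comp_add g f f'
  comp_add _ _ _ f g g' := ContinuousLinearMap.add_comp g g' f

/-- The category of the topological modules of the form `P ⊕ Q*` and continuous homomorphisms. -/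
instance : Category (ElementaryData R) where
  Hom D D' := D.Space →L[R] D'.Space
  id D := ContinuousLinearMap.id R D.Space
  comp f g := g.comp f

/-- The inclusion `P → P ⊕ Q*`. -/
def ElementaryData.inP (D : ElementaryData R) : D.P →ₗ[R] D.Space :=
  LinearMap.inl R D.P (Dual R D.Q)

/-- The projection `P ⊕ Q* → P`. -/
def ElementaryData.prP (D : ElementaryData R) : D.Space →ₗ[R] D.P :=
  LinearMap.fst R D.P (Dual R D.Q)

/-- The component `P → P'` of a homomorphism `P ⊕ Q* → P' ⊕ Q'*`. -/
def discretePart {D D' : ElementaryData R} (f : D.Space →L[R] D'.Space) : D.P →ₗ[R] D'.P :=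
  D'.prP ∘ₗ (f : D.Space →ₗ[R] D'.Space) ∘ₗ D.inP

/-- A homomorphism from the dual of a projective right module to a left module which vanishes on
the annihilator of a finite set has finitely generated image. -/
theorem hasFGImage_of_dual {Q : Type u} [AddCommGroup Q] [Module Rᵐᵒᵖ Q]
    [Module.Projective Rᵐᵒᵖ Q] {P : Type u} [AddCommGroup P] [Module R P]
    (h : Dual R Q →ₗ[R] P) (S : Finset Q) (hS : ∀ f : Dual R Q, (∀ q ∈ S, f q = 0) → h f = 0) :
    HasFGImage h := by
  classical
  obtain ⟨s, hs⟩ := Module.projective_def.1 (inferInstance : Module.Projective Rᵐᵒᵖ Q)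
  let T : Finset Q := S.biUnion fun q => (s q).support
  let c : Q → Dual R Q := fun t =>
    ({ toFun := fun q => (s q t).unop
       map_add' := fun a b => by simp
       map_smul' := fun a b => by simp } : Q →ₗ[Rᵐᵒᵖ] R)
  have key : ∀ f : Dual R Q, h f = ∑ t ∈ T, f t • h (c t) := by
    intro f
    have h0 : h (f - ∑ t ∈ T, f t • c t) = 0 := by
      apply hS
      intro q hq
      have e1 : f q = ∑ t ∈ T, f t * (s q t).unop := by
        have h1 : q = ∑ t ∈ T, s q t • t := by
          conv_lhs => rw [← hs q]
          rw [Finsupp.linearCombination_apply, Finsupp.sum_of_support_subset (s := T)]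
          · rfl
          · exact Finset.subset_biUnion_of_mem (fun q => (s q).support) hq
          · simp
        have h2 : f q = (show Q →ₗ[Rᵐᵒᵖ] R from f) (∑ t ∈ T, s q t • t) := congrArg _ h1
        rw [h2, map_sum]
        refine Finset.sum_congr rfl fun t _ => ?_
        rw [map_smul]
        rfl
      have e2 : (∑ t ∈ T, f t • c t : Dual R Q) q = ∑ t ∈ T, f t * (s q t).unop := by
        change (show Q →ₗ[Rᵐᵒᵖ] R from ∑ t ∈ T, f t • c t) q = _
        have := LinearMap.sum_apply T (fun t => (show Q →ₗ[Rᵐᵒᵖ] R from f t • c t)) q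
        exact this
      change f q - (∑ t ∈ T, f t • c t : Dual R Q) q = 0
      rw [e1, e2, sub_self]
    rw [map_sub, sub_eq_zero, map_sum] at h0
    rw [h0]
    exact Finset.sum_congr rfl fun t _ => by rw [map_smul]
  refine ⟨Submodule.span R (T.image fun t => h (c t) : Finset P), ⟨_, rfl⟩, ?_⟩
  rintro _ ⟨f, rfl⟩
  rw [key]
  refine Submodule.sum_mem _ fun t ht => Submodule.smul_mem _ _ (Submodule.subset_span ?_)
  exact Finset.mem_coe.2 (Finset.mem_image_of_mem _ ht)

/-- The component `Q* → P'` of a continuous homomorphism `P ⊕ Q* → P' ⊕ Q'*` has finitely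
generated image. -/
theorem hasFGImage_compactToDiscrete {D D' : ElementaryData R} (f : D.Space →L[R] D'.Space) :
    HasFGImage (D'.prP ∘ₗ (f : D.Space →ₗ[R] D'.Space) ∘ₗ
      (LinearMap.inr R D.P (Dual R D.Q) : Dual R D.Q →ₗ[R] D.Space)) := by
  let _ : TopologicalSpace R := ⊥
  have : DiscreteTopology R := ⟨rfl⟩
  let _ : TopologicalSpace D'.P := ⊥
  have : DiscreteTopology D'.P := ⟨rfl⟩
  let _ : TopologicalSpace D.P := ⊥
  have : DiscreteTopology D.P := ⟨rfl⟩
  set h := D'.prP ∘ₗ (f : D.Space →ₗ[R] D'.Space) ∘ₗ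
      (LinearMap.inr R D.P (Dual R D.Q) : Dual R D.Q →ₗ[R] D.Space) with hh
  have c1 : Continuous (fun x : Dual R D.Q => ((0, x) : D.P × Dual R D.Q)) := by fun_prop
  have c2 : Continuous (fun x : D'.P × Dual R D'.Q => x.1) := continuous_fst
  have hc : Continuous h := c2.comp (f.continuous.comp c1)
  have ho : IsOpen (h ⁻¹' {0}) := (isOpen_discrete _).preimage hc
  obtain ⟨U, hU, hU'⟩ := isOpen_induced_iff.1 ho
  have hz : (fun q => (0 : Dual R D.Q) q) ∈ U := by
    have : (0 : Dual R D.Q) ∈ h ⁻¹' {0} := by simp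
    rw [← hU'] at this
    exact this
  obtain ⟨S, V, hV, hVU⟩ := isOpen_pi_iff.1 hU _ hz
  refine hasFGImage_of_dual h S fun g hg => ?_
  have : g ∈ h ⁻¹' {0} := by
    rw [← hU']
    refine hVU fun q hq => ?_
    have e : g q = (0 : Dual R D.Q) q := hg q hq
    change g q ∈ V q
    rw [e]
    exact (hV q hq).2
  exact this

theorem discretePart_comp {D D' D'' : ElementaryData R} (f : D.Space →L[R] D'.Space)
    (g : D'.Space →L[R] D''.Space) :
    HasFGImage (discretePart (g.comp f) - discretePart g ∘ₗ discretePart f) := by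
  have h1 := (hasFGImage_compactToDiscrete g).comp_right
    ((LinearMap.snd R D'.P (Dual R D'.Q) : D'.Space →ₗ[R] Dual R D'.Q) ∘ₗ
      (f : D.Space →ₗ[R] D'.Space) ∘ₗ D.inP)
  convert h1 using 1
  ext x
  let y : D'.Space := f (D.inP x)
  let z : D'.Space := (LinearMap.inr R D'.P (Dual R D'.Q) : Dual R D'.Q →ₗ[R] D'.Space)
    ((LinearMap.snd R D'.P (Dual R D'.Q) : D'.Space →ₗ[R] Dual R D'.Q) y)
  have h2 : y = D'.inP (D'.prP y) + z := by
    refine Prod.ext ?_ ?_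
    · exact (add_zero _).symm
    · exact (zero_add _).symm
  change D''.prP (g y) - D''.prP (g (D'.inP (D'.prP y))) = D''.prP (g z)
  rw [sub_eq_iff_eq_add, ← map_add, ← map_add, add_comm z, ← h2]

theorem discretePart_add {D D' : ElementaryData R} (f g : D.Space →L[R] D'.Space) :
    discretePart (f + g) = discretePart f + discretePart g := by
  ext x
  change D'.prP (f (D.inP x) + g (D.inP x)) = _
  rw [map_add]
  rfl

variable (R) in
/-- The functor `P ⊕ Q* ↦ P` from elementary Tate modules to `CalkinProj R`, which takes a
morphism to the class of its component `P → P'`. -/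
def Psi : ElementaryData R ⥤ CalkinProj R where
  obj D := ⟨⟨ModuleCat.of R D.P⟩, D.projectiveP⟩
  map f := CalkinProj.mk (discretePart f)
  map_id D := by
    have : discretePart (𝟙 D) = LinearMap.id := rfl
    rw [this]
    rfl
  map_comp {D D' D''} f g := by
    apply ObjectProperty.hom_ext
    change (Quotient.functor (calkinRel R)).map (ModuleCat.ofHom _) =
      (Quotient.functor (calkinRel R)).map (ModuleCat.ofHom _) ≫
        (Quotient.functor (calkinRel R)).map (ModuleCat.ofHom _)
    rw [← Functor.map_comp, Quotient.functor_map_eq_iff]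
    exact discretePart_comp f g

theorem Psi_map_add {D D' : ElementaryData R} (f g : D.Space →L[R] D'.Space) :
    (Psi R).map (X := D) (Y := D') (f + g) =
      (Psi R).map (X := D) (Y := D') f + (Psi R).map (X := D) (Y := D') g := by
  apply ObjectProperty.hom_ext
  change (Quotient.functor (calkinRel R)).map (ModuleCat.ofHom (discretePart (f + g))) = _
  rw [discretePart_add]
  rfl

/-- A presentation of a Tate module as a direct summand of some `P ⊕ Q*`. -/
structure TateModule.Presentation (M : TateModule R) where
  D : ElementaryData R
  i : M →L[R] D.Space
  r : D.Space →L[R] M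
  r_i : ∀ x, r (i x) = x

namespace TateModule.Presentation

variable {M M' M'' : TateModule R}

/-- The image in the Calkin category of a Tate module presented as the image of the idempotent
`π` of `P ⊕ Q*`: the image of the idempotent of `P` induced by `π`. -/
def toCalkin (p : M.Presentation) : CalkinCategory R where
  X := (Psi R).obj p.D
  p := (Psi R).map (X := p.D) (Y := p.D) (p.i.comp p.r)
  idem := by
    rw [← Functor.map_comp]
    congr 1
    change (p.i.comp p.r).comp (p.i.comp p.r) = _
    ext x
    simp [p.r_i]

/-- The morphism in the Calkin category induced by a morphism of presented Tate modules. -/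
def toCalkinMap (p : M.Presentation) (p' : M'.Presentation) (f : M →L[R] M') :
    p.toCalkin ⟶ p'.toCalkin where
  f := (Psi R).map (X := p.D) (Y := p'.D) (p'.i.comp (f.comp p.r))
  comm := by
    change (Psi R).map _ ≫ (Psi R).map _ ≫ (Psi R).map _ = _
    rw [← Functor.map_comp, ← Functor.map_comp]
    congr 1
    change ((p'.i.comp p'.r).comp (p'.i.comp (f.comp p.r))).comp (p.i.comp p.r) = _
    ext x
    simp [p.r_i, p'.r_i]

theorem toCalkinMap_id (p : M.Presentation) :
    toCalkinMap p p (ContinuousLinearMap.id R M) = 𝟙 p.toCalkin := rfl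

theorem toCalkinMap_comp (p : M.Presentation) (p' : M'.Presentation) (p'' : M''.Presentation)
    (f : M →L[R] M') (g : M' →L[R] M'') :
    toCalkinMap p p'' (g.comp f) = toCalkinMap p p' f ≫ toCalkinMap p' p'' g := by
  apply Idempotents.Karoubi.hom_ext
  change (Psi R).map _ = (Psi R).map _ ≫ (Psi R).map _
  rw [← Functor.map_comp]
  congr 1
  change _ = (p''.i.comp (g.comp p'.r)).comp (p'.i.comp (f.comp p.r))
  ext x
  simp [p'.r_i]

theorem toCalkinMap_add (p : M.Presentation) (p' : M'.Presentation) (f g : M →L[R] M') :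
    toCalkinMap p p' (f + g) = toCalkinMap p p' f + toCalkinMap p p' g := by
  apply Idempotents.Karoubi.hom_ext
  have h : p'.i.comp ((f + g).comp p.r) = p'.i.comp (f.comp p.r) + p'.i.comp (g.comp p.r) := by
    ext x
    simp
  exact (congrArg ((Psi R).map (X := p.D) (Y := p'.D)) h).trans (Psi_map_add _ _)

/-- Up to isomorphism, the object of the Calkin category does not depend on the presentation. -/
def toCalkinIso (p p' : M.Presentation) : p.toCalkin ≅ p'.toCalkin where
  hom := toCalkinMap p p' (ContinuousLinearMap.id R M)
  inv := toCalkinMap p' p (ContinuousLinearMap.id R M)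
  hom_inv_id := by rw [← toCalkinMap_comp]; rfl
  inv_hom_id := by rw [← toCalkinMap_comp]; rfl

end TateModule.Presentation

/-- A chosen presentation of a Tate module. -/
def TateModule.presentation (M : TateModule R) : M.Presentation :=
  Classical.choice <| by
    obtain ⟨D, i, r, h, -⟩ := M.isTate.exists_retract
    exact ⟨⟨D, i, r, fun x => congrArg (fun g : M →L[R] M => g x) h⟩⟩

variable (R) in
/-- The functor from Tate modules to the Calkin category which extends `Psi R`. -/
def Phi : TateModule R ⥤ CalkinCategory R where
  obj M := M.presentation.toCalkin
  map {M M'} f := TateModule.Presentation.toCalkinMap M.presentation M'.presentation f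
  map_id _ := TateModule.Presentation.toCalkinMap_id _
  map_comp f g := TateModule.Presentation.toCalkinMap_comp _ _ _ f g

instance : (Phi R).Additive where
  map_add {_ _ f g} := TateModule.Presentation.toCalkinMap_add _ _ f g

/-- The class of a Tate module in `K_{-1}(R)`. -/
def TateModule.cls (M : TateModule R) : KMinusOne R := K0.of ((Phi R).obj M)

end Tate

section Laurent

variable (R : Type u) [Ring R]

/-- The inclusion `R[t, t⁻¹] → R((t))` for a not necessarily commutative ring `R` (the variable
`t` is central). -/
def laurentInclusion : LaurentPolynomial R →+* LaurentSeries R :=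
  AddMonoidAlgebra.liftNCRingHom HahnSeries.C
    { toFun := fun n => HahnSeries.single (Multiplicative.toAdd n) 1
      map_one' := rfl
      map_mul' := fun m n => by simp }
    (fun x n => by
      change HahnSeries.C x * HahnSeries.single _ 1 = HahnSeries.single _ 1 * HahnSeries.C x
      simp [HahnSeries.C_apply])

/-- The usual topology of `R((t))`: the subgroups `tⁿ R[[t]]` form a base of neighbourhoods
of `0`. -/
@[reducible]
def laurentTopology : TopologicalSpace (LaurentSeries R) where
  IsOpen U := ∀ f ∈ U, ∃ n : ℤ, ∀ g : LaurentSeries R, (∀ m < n, g.coeff m = f.coeff m) → g ∈ U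
  isOpen_univ := fun _ _ => ⟨0, fun _ _ => trivial⟩
  isOpen_inter := by
    rintro U V hU hV f ⟨hfU, hfV⟩
    obtain ⟨n, hn⟩ := hU f hfU
    obtain ⟨n', hn'⟩ := hV f hfV
    exact ⟨max n n', fun g hg => ⟨hn g fun m hm => hg m (lt_max_of_lt_left hm),
      hn' g fun m hm => hg m (lt_max_of_lt_right hm)⟩⟩
  isOpen_sUnion := by
    rintro s hs f ⟨U, hU, hf⟩
    obtain ⟨n, hn⟩ := hs U hU f hf
    exact ⟨n, fun g hg => ⟨U, hU, hn g hg⟩⟩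

variable (P : Type u) [AddCommGroup P] [Module (LaurentPolynomial R) P]

/-- The relations `s a ⊗ x = s ⊗ a x` for `a ∈ R[t, t⁻¹]`. -/
def laurentRelations : Submodule (LaurentSeries R) (TensorProduct ℤ (LaurentSeries R) P) :=
  Submodule.span (LaurentSeries R)
    {z | ∃ (s : LaurentSeries R) (a : LaurentPolynomial R) (x : P),
      z = (s * laurentInclusion R a) ⊗ₜ[ℤ] x - s ⊗ₜ[ℤ] (a • x)}

/-- The left `R((t))`-module `R((t)) ⊗_{R[t, t⁻¹]} P`, where `P` is a left `R[t, t⁻¹]`-module: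
the quotient of the tensor product over `ℤ` by the relations `s a ⊗ x = s ⊗ a x`. -/
def LaurentExtension : Type u :=
  TensorProduct ℤ (LaurentSeries R) P ⧸ laurentRelations R P

instance : AddCommGroup (LaurentExtension R P) :=
  inferInstanceAs (AddCommGroup (_ ⧸ laurentRelations R P))

instance : Module (LaurentSeries R) (LaurentExtension R P) :=
  inferInstanceAs (Module (LaurentSeries R) (_ ⧸ laurentRelations R P))

instance : Module R (LaurentExtension R P) := Module.compHom _ (HahnSeries.C (Γ := ℤ) (R := R))

/-- The standard topology of a finitely generated projective `R((t))`-module: the weakest one for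
which all `R((t))`-linear maps to `R((t))` are continuous. (On a direct summand of `R((t))^n` this
is the topology induced by the product topology.) -/
instance : TopologicalSpace (LaurentExtension R P) :=
  ⨅ f : LaurentExtension R P →ₗ[LaurentSeries R] LaurentSeries R,
    TopologicalSpace.induced f (laurentTopology R)

end Laurent

end TateK

end

/-! Call a homomorphism bounded if its image lies in a finitely generated submodule. A continuous
map from a dual Q* to a discrete module kills the annihilator of a finite subset of Q, hence is
bounded. So modulo bounded maps only the components between discrete parts matter. Every such
component extends by zero on the duals, so `Phi` is full.

Vanishing of classes. The swindle P^(ℕ) ≅ P ⊕ P^(ℕ) kills the class of an honest projective module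
in K₋₁(R) and, carried out on P and Q at once, the class of P ⊕ Q* in K₀ of Tate modules. Hence
quasi-elementary modules have class zero in both groups. Conversely, if [M] = 0 then Φ(M ⊕ F) ≅ Φ(F)
for some free discrete F. Lifts of this isomorphism and of its inverse are inverse to each other
modulo maps killed by Φ. After adding some R^n, the map to F becomes a split surjection whose kernel
has bounded discrete component, and such a kernel is a dual (`exists_equiv_dual_of_hasFGImage`). So
M plus a free module is elementary. The dual part of the sum meets only finitely many coordinates of
that free module, which can therefore be cut down to finite rank (`isQuasiElementary_of_prod_free`).

Injectivity on K₀. A Tate module has a complement with elementary sum, so every element of K₀ is the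
class of a single module, and the criterion above shows that the kernel is trivial.

Surjectivity. Let a be an endomorphism of P, idempotent modulo bounded maps; write a - a² = jk with
k : P → F and F = R^n. The operators u = 1 - a + ta and v = 1 - a + t⁻¹a on P[t,t⁻¹] satisfy uv = vu
= 1 - (2 - t - t⁻¹)jk. Therefore (u, j) : (P ⊕ F)[t,t⁻¹] → P[t,t⁻¹] is a split surjection, and its
kernel is a direct summand of (F ⊕ F)[t,t⁻¹], that is, the image of an idempotent matrix q over
R[t,t⁻¹]. The projection Θ to negative degrees is an honest idempotent, so it has class zero. Modulo
bounded maps it preserves the kernel, where it gives the Toeplitz operator of q, and on the quotient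
it induces Θ plus a placed in degree 0. Hence [q] + [a] = 0 (`exists_toeplitz`). The polar parts
form the discrete summand of R((t))^N, so the Toeplitz operator of q is exactly what represents the
Tate module R((t)) ⊗ im q (`exists_cls_laurentExtension`). As idempotent matrices form a set, K₋₁(R)
is small, and so is the isomorphic group K₀ of Tate modules. -/

noncomputable section

namespace TateK

section

/-! ### Images of idempotents in an idempotent completion. -/

section KaroubiInvariants

open Idempotents

variable {C : Type*} [Category C] [Preadditive C] {X : C} {c p : X ⟶ X}

/-- If the idempotent `c` preserves the image of the idempotent `p`, then the image of `c` is the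
direct sum of the images of the idempotents induced on the image and on the kernel of `p`. -/
theorem Karoubi.exists_isBilimit_of_preserves (hc : c ≫ c = c) (hp : p ≫ p = p)
    (h : p ≫ c ≫ p = p ≫ c) (h₁ : (p ≫ c) ≫ p ≫ c = p ≫ c)
    (h₂ : (c - c ≫ p) ≫ (c - c ≫ p) = c - c ≫ p) :
    ∃ b : BinaryBicone (⟨X, p ≫ c, h₁⟩ : Karoubi C) ⟨X, c - c ≫ p, h₂⟩,
      b.pt = ⟨X, c, hc⟩ ∧ Nonempty b.IsBilimit := by
  have hc' : ∀ {Z : C} (f : X ⟶ Z), c ≫ c ≫ f = c ≫ f := fun f => by rw [← Category.assoc, hc]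
  have hp' : ∀ {Z : C} (f : X ⟶ Z), p ≫ p ≫ f = p ≫ f := fun f => by rw [← Category.assoc, hp]
  have h' : ∀ {Z : C} (f : X ⟶ Z), p ≫ c ≫ p ≫ f = p ≫ c ≫ f := fun f => by
    have := congrArg (· ≫ f) h
    simpa using this
  let b : BinaryBicone (⟨X, p ≫ c, h₁⟩ : Karoubi C) ⟨X, c - c ≫ p, h₂⟩ :=
    { pt := ⟨X, c, hc⟩
      inl := ⟨p ≫ c, by simp [hc, h']⟩
      -- Since `c` preserves the image of `p` but perhaps not its kernel, the second inclusion is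
      -- not the idempotent `c - c ≫ p` itself but its composite with `c`.
      inr := ⟨c - c ≫ p ≫ c, by simp [hc, hc', h', Preadditive.comp_sub, Preadditive.sub_comp]⟩
      fst := ⟨c ≫ p ≫ c, by simp [hc, hc', h']⟩
      snd := ⟨c - c ≫ p, by simp [hc, hc', h, Preadditive.comp_sub, Preadditive.sub_comp]⟩
      inl_fst := by
        ext
        change (p ≫ c) ≫ c ≫ p ≫ c = p ≫ c
        simp [hc, hc', h']
      inl_snd := by ext; simp [hc, hc', h, Preadditive.comp_sub]
      inr_fst := by
        ext
        change (c - c ≫ p ≫ c) ≫ c ≫ p ≫ c = 0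
        simp [hc, hc', h', Preadditive.sub_comp]
      inr_snd := by
        ext; simp [hc, hc', h, Preadditive.comp_sub, Preadditive.sub_comp] }
  refine ⟨b, rfl, ⟨isBinaryBilimitOfTotal b ?_⟩⟩
  ext
  simp [b, hc, hc', h', Preadditive.comp_sub, Preadditive.sub_comp]

/-- The image of an idempotent `b` is isomorphic to its image under a retract. -/
def Karoubi.isoOfRetract {N W : C} {b : N ⟶ N} (hb : b ≫ b = b) (f : N ⟶ W) (g : W ⟶ N)
    (h : b ≫ f ≫ g ≫ b = b) (h' : (g ≫ b ≫ f) ≫ g ≫ b ≫ f = g ≫ b ≫ f) :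
    (⟨N, b, hb⟩ : Karoubi C) ≅ ⟨W, g ≫ b ≫ f, h'⟩ :=
  have hb' : ∀ {Z : C} (k : N ⟶ Z), b ≫ b ≫ k = b ≫ k := fun k => by rw [← Category.assoc, hb]
  have h1 : ∀ {Z : C} (k : N ⟶ Z), b ≫ f ≫ g ≫ b ≫ k = b ≫ k := fun k => by
    have := congrArg (· ≫ k) h
    simpa using this
  { hom := ⟨b ≫ f, by simp [hb', h1]⟩
    inv := ⟨g ≫ b, by simp [h, hb]⟩
    hom_inv_id := by ext; simp [h]
    inv_hom_id := by ext; simp [hb'] }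

end KaroubiInvariants

/-! ### Objects and morphisms of the Calkin category. -/

section CalkinObjects

variable {R : Type u} [Ring R]

variable (R) in
/-- A projective module as an object of `CalkinProj R`. -/
abbrev CalkinProj.of (P : Type u) [AddCommGroup P] [Module R P] [h : Module.Projective R P] :
    CalkinProj R := ⟨⟨ModuleCat.of R P⟩, h⟩

variable {P : Type u} [AddCommGroup P] [Module R P] [Module.Projective R P]
  {P' : Type u} [AddCommGroup P'] [Module R P'] [Module.Projective R P']
  {P'' : Type u} [AddCommGroup P''] [Module R P''] [Module.Projective R P'']

/-- The class of a homomorphism of projective modules modulo homomorphisms whose image is contained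
in a finitely generated submodule. -/
def calkinMk (f : P →ₗ[R] P') : CalkinProj.of R P ⟶ CalkinProj.of R P' :=
  CalkinProj.mk (X := CalkinProj.of R P) (Y := CalkinProj.of R P') f

theorem calkinMk_eq_iff {f g : P →ₗ[R] P'} : calkinMk f = calkinMk g ↔ HasFGImage (f - g) := by
  have : calkinMk f = calkinMk g ↔ (Quotient.functor (calkinRel R)).map (ModuleCat.ofHom f) =
      (Quotient.functor (calkinRel R)).map (ModuleCat.ofHom g) :=
    ⟨fun h => congrArg (fun k => k.hom) h, fun h => ObjectProperty.hom_ext _ h⟩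
  rw [this, Quotient.functor_map_eq_iff]
  rfl

theorem calkinMk_comp (f : P →ₗ[R] P') (g : P' →ₗ[R] P'') :
    calkinMk (g ∘ₗ f) = calkinMk f ≫ calkinMk g := rfl

theorem calkinMk_id : calkinMk (LinearMap.id : P →ₗ[R] P) = 𝟙 _ := rfl

theorem calkinMk_add (f g : P →ₗ[R] P') : calkinMk (f + g) = calkinMk f + calkinMk g := rfl

theorem calkinMk_surjective (φ : CalkinProj.of R P ⟶ CalkinProj.of R P') :
    ∃ f : P →ₗ[R] P', calkinMk f = φ := by
  obtain ⟨f, hf⟩ := (Quotient.functor (calkinRel R)).map_surjective φ.hom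
  exact ⟨f.hom, ObjectProperty.hom_ext _ hf⟩

theorem calkinMk_eq_zero_iff {f : P →ₗ[R] P'} : calkinMk f = 0 ↔ HasFGImage f := by
  have : (0 : CalkinProj.of R P ⟶ CalkinProj.of R P') = calkinMk 0 := rfl
  rw [this, calkinMk_eq_iff, sub_zero]

theorem calkinMk_sub (f g : P →ₗ[R] P') : calkinMk (f - g) = calkinMk f - calkinMk g := by
  rw [eq_sub_iff_add_eq, ← calkinMk_add, sub_add_cancel]


section Classes

variable {W : Type u} [AddCommGroup W] [Module R W] [Module.Projective R W]

/-- The object of the Calkin category defined by an endomorphism which is idempotent modulo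
homomorphisms whose image is contained in a finitely generated submodule. -/
def calkinImage (a : P →ₗ[R] P) (ha : calkinMk a ≫ calkinMk a = calkinMk a) :
    CalkinCategory R := ⟨CalkinProj.of R P, calkinMk a, ha⟩

theorem exists_eq_calkinImage (X : CalkinCategory R) :
    ∃ (P : Type u) (_ : AddCommGroup P) (_ : Module R P) (_ : Module.Projective R P)
      (a : P →ₗ[R] P) (ha : calkinMk a ≫ calkinMk a = calkinMk a), X = calkinImage a ha := by
  obtain ⟨⟨⟨P⟩, hP⟩, p, hp⟩ := X
  have : Module.Projective R P := hP
  obtain ⟨a, ha⟩ := calkinMk_surjective (P := P) (P' := P) p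
  subst ha
  exact ⟨P, inferInstance, inferInstance, hP, a, hp, rfl⟩

theorem calkinImage_congr {a b : P →ₗ[R] P} (h : calkinMk a = calkinMk b)
    (ha : calkinMk a ≫ calkinMk a = calkinMk a) (hb : calkinMk b ≫ calkinMk b = calkinMk b) :
    calkinImage a ha = calkinImage b hb := by
  unfold calkinImage
  congr

/-- The image of an idempotent and its image under a retract. -/
def calkinImageIsoOfRetract {b : P →ₗ[R] P} {b' : W →ₗ[R] W} (f : P →ₗ[R] W) (g : W →ₗ[R] P)
    (hb : calkinMk b ≫ calkinMk b = calkinMk b)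
    (h : calkinMk b ≫ calkinMk f ≫ calkinMk g ≫ calkinMk b = calkinMk b)
    (hb' : calkinMk b' ≫ calkinMk b' = calkinMk b')
    (h' : calkinMk b' = calkinMk g ≫ calkinMk b ≫ calkinMk f) :
    calkinImage b hb ≅ calkinImage b' hb' :=
  Karoubi.isoOfRetract hb (calkinMk f) (calkinMk g) h (by rw [← h', hb']) ≪≫
    eqToIso (by unfold calkinImage; congr; exact h'.symm)

namespace K0

open ZeroObject in
-- A zero object is its own double, so its class vanishes; an isomorphism presents `Y` as a direct
-- sum of `X` and zero.
theorem of_eq_of_iso {A : Type*} [Category A] [Preadditive A] [HasZeroObject A] {X Y : A}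
    (e : X ≅ Y) : of X = of Y := by
  have hz : ∀ Z : A, IsZero Z → of Z = 0 := fun Z hZ => by
    let b : BinaryBicone Z Z :=
      { pt := Z, fst := 𝟙 Z, snd := 𝟙 Z, inl := 𝟙 Z, inr := 𝟙 Z
        inl_snd := hZ.eq_of_src _ _, inr_fst := hZ.eq_of_src _ _ }
    have := isAdditiveInvariant_of Z Z b ⟨isBinaryBilimitOfTotal b (hZ.eq_of_src _ _)⟩
    simpa [b] using this
  let b : BinaryBicone X (0 : A) :=
    { pt := Y, fst := e.inv, snd := 0, inl := e.hom, inr := 0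
      inr_snd := (isZero_zero A).eq_of_src _ _ }
  have := isAdditiveInvariant_of X 0 b ⟨isBinaryBilimitOfTotal b (by simp [b])⟩
  rw [hz 0 (isZero_zero A), add_zero] at this
  exact this.symm

end K0

end Classes

end CalkinObjects

end

section

/-! ### The one-sided shift behind the swindles. -/

section Shift

variable (A : Type*) (P : Type*) [Ring A] [AddCommGroup P] [Module A P]

/-- The shift `xᵢ ↦ xᵢ₊₁` of finite sequences. -/
def shiftRight : (ℕ →₀ P) →ₗ[A] (ℕ →₀ P) := Finsupp.lmapDomain P A (· + 1)

/-- The left inverse of the shift. -/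
def shiftLeft : (ℕ →₀ P) →ₗ[A] (ℕ →₀ P) :=
  Finsupp.lcomapDomain (· + 1) (add_left_injective 1)

theorem shiftLeft_shiftRight (x : ℕ →₀ P) : shiftLeft A P (shiftRight A P x) = x :=
  Finsupp.comapDomain_mapDomain _ (add_left_injective 1) x

theorem shiftLeft_single_zero (x : P) : shiftLeft A P (Finsupp.single 0 x) = 0 := by
  ext k; simp [shiftLeft, Finsupp.lcomapDomain]

theorem shiftRight_apply_zero (x : ℕ →₀ P) : shiftRight A P x 0 = 0 :=
  Finsupp.mapDomain_of_notMem_range _ _ (by simp)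

theorem single_zero_add_shiftRight (x : ℕ →₀ P) :
    Finsupp.single 0 (x 0) + shiftRight A P (shiftLeft A P x) = x := by
  ext k
  cases k with
  | zero => simp [shiftRight_apply_zero]
  | succ k =>
    have : shiftRight A P (shiftLeft A P x) (k + 1) = shiftLeft A P x k :=
      Finsupp.mapDomain_apply (add_left_injective 1) _ _
    rw [Finsupp.add_apply, this]
    simp [shiftLeft, Finsupp.lcomapDomain]

end Shift

/-! ### Classes in K₋₁(R): additivity and vanishing. -/

section CalkinClasses

variable {R : Type u} [Ring R]

section Biproducts

variable (P P' : Type u) [AddCommGroup P] [Module R P] [Module.Projective R P]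
  [AddCommGroup P'] [Module R P'] [Module.Projective R P']

theorem calkinProj_hasBinaryBiproduct :
    HasBinaryBiproduct (CalkinProj.of R P) (CalkinProj.of R P') :=
  hasBinaryBiproduct_of_total
    { pt := CalkinProj.of R (P × P')
      fst := calkinMk (LinearMap.fst R P P')
      snd := calkinMk (LinearMap.snd R P P')
      inl := calkinMk (LinearMap.inl R P P')
      inr := calkinMk (LinearMap.inr R P P')
      inl_fst := rfl
      inl_snd := rfl
      inr_fst := rfl
      inr_snd := rfl } <| by
    change calkinMk (LinearMap.inl R P P' ∘ₗ LinearMap.fst R P P' +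
      LinearMap.inr R P P' ∘ₗ LinearMap.snd R P P') = calkinMk LinearMap.id
    congr 1
    ext <;> simp

end Biproducts

instance : HasBinaryBiproducts (CalkinProj R) where
  has_binary_biproduct := by
    rintro ⟨⟨X⟩, hX⟩ ⟨⟨Y⟩, hY⟩
    have : Module.Projective R X := hX
    have : Module.Projective R Y := hY
    exact calkinProj_hasBinaryBiproduct X Y

instance : HasZeroObject (CalkinProj R) where
  zero := by
    refine ⟨CalkinProj.of R PUnit.{u + 1}, (IsZero.iff_id_eq_zero _).2 ?_⟩
    rw [← calkinMk_id, calkinMk_eq_zero_iff]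
    exact ⟨⊤, Module.Finite.fg_top, le_top⟩

instance : HasFiniteBiproducts (CalkinProj R) :=
  have := hasFiniteProducts_of_has_binary_and_terminal (C := CalkinProj R)
  HasFiniteBiproducts.of_hasFiniteProducts

instance : HasBinaryBiproducts (CalkinCategory R) := hasBinaryBiproducts_of_finite_biproducts _

instance : HasZeroObject (CalkinCategory R) where
  zero := by
    refine ⟨⟨CalkinProj.of R PUnit.{u + 1}, 0, by simp⟩, (IsZero.iff_id_eq_zero _).2 rfl⟩

variable {P : Type u} [AddCommGroup P] [Module R P] [Module.Projective R P]
  {W : Type u} [AddCommGroup W] [Module R W] [Module.Projective R W]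

/-- The class in `K_{-1}(R)` of an endomorphism which is idempotent modulo homomorphisms whose
image is contained in a finitely generated submodule. -/
def calkinClass (a : P →ₗ[R] P) (ha : calkinMk a ≫ calkinMk a = calkinMk a) : KMinusOne R :=
  K0.of (calkinImage a ha)

theorem calkinClass_congr {a b : P →ₗ[R] P} (h : calkinMk a = calkinMk b)
    (ha : calkinMk a ≫ calkinMk a = calkinMk a) (hb : calkinMk b ≫ calkinMk b = calkinMk b) :
    calkinClass a ha = calkinClass b hb := by
  unfold calkinClass
  rw [calkinImage_congr h ha hb]

theorem calkinClass_of_retract {b : P →ₗ[R] P} {b' : W →ₗ[R] W} (f : P →ₗ[R] W) (g : W →ₗ[R] P)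
    (hb : calkinMk b ≫ calkinMk b = calkinMk b)
    (h : calkinMk b ≫ calkinMk f ≫ calkinMk g ≫ calkinMk b = calkinMk b)
    (hb' : calkinMk b' ≫ calkinMk b' = calkinMk b')
    (h' : calkinMk b' = calkinMk g ≫ calkinMk b ≫ calkinMk f) :
    calkinClass b hb = calkinClass b' hb' :=
  K0.of_eq_of_iso (calkinImageIsoOfRetract f g hb h hb' h')

/-- The main tool for computing classes: modulo bounded maps `c` preserves the image of `p`, `c₁` is
what it does there, and `c₂` is what it induces on the quotient by that image. All the identities
are needed only in the Calkin category. -/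
theorem calkinClass_eq_add {c p c₁ c₂ : P →ₗ[R] P} (hc : calkinMk c ≫ calkinMk c = calkinMk c)
    (hp : calkinMk p ≫ calkinMk p = calkinMk p)
    (h : calkinMk p ≫ calkinMk c ≫ calkinMk p = calkinMk p ≫ calkinMk c)
    (hc₁ : calkinMk c₁ ≫ calkinMk c₁ = calkinMk c₁) (hc₂ : calkinMk c₂ ≫ calkinMk c₂ = calkinMk c₂)
    (h₁ : calkinMk c₁ = calkinMk p ≫ calkinMk c)
    (h₂ : calkinMk c₂ = calkinMk c - calkinMk c ≫ calkinMk p) :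
    calkinClass c hc = calkinClass c₁ hc₁ + calkinClass c₂ hc₂ := by
  obtain ⟨b, hb, hb'⟩ := Karoubi.exists_isBilimit_of_preserves hc hp h
    (by rw [← h₁, hc₁]) (by rw [← h₂, hc₂])
  have := K0.isAdditiveInvariant_of _ _ b hb'
  rw [hb] at this
  unfold calkinClass calkinImage
  rw [this]
  congr 2 <;> congr <;> simp [h₁, h₂]

theorem calkinMk_idem {a : P →ₗ[R] P} (ha : a ∘ₗ a = a) :
    calkinMk a ≫ calkinMk a = calkinMk a := by rw [← calkinMk_comp, ha]

instance (ι M : Type*) [AddCommGroup M] [Module R M] [Module.Projective R M] :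
    Module.Projective R (ι →₀ M) := by
  classical
  exact Module.Projective.of_equiv (finsuppLequivDFinsupp R).symm

/-- Eilenberg swindle: the degree-zero projection splits P^(ℕ) into P and the image of the shift,
which is again a copy of P^(ℕ). -/
theorem calkinClass_id : calkinClass (LinearMap.id : P →ₗ[R] P) (calkinMk_idem rfl) = 0 := by
  let p : (ℕ →₀ P) →ₗ[R] (ℕ →₀ P) := Finsupp.lsingle 0 ∘ₗ Finsupp.lapply 0
  let S := shiftRight R P
  let S' := shiftLeft R P
  have hS : S' ∘ₗ S = LinearMap.id := LinearMap.ext (shiftLeft_shiftRight R P)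
  have hp : p ∘ₗ p = p := by
    ext i x j
    simp [p, Finsupp.lapply_apply, Finsupp.lsingle_apply]
  have hpS : p + S ∘ₗ S' = LinearMap.id := LinearMap.ext (single_zero_add_shiftRight R P)
  have hSS : (S ∘ₗ S') ∘ₗ S ∘ₗ S' = S ∘ₗ S' := by
    rw [LinearMap.comp_assoc, ← LinearMap.comp_assoc S', hS, LinearMap.id_comp]
  have h1 := calkinClass_eq_add (c := (LinearMap.id : (ℕ →₀ P) →ₗ[R] (ℕ →₀ P))) (p := p) (c₁ := p)
    (c₂ := S ∘ₗ S') (calkinMk_idem rfl) (calkinMk_idem hp)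
    (by simp [calkinMk_id, calkinMk_idem hp]) (calkinMk_idem hp) (calkinMk_idem hSS)
    (by simp [calkinMk_id]) (by
      rw [eq_sub_iff_add_eq, calkinMk_id, Category.id_comp, ← calkinMk_add, add_comm, hpS,
        calkinMk_id])
  have h2 := calkinClass_of_retract (b := (LinearMap.id : (ℕ →₀ P) →ₗ[R] (ℕ →₀ P))) S S' (calkinMk_idem rfl)
    (by simp [calkinMk_id, ← calkinMk_comp, hS]) (calkinMk_idem hSS)
    (by simp [calkinMk_id, ← calkinMk_comp])
  have h3 := calkinClass_of_retract (b := (LinearMap.id : P →ₗ[R] P)) (b' := p)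
    (Finsupp.lsingle 0 : P →ₗ[R] (ℕ →₀ P)) (Finsupp.lapply 0) (calkinMk_idem rfl)
    (by
      have : (Finsupp.lapply 0 : (ℕ →₀ P) →ₗ[R] P) ∘ₗ Finsupp.lsingle 0 = LinearMap.id := by ext; simp
      simp [calkinMk_id, ← calkinMk_comp, this]) (calkinMk_idem hp)
    (by simp [calkinMk_id, ← calkinMk_comp, p])
  rw [← h2, ← h3] at h1
  simpa using h1

/-- The image of an honest idempotent is a projective module, and the class is that of the identity
of this module. -/
theorem calkinClass_of_idem {a : P →ₗ[R] P} (ha : a ∘ₗ a = a) :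
    calkinClass a (calkinMk_idem ha) = 0 := by
  have e : a.rangeRestrict ∘ₗ a.range.subtype = LinearMap.id := by
    ext ⟨_, x, rfl⟩
    exact LinearMap.congr_fun ha x
  have : Module.Projective R a.range := Module.Projective.of_split _ _ e
  rw [← calkinClass_id (P := a.range)]
  refine (calkinClass_of_retract a.range.subtype a.rangeRestrict _ ?_ _ ?_).symm
  · simp [calkinMk_id, ← calkinMk_comp, e]
  · simp [calkinMk_id, ← calkinMk_comp]

/-- The images of `a` and `1 - a` add up to the whole of `P`, whose class is zero. Thus negatives of
classes are again classes of objects. -/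
theorem calkinClass_add_compl {a : P →ₗ[R] P} (ha : calkinMk a ≫ calkinMk a = calkinMk a)
    (ha' : calkinMk (LinearMap.id - a) ≫ calkinMk (LinearMap.id - a) =
      calkinMk (LinearMap.id - a)) :
    calkinClass a ha + calkinClass (LinearMap.id - a) ha' = 0 := by
  rw [← calkinClass_id (P := P)]
  refine (calkinClass_eq_add (p := a) _ ha ?_ _ _ ?_ ?_).symm
  · simp [calkinMk_id, ha]
  · simp [calkinMk_id]
  · simp [calkinMk_id, calkinMk_sub]

theorem calkinMk_idem_compl {a : P →ₗ[R] P} (ha : calkinMk a ≫ calkinMk a = calkinMk a) :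
    calkinMk (LinearMap.id - a) ≫ calkinMk (LinearMap.id - a) = calkinMk (LinearMap.id - a) := by
  simp [calkinMk_sub, calkinMk_id, Preadditive.comp_sub, Preadditive.sub_comp, ha]

end CalkinClasses

end

section

/-! ### Vanishing in K₀ as stable triviality. -/

section StableIsomorphism

variable {A : Type*} [Category A]

variable (A) in
/-- The isomorphism classes of objects of a category. -/
def IsoClasses : Type _ := _root_.Quotient (isIsomorphicSetoid A)

namespace IsoClasses

/-- The isomorphism class of an object. -/
def mk (X : A) : IsoClasses A := Quotient.mk'' X

theorem mk_eq_mk_iff {X Y : A} : mk X = mk Y ↔ Nonempty (X ≅ Y) := _root_.Quotient.eq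

variable [Preadditive A] [HasBinaryBiproducts A]

instance : Add (IsoClasses A) :=
  ⟨_root_.Quotient.map₂ (fun X Y => X ⊞ Y) fun _ _ ⟨e⟩ _ _ ⟨e'⟩ => ⟨biprod.mapIso e e'⟩⟩

theorem mk_biprod (X Y : A) : mk (X ⊞ Y) = mk X + mk Y := rfl

theorem mk_pt {X Y : A} (b : BinaryBicone X Y) (hb : b.IsBilimit) : mk b.pt = mk X + mk Y :=
  mk_eq_mk_iff.2 ⟨biprod.uniqueUpToIso X Y hb⟩

variable [HasZeroObject A]

open ZeroObject in
instance : Zero (IsoClasses A) := ⟨mk 0⟩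

instance : AddCommMonoid (IsoClasses A) where
  add_assoc := by
    rintro ⟨X⟩ ⟨Y⟩ ⟨Z⟩
    exact mk_eq_mk_iff.2 ⟨biprod.associator X Y Z⟩
  add_comm := by
    rintro ⟨X⟩ ⟨Y⟩
    exact mk_eq_mk_iff.2 ⟨biprod.braiding X Y⟩
  zero_add := by
    rintro ⟨X⟩
    exact mk_eq_mk_iff.2 ⟨(isoZeroBiprod (isZero_zero A)).symm⟩
  add_zero := by
    rintro ⟨X⟩
    exact mk_eq_mk_iff.2 ⟨(isoBiprodZero (isZero_zero A)).symm⟩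
  nsmul := nsmulRec

end IsoClasses

variable [Preadditive A] [HasBinaryBiproducts A] [HasZeroObject A]

/-- The class in the group completion of the monoid of isomorphism classes is an additive function,
so it factors through `K0`. An element of a commutative monoid dies in the group completion only if
adding some `Z` absorbs it. -/
theorem K0.exists_biprod_iso {X : A} (h : K0.of X = 0) : ∃ Z : A, Nonempty (X ⊞ Z ≅ Z) := by
  let φ : A → Algebra.GrothendieckAddGroup (IsoClasses A) := fun X =>
    Algebra.GrothendieckAddGroup.of (IsoClasses.mk X)
  have hφ : IsAdditiveInvariant φ := fun X Y b ⟨hb⟩ => by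
    simp only [φ]
    rw [IsoClasses.mk_pt b hb, map_add]
  have h' : φ X = 0 := by rw [← K0.lift_of φ hφ, h, map_zero]
  have h'' : Algebra.GrothendieckAddGroup.of (IsoClasses.mk X) =
      Algebra.GrothendieckAddGroup.of (0 : IsoClasses A) := by rw [map_zero]; exact h'
  obtain ⟨⟨Z⟩, hZ⟩ := (AddLocalization.addMonoidOf
    (⊤ : AddSubmonoid (IsoClasses A))).eq_iff_exists.1 h''
  obtain ⟨Z⟩ := Z
  refine ⟨Z, IsoClasses.mk_eq_mk_iff.1 ?_⟩
  rw [IsoClasses.mk_biprod, add_comm]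
  exact hZ.trans (add_zero _)

end StableIsomorphism

/-! ### Stabilisation by free modules; every element of K₋₁(R) is the class of an object. -/

section CalkinSwindle

variable {R : Type u} [Ring R]

/-- The stabilising object may be enlarged by any summand. It is the image of an endomorphism of a
projective `P`, which is a retract of the free module on the set `P`; adding the complement inside
that free module makes it free. -/
theorem exists_biprod_free_iso {X : CalkinCategory R} (h : K0.of X = 0) :
    ∃ S : Type u, Nonempty (X ⊞ calkinImage (LinearMap.id : (S →₀ R) →ₗ[R] _) (calkinMk_idem rfl) ≅
      calkinImage (LinearMap.id : (S →₀ R) →ₗ[R] _) (calkinMk_idem rfl)) := by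
  obtain ⟨Z, ⟨e⟩⟩ := K0.exists_biprod_iso h
  obtain ⟨P, _, _, _, a, ha, rfl⟩ := exists_eq_calkinImage Z
  obtain ⟨s, hs⟩ := Module.projective_def'.1 ‹Module.Projective R P›
  let r := Finsupp.linearCombination R (id : P → P)
  have hrs : calkinMk s ≫ calkinMk r = 𝟙 _ := by rw [← calkinMk_comp, hs]; rfl
  have hb : calkinMk (s ∘ₗ a ∘ₗ r) ≫ calkinMk (s ∘ₗ a ∘ₗ r) = calkinMk (s ∘ₗ a ∘ₗ r) := by
    simp only [calkinMk_comp, Category.assoc]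
    rw [reassoc_of% hrs, reassoc_of% ha]
  let e' := calkinImageIsoOfRetract s r ha (by rw [reassoc_of% hrs, ha]) hb (by
    simp only [calkinMk_comp, Category.assoc])
  refine ⟨P, IsoClasses.mk_eq_mk_iff.1 ?_⟩
  let Z' := (calkinImage (s ∘ₗ a ∘ₗ r) hb).complement
  have h1 : IsoClasses.mk (calkinImage (LinearMap.id : (P →₀ R) →ₗ[R] _) (calkinMk_idem rfl)) =
      IsoClasses.mk (calkinImage a ha) + IsoClasses.mk Z' := by
    rw [IsoClasses.mk_eq_mk_iff.2 ⟨e'⟩, ← IsoClasses.mk_biprod]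
    exact (IsoClasses.mk_eq_mk_iff.2
      ⟨Idempotents.Karoubi.decomposition (calkinImage (s ∘ₗ a ∘ₗ r) hb)⟩).symm
  rw [IsoClasses.mk_biprod, h1, ← add_assoc, ← IsoClasses.mk_biprod,
    IsoClasses.mk_eq_mk_iff.2 ⟨e⟩]

theorem K0.induction {A : Type*} [Category A] [Preadditive A] {motive : K0 A → Prop} (x : K0 A)
    (zero : motive 0) (of : ∀ X, motive (K0.of X)) (neg : ∀ x, motive x → motive (-x))
    (add : ∀ x y, motive x → motive y → motive (x + y)) : motive x := by
  obtain ⟨x, rfl⟩ := QuotientAddGroup.mk'_surjective _ x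
  induction x using FreeAbelianGroup.induction_on with
  | zero => exact zero
  | of X => exact of X
  | neg X h => exact neg _ h
  | add x y hx hy => exact add _ _ hx hy

theorem calkinClass_prod {P P' : Type u} [AddCommGroup P] [Module R P] [Module.Projective R P]
    [AddCommGroup P'] [Module R P'] [Module.Projective R P'] {a : P →ₗ[R] P} {b : P' →ₗ[R] P'}
    (ha : calkinMk a ≫ calkinMk a = calkinMk a) (hb : calkinMk b ≫ calkinMk b = calkinMk b) :
    ∃ h : calkinMk (a.prodMap b) ≫ calkinMk (a.prodMap b) = calkinMk (a.prodMap b),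
      calkinClass (a.prodMap b) h = calkinClass a ha + calkinClass b hb := by
  let i := LinearMap.inl R P P'
  let j := LinearMap.inr R P P'
  let f := LinearMap.fst R P P'
  let g := LinearMap.snd R P P'
  have hif : calkinMk i ≫ calkinMk f = 𝟙 _ := rfl
  have hjg : calkinMk j ≫ calkinMk g = 𝟙 _ := rfl
  have hig : calkinMk i ≫ calkinMk g = 0 := rfl
  have hjf : calkinMk j ≫ calkinMk f = 0 := rfl
  have e : calkinMk (a.prodMap b) = calkinMk f ≫ calkinMk a ≫ calkinMk i +
      calkinMk g ≫ calkinMk b ≫ calkinMk j := by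
    rw [← calkinMk_comp, ← calkinMk_comp, ← calkinMk_comp, ← calkinMk_comp, ← calkinMk_add]
    congr 1
    ext <;> simp [i, j, f, g]
  have h : calkinMk (a.prodMap b) ≫ calkinMk (a.prodMap b) = calkinMk (a.prodMap b) := by
    simp only [e, Preadditive.comp_add, Preadditive.add_comp, Category.assoc, reassoc_of% hif,
      reassoc_of% hjg, reassoc_of% hig, reassoc_of% hjf, zero_comp, comp_zero, add_zero, zero_add,
      reassoc_of% ha, reassoc_of% hb]
  have h₁ : calkinMk (i ∘ₗ a ∘ₗ f) ≫ calkinMk (i ∘ₗ a ∘ₗ f) = calkinMk (i ∘ₗ a ∘ₗ f) := by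
    simp only [calkinMk_comp, Category.assoc, reassoc_of% hif, reassoc_of% ha]
  have h₂ : calkinMk (j ∘ₗ b ∘ₗ g) ≫ calkinMk (j ∘ₗ b ∘ₗ g) = calkinMk (j ∘ₗ b ∘ₗ g) := by
    simp only [calkinMk_comp, Category.assoc, reassoc_of% hjg, reassoc_of% hb]
  refine ⟨h, ?_⟩
  rw [calkinClass_of_retract i f ha (by rw [reassoc_of% hif, ha]) h₁
      (by simp only [calkinMk_comp, Category.assoc]),
    calkinClass_of_retract j g hb (by rw [reassoc_of% hjg, hb]) h₂
      (by simp only [calkinMk_comp, Category.assoc])]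
  refine calkinClass_eq_add (p := i ∘ₗ f) _ (calkinMk_idem rfl) ?_ _ _ ?_ ?_
  all_goals
    simp only [e, calkinMk_comp, Preadditive.comp_add, Preadditive.add_comp, Category.assoc,
      reassoc_of% hif, reassoc_of% hig, reassoc_of% hjf, zero_comp, comp_zero, add_zero,
      add_sub_cancel_left]

/-- No formal differences are needed, because `1 - a` supplies the negative of the class of `a`. -/
theorem exists_eq_calkinClass (x : KMinusOne R) :
    ∃ (P : Type u) (_ : AddCommGroup P) (_ : Module R P) (_ : Module.Projective R P)
      (a : P →ₗ[R] P) (ha : calkinMk a ≫ calkinMk a = calkinMk a), x = calkinClass a ha := by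
  induction x using K0.induction with
  | zero =>
    exact ⟨R, inferInstance, inferInstance, inferInstance, LinearMap.id, calkinMk_idem rfl,
      calkinClass_id.symm⟩
  | of X =>
    obtain ⟨P, _, _, _, a, ha, rfl⟩ := exists_eq_calkinImage X
    exact ⟨P, _, _, inferInstance, a, ha, rfl⟩
  | neg x h =>
    obtain ⟨P, _, _, _, a, ha, rfl⟩ := h
    exact ⟨P, _, _, inferInstance, LinearMap.id - a, calkinMk_idem_compl ha,
      neg_eq_of_add_eq_zero_right (calkinClass_add_compl ha _)⟩
  | add x y hx hy =>
    obtain ⟨P, _, _, _, a, ha, rfl⟩ := hx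
    obtain ⟨P', _, _, _, b, hb, rfl⟩ := hy
    obtain ⟨h, e⟩ := calkinClass_prod ha hb
    exact ⟨_, _, _, inferInstance, _, h, e.symm⟩

end CalkinSwindle

end

section

/-! ### Factoring through finite free modules. -/

section FiniteRank

/-- A dual basis writes each generator of `F` with finitely many coordinates; keeping only these
reproduces `F`. This is how every bounded map of projective modules gets factored through some R^n.
-/
theorem exists_retract_on_fg {A : Type*} [Ring A] {P : Type*} [AddCommGroup P] [Module A P]
    [Module.Projective A P] {F : Submodule A P} (hF : F.FG) :
    ∃ (n : ℕ) (α : P →ₗ[A] (Fin n → A)) (β : (Fin n → A) →ₗ[A] P), ∀ x ∈ F, β (α x) = x := by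
  classical
  obtain ⟨s, hs⟩ := Module.projective_def.1 ‹Module.Projective A P›
  obtain ⟨G, rfl⟩ := hF
  let T : Finset P := G.biUnion fun g => (s g).support
  refine ⟨T.card, LinearMap.pi fun i => Finsupp.lapply (T.equivFin.symm i : P) ∘ₗ s,
    Fintype.linearCombination A fun i => (T.equivFin.symm i : P), fun x hx => ?_⟩
  induction hx using Submodule.span_induction with
  | mem x hx =>
    conv_rhs => rw [← hs x, Finsupp.linearCombination_apply, Finsupp.sum_of_support_subset
      (s := T) _ (Finset.subset_biUnion_of_mem (fun g => (s g).support) hx) _ (by simp),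
      ← Finset.sum_coe_sort, ← T.equivFin.symm.sum_comp]
    simp [Fintype.linearCombination_apply]
  | zero => simp
  | add x y _ _ hx hy => rw [map_add, map_add, hx, hy]
  | smul c x _ hx => rw [map_smul, map_smul, hx]

/-- For a free module the coordinates form a basis, so the finitely many used by `F` span an actual
direct summand R^n, whence `α (β y) = y` as well. -/
theorem exists_retract_on_fg_finsupp {A S : Type*} [Ring A] {F : Submodule A (S →₀ A)}
    (hF : F.FG) :
    ∃ (n : ℕ) (α : (S →₀ A) →ₗ[A] (Fin n → A)) (β : (Fin n → A) →ₗ[A] (S →₀ A)),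
      (∀ x ∈ F, β (α x) = x) ∧ ∀ y, α (β y) = y := by
  classical
  obtain ⟨G, rfl⟩ := hF
  let T : Finset S := G.biUnion fun g => g.support
  have key : ∀ x : S →₀ A, x.support ⊆ T →
      ∑ i, x (T.equivFin.symm i) • Finsupp.single (T.equivFin.symm i : S) (1 : A) = x := by
    intro x hx
    conv_rhs => rw [← Finsupp.sum_single x, Finsupp.sum_of_support_subset _ hx _ (by simp),
      ← Finset.sum_coe_sort, ← T.equivFin.symm.sum_comp]
    simp
  refine ⟨T.card, LinearMap.pi fun i => Finsupp.lapply (T.equivFin.symm i : S),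
    Fintype.linearCombination A fun i => Finsupp.single (T.equivFin.symm i : S) (1 : A),
    fun x hx => ?_, fun y => ?_⟩
  · induction hx using Submodule.span_induction with
    | mem x hx => exact key x (Finset.subset_biUnion_of_mem (fun g => g.support) hx)
    | zero => simp
    | add x y _ _ hx hy => rw [map_add, map_add, hx, hy]
    | smul c x _ hx => rw [map_smul, map_smul, hx]
  · ext i
    simp [Fintype.linearCombination_apply, Finsupp.single_apply,
      T.equivFin.symm.injective.eq_iff]

end FiniteRank

variable {R : Type u} [Ring R]

/-! ### Discrete modules. -/

section Discrete

/-- A module with the discrete topology. -/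
def Disc (P : Type u) : Type u := P

variable (P : Type u) [AddCommGroup P] [Module R P]

instance : AddCommGroup (Disc P) := inferInstanceAs (AddCommGroup P)

instance : Module R (Disc P) := inferInstanceAs (Module R P)

instance : TopologicalSpace (Disc P) := ⊥

instance : DiscreteTopology (Disc P) := ⟨rfl⟩

instance [Module.Projective R P] : Module.Projective R (Disc P) :=
  inferInstanceAs (Module.Projective R P)

variable {P}

/-- A linear map out of a discrete module is continuous. -/
def Disc.lift {M : Type*} [AddCommGroup M] [Module R M] [TopologicalSpace M] (f : P →ₗ[R] M) :
    Disc P →L[R] M :=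
  ⟨f, continuous_of_discreteTopology⟩

/-- A linear isomorphism of discrete modules. -/
def Disc.congr {P' : Type u} [AddCommGroup P'] [Module R P'] (e : P ≃ₗ[R] P') :
    Disc P ≃L[R] Disc P' :=
  { e with
    continuous_toFun := continuous_of_discreteTopology
    continuous_invFun := continuous_of_discreteTopology }

/-- The product of two discrete modules. -/
def Disc.prodEquiv {P' : Type u} [AddCommGroup P'] [Module R P'] :
    (Disc P × Disc P') ≃L[R] Disc (P × P') :=
  { LinearEquiv.refl R (P × P') with
    continuous_toFun := continuous_of_discreteTopology
    continuous_invFun := continuous_of_discreteTopology }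

end Discrete

/-! ### Duals of projective right modules: reflexivity and direct summands. -/

section Duals

variable {Q : Type u} [AddCommGroup Q] [Module Rᵐᵒᵖ Q]
  {Q' : Type u} [AddCommGroup Q'] [Module Rᵐᵒᵖ Q']

/-- An element of the dual of `Q` as a homomorphism. -/
def Dual.toHom (f : Dual R Q) : Q →ₗ[Rᵐᵒᵖ] R := f

@[ext] theorem Dual.ext {f g : Dual R Q} (h : ∀ q, f q = g q) : f = g := LinearMap.ext h

theorem Dual.map_add (f : Dual R Q) (q q' : Q) : f (q + q') = f q + f q' :=
  LinearMap.map_add f.toHom q q'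
theorem Dual.map_smul (f : Dual R Q) (r : R) (q : Q) : f (MulOpposite.op r • q) = f q * r :=
  LinearMap.map_smul f.toHom (MulOpposite.op r) q
theorem Dual.map_sum {ι : Type*} (f : Dual R Q) (s : Finset ι) (q : ι → Q) :
    f (∑ i ∈ s, q i) = ∑ i ∈ s, f (q i) :=
  _root_.map_sum f.toHom q s
theorem Dual.sum_apply {ι : Type*} (s : Finset ι) (f : ι → Dual R Q) (q : Q) :
    (∑ i ∈ s, f i) q = ∑ i ∈ s, f i q :=
  LinearMap.sum_apply s (fun i => (f i).toHom) q

variable (R) in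
/-- Evaluation at an element of `Q`. -/
def Dual.eval (q : Q) : Dual R Q →L[R] Disc R where
  toFun f := f q
  map_add' _ _ := rfl
  map_smul' _ _ := rfl
  cont := @Continuous.comp _ _ _ _ (@Pi.topologicalSpace Q (fun _ => R) fun _ => ⊥) ⊥ _ _
    (@continuous_apply Q (fun _ => R) (fun _ => ⊥) q) continuous_induced_dom

theorem Dual.continuous_of_eval {X : Type*} [TopologicalSpace X] {f : X → Dual R Q}
    (h : ∀ q, Continuous fun x => Dual.eval R q (f x)) : Continuous f :=
  continuous_induced_rng.2 (@continuous_pi _ _ _ _ (fun _ => ⊥) _ h)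

/-- The dual of a homomorphism of right modules. -/
def Dual.map (g : Q' →ₗ[Rᵐᵒᵖ] Q) : Dual R Q →L[R] Dual R Q' where
  toFun f := (f.toHom ∘ₗ g : Q' →ₗ[Rᵐᵒᵖ] R)
  map_add' _ _ := rfl
  map_smul' _ _ := rfl
  cont := Dual.continuous_of_eval fun q => (Dual.eval R (g q)).continuous

theorem Dual.exists_finset_of_continuous {P : Type u} [AddCommGroup P] [Module R P]
    (φ : Dual R Q →L[R] Disc P) :
    ∃ S : Finset Q, ∀ f : Dual R Q, (∀ q ∈ S, f q = 0) → φ f = 0 := by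
  let _ : TopologicalSpace R := ⊥
  have ho : IsOpen (φ ⁻¹' {0}) := (isOpen_discrete _).preimage φ.continuous
  obtain ⟨U, hU, hU'⟩ := isOpen_induced_iff.1 ho
  have hz : (fun q : Q => (0 : Dual R Q) q) ∈ U := by
    have : (0 : Dual R Q) ∈ φ ⁻¹' {0} := map_zero φ
    rwa [← hU'] at this
  obtain ⟨S, V, hV, hVU⟩ := isOpen_pi_iff.1 hU _ hz
  refine ⟨S, fun f hf => ?_⟩
  have : f ∈ φ ⁻¹' {0} := by
    rw [← hU']
    refine hVU fun q hq => ?_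
    have e : f q = (0 : Dual R Q) q := hf q hq
    change f q ∈ V q
    rw [e]
    exact (hV q hq).2
  exact this

theorem Dual.hasFGImage_of_continuous [Module.Projective Rᵐᵒᵖ Q] {P : Type u} [AddCommGroup P]
    [Module R P] (φ : Dual R Q →L[R] Disc P) : HasFGImage (φ : Dual R Q →ₗ[R] Disc P) := by
  obtain ⟨S, hS⟩ := Dual.exists_finset_of_continuous φ
  exact hasFGImage_of_dual _ S hS

/-- A homomorphism of right modules `Q → Rᵐᵒᵖ` as an element of the dual. -/
def Dual.ofOp (f : Q →ₗ[Rᵐᵒᵖ] Rᵐᵒᵖ) : Dual R Q :=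
  ({ toFun := fun q => (f q).unop
     map_add' := fun a b => by simp
     map_smul' := fun a b => by simp } : Q →ₗ[Rᵐᵒᵖ] R)

/-- The coordinate functions of a dual basis already separate points. -/
theorem Dual.eq_of_forall_apply_eq [Module.Projective Rᵐᵒᵖ Q] {q q' : Q}
    (h : ∀ f : Dual R Q, f q = f q') : q = q' := by
  obtain ⟨s, hs⟩ := Module.projective_def.1 ‹Module.Projective Rᵐᵒᵖ Q›
  rw [← hs q, ← hs q']
  congr 1
  ext t
  exact congrArg MulOpposite.op (h (Dual.ofOp (Finsupp.lapply t ∘ₗ s)))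

/-- The dual of a projective right module is reflexive. -/
theorem Dual.exists_eq_eval [Module.Projective Rᵐᵒᵖ Q] (φ : Dual R Q →L[R] Disc R) :
    ∃ q : Q, ∀ f, φ f = f q := by
  obtain ⟨S, hS⟩ := Dual.exists_finset_of_continuous φ
  obtain ⟨n, α, β, h⟩ := exists_retract_on_fg (A := Rᵐᵒᵖ)
    (F := Submodule.span Rᵐᵒᵖ (S : Set Q)) ⟨S, rfl⟩
  let c : Fin n → Dual R Q := fun i => Dual.ofOp (LinearMap.proj i ∘ₗ α)
  let b : Fin n → Q := fun i => β (Pi.single i 1)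
  have hβ : ∀ y, β y = ∑ i, y i • b i := fun y => by
    conv_lhs => rw [pi_eq_sum_univ y]
    rw [_root_.map_sum]
    refine Finset.sum_congr rfl fun i _ => ?_
    rw [LinearMap.map_smul]
    congr 2
    ext j
    simp [Pi.single_apply, eq_comm]
  -- On the finite set `S` that controls `φ`, every `f` agrees with ∑ f(bᵢ) cᵢ. So φ(f) = ∑ f(bᵢ)
  -- φ(cᵢ), which is f evaluated at ∑ bᵢ φ(cᵢ).
  refine ⟨∑ i, MulOpposite.op (α := R) (φ (c i)) • b i, fun f => ?_⟩
  have h0 : φ (f - ∑ i, f (b i) • c i) = 0 := by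
    refine hS _ fun q hq => ?_
    rw [sub_eq_add_neg]
    have : f q = (∑ i, f (b i) • c i) q := by
      rw [Dual.sum_apply]
      conv_lhs => rw [← h q (Submodule.subset_span hq), hβ, Dual.map_sum]
      refine Finset.sum_congr rfl fun i _ => ?_
      exact Dual.map_smul f ((α q i).unop) (b i)
    change f q + -((∑ i, f (b i) • c i) q) = 0
    rw [← this, add_neg_cancel]
  rw [map_sub, sub_eq_zero, _root_.map_sum] at h0
  rw [h0, Dual.map_sum]
  refine Finset.sum_congr rfl fun i _ => ?_
  exact (ContinuousLinearMap.map_smul φ _ _).trans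
    (Dual.map_smul f (show R from φ (c i)) (b i)).symm

/-- A topological direct summand of the dual of a projective module is such a dual. -/
theorem Dual.exists_equiv_of_retract [Module.Projective Rᵐᵒᵖ Q] {L : Type u} [AddCommGroup L]
    [Module R L] [TopologicalSpace L] (i : L →L[R] Dual R Q) (r : Dual R Q →L[R] L)
    (h : ∀ x, r (i x) = x) :
    ∃ (Q' : Type u) (_ : AddCommGroup Q') (_ : Module Rᵐᵒᵖ Q') (_ : Module.Projective Rᵐᵒᵖ Q'),
      Nonempty (L ≃L[R] Dual R Q') := by
  -- By reflexivity the idempotent `i ∘ r` of the dual is the transpose of an idempotent `ϖ` of `Q`;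
  -- then `L` is the dual of the image of `ϖ`.
  have hex : ∀ q : Q, ∃ q' : Q, ∀ f : Dual R Q, i (r f) q = f q' := fun q =>
    Dual.exists_eq_eval ((Dual.eval R q).comp (i.comp r))
  choose w hw using hex
  let ϖ : Q →ₗ[Rᵐᵒᵖ] Q :=
    { toFun := w
      map_add' := fun a b => Dual.eq_of_forall_apply_eq fun f => by
        rw [← hw, Dual.map_add, Dual.map_add, hw, hw]
      map_smul' := fun c a => Dual.eq_of_forall_apply_eq fun f => by
        obtain ⟨c, rfl⟩ := MulOpposite.op_surjective c
        rw [← hw, RingHom.id_apply, Dual.map_smul, Dual.map_smul, hw] }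
  have hϖ : ∀ (f : Dual R Q) q, i (r f) q = f (ϖ q) := fun f q => hw q f
  have hidem : ϖ.rangeRestrict ∘ₗ ϖ.range.subtype = LinearMap.id := by
    ext ⟨_, q, rfl⟩
    refine Dual.eq_of_forall_apply_eq (R := R) fun f => ?_
    change f (ϖ (ϖ q)) = f (ϖ q)
    rw [← hϖ, ← hϖ, h, ← hϖ]
  refine ⟨ϖ.range, inferInstance, inferInstance, Module.Projective.of_split _ _ hidem,
    ⟨{ toFun := fun x => Dual.map ϖ.range.subtype (i x)
       invFun := fun g => r (Dual.map ϖ.rangeRestrict g)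
       map_add' := fun x y => by simp
       map_smul' := fun c x => by simp
       left_inv := fun x => ?_
       right_inv := fun g => ?_
       continuous_toFun := (Dual.map _).continuous.comp i.continuous
       continuous_invFun := r.continuous.comp (Dual.map _).continuous }⟩⟩
  · have e : Dual.map ϖ.rangeRestrict (Dual.map ϖ.range.subtype (i x)) = i x := by
      ext q
      exact (hϖ (i x) q).symm.trans (congrArg (fun y => i y q) (h x))
    exact (congrArg r e).trans (h x)
  · ext q
    change i (r (Dual.map ϖ.rangeRestrict g)) q = g q
    rw [hϖ]
    exact congrArg g ((LinearMap.congr_fun hidem (ϖ.rangeRestrict q)).trans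
      (LinearMap.congr_fun hidem q))

end Duals

end

section

variable {R : Type u} [Ring R]

/-! ### Elementary Tate modules and two criteria for direct summands. -/

section Elementary

/-- The projection `P ⊕ Q* → P` as a continuous map. -/
def ElementaryData.fstL (D : ElementaryData R) : D.Space →L[R] Disc D.P :=
  ContinuousLinearMap.fst R (Disc D.P) (Dual R D.Q)

/-- The projection `P ⊕ Q* → Q*` as a continuous map. -/
def ElementaryData.sndL (D : ElementaryData R) : D.Space →L[R] Dual R D.Q :=
  ContinuousLinearMap.snd R (Disc D.P) (Dual R D.Q)

/-- The inclusion `P → P ⊕ Q*` as a continuous map. -/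
def ElementaryData.inlL (D : ElementaryData R) : Disc D.P →L[R] D.Space :=
  ContinuousLinearMap.inl R (Disc D.P) (Dual R D.Q)

/-- The inclusion `Q* → P ⊕ Q*` as a continuous map. -/
def ElementaryData.inrL (D : ElementaryData R) : Dual R D.Q →L[R] D.Space :=
  ContinuousLinearMap.inr R (Disc D.P) (Dual R D.Q)

theorem ElementaryData.inl_fst_add (D : ElementaryData R) (x : D.Space) :
    D.inlL (D.fstL x) + D.inrL (D.sndL x) = x :=
  Prod.ext (add_zero _) (zero_add _)

theorem IsElementary.of_equiv {M N : Type u} [AddCommGroup M] [Module R M] [TopologicalSpace M]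
    [AddCommGroup N] [Module R N] [TopologicalSpace N] (h : IsElementary R M) (e : N ≃L[R] M) :
    IsElementary R N := by
  obtain ⟨D, ⟨e'⟩⟩ := h
  exact ⟨D, ⟨e.trans e'⟩⟩

theorem isElementary_disc_prod_dual (P Q : Type u) [AddCommGroup P] [Module R P]
    [Module.Projective R P] [AddCommGroup Q] [Module Rᵐᵒᵖ Q] [Module.Projective Rᵐᵒᵖ Q] :
    IsElementary R (Disc P × Dual R Q) :=
  ⟨⟨P, Q⟩, ⟨ContinuousLinearEquiv.refl R (Disc P × Dual R Q)⟩⟩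

theorem isElementary_disc (P : Type u) [AddCommGroup P] [Module R P] [Module.Projective R P] :
    IsElementary R (Disc P) := by
  refine (isElementary_disc_prod_dual P PUnit.{u + 1}).of_equiv
    { toFun := fun x => (x, 0)
      invFun := Prod.fst
      map_add' := fun x y => by simp
      map_smul' := fun c x => by simp
      left_inv := fun x => rfl
      right_inv := fun ⟨x, f⟩ => Prod.ext rfl (Dual.ext fun q => ?_)
      continuous_toFun := by fun_prop
      continuous_invFun := by fun_prop }
  rw [Subsingleton.elim q 0]
  exact (LinearMap.map_zero f.toHom).symm

theorem IsElementary.isTate {M : Type u} [AddCommGroup M] [Module R M] [TopologicalSpace M]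
    (h : IsElementary R M) : IsTate R M := by
  refine ⟨Disc PUnit.{u + 1}, inferInstance, inferInstance, inferInstance, h.of_equiv
    { toFun := Prod.fst
      invFun := fun x => (x, 0)
      map_add' := fun x y => rfl
      map_smul' := fun c x => rfl
      left_inv := fun ⟨x, y⟩ => rfl
      right_inv := fun x => rfl
      continuous_toFun := by fun_prop
      continuous_invFun := by fun_prop }⟩

theorem IsTate.of_retract {M E : Type u} [AddCommGroup M] [Module R M] [TopologicalSpace M]
    [AddCommGroup E] [Module R E] [TopologicalSpace E] [IsTopologicalAddGroup E]
    (hE : IsElementary R E) (i : M →L[R] E) (r : E →L[R] M) (h : ∀ x, r (i x) = x) :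
    IsTate R M :=
  ⟨r.ker, inferInstance, inferInstance, inferInstance,
    hE.of_equiv (ContinuousLinearEquiv.equivOfRightInverse r i h).symm⟩

theorem IsElementary.prod {M N : Type u} [AddCommGroup M] [Module R M] [TopologicalSpace M]
    [AddCommGroup N] [Module R N] [TopologicalSpace N] (h : IsElementary R M)
    (h' : IsElementary R N) : IsElementary R (M × N) := by
  obtain ⟨D, ⟨e⟩⟩ := h
  obtain ⟨D', ⟨e'⟩⟩ := h'
  refine (isElementary_disc_prod_dual (D.P × D'.P) (D.Q × D'.Q)).of_equiv
    ((e.prodCongr e').trans ?_)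
  exact
    { toFun := fun x => ((D.fstL x.1, D'.fstL x.2),
        Dual.map (LinearMap.fst _ _ _) (D.sndL x.1) + Dual.map (LinearMap.snd _ _ _) (D'.sndL x.2))
      invFun := fun y =>
        (D.inlL (Prod.fst y.1) + D.inrL (Dual.map (LinearMap.inl _ _ _) y.2),
          D'.inlL (Prod.snd y.1) + D'.inrL (Dual.map (LinearMap.inr _ _ _) y.2))
      map_add' := fun x y => by
        refine Prod.ext rfl ?_
        simp only [Prod.fst_add, Prod.snd_add, map_add]
        abel
      map_smul' := fun c x => by
        refine Prod.ext rfl ?_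
        simp only [Prod.smul_fst, Prod.smul_snd, map_smul, smul_add, RingHom.id_apply]
      left_inv := fun x => by
        refine Prod.ext ?_ ?_
        · conv_rhs => rw [← D.inl_fst_add x.1]
          refine congrArg (fun z => D.inlL (D.fstL x.1) + D.inrL z) (Dual.ext fun q => ?_)
          exact (congrArg _ (LinearMap.map_zero (D'.sndL x.2).toHom)).trans (add_zero _)
        · conv_rhs => rw [← D'.inl_fst_add x.2]
          refine congrArg (fun z => D'.inlL (D'.fstL x.2) + D'.inrL z) (Dual.ext fun q => ?_)
          exact (congrArg (· + D'.sndL x.2 q)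
            (LinearMap.map_zero (D.sndL x.1).toHom)).trans (zero_add _)
      right_inv := fun y => by
        refine Prod.ext (Prod.ext (add_zero _) (add_zero _)) ?_
        ext q
        change (0 + y.2 (q.1, 0)) + (0 + y.2 (0, q.2)) = y.2 q
        rw [zero_add, zero_add, ← Dual.map_add]
        simp
      continuous_toFun := by
        have h1 : Continuous fun x : D.Space × D'.Space => (D.fstL x.1, D'.fstL x.2) := by fun_prop
        exact ((Disc.prodEquiv (R := R)).continuous.comp h1).prodMk (by fun_prop)
      continuous_invFun := by
        have h1 : Continuous fun y : Disc (D.P × D'.P) => (show Disc D.P from Prod.fst y) :=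
          continuous_of_discreteTopology
        have h2 : Continuous fun y : Disc (D.P × D'.P) => (show Disc D'.P from Prod.snd y) :=
          continuous_of_discreteTopology
        refine Continuous.prodMk ?_ ?_
        · exact (D.inlL.continuous.comp (h1.comp continuous_fst)).add (by fun_prop)
        · exact (D'.inlL.continuous.comp (h2.comp continuous_fst)).add (by fun_prop) }

theorem IsTate.prod {M N : Type u} [AddCommGroup M] [Module R M] [TopologicalSpace M]
    [AddCommGroup N] [Module R N] [TopologicalSpace N] (h : IsTate R M)
    (h' : IsTate R N) : IsTate R (M × N) := by
  obtain ⟨M', _, _, _, h⟩ := h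
  obtain ⟨N', _, _, _, h'⟩ := h'
  exact ⟨M' × N', inferInstance, inferInstance, inferInstance,
    (h.prod h').of_equiv (ContinuousLinearEquiv.prodProdProdComm R M N M' N')⟩

theorem IsTate.of_prod_left {M N : Type u} [AddCommGroup M] [Module R M] [TopologicalSpace M]
    [AddCommGroup N] [Module R N] [TopologicalSpace N] (h : IsElementary R (M × N)) :
    IsTate R N :=
  ⟨M, inferInstance, inferInstance, inferInstance, h.of_equiv (ContinuousLinearEquiv.prodComm R N M)⟩

instance : Module.Projective Rᵐᵒᵖ R :=
  Module.Projective.of_equiv (MulOpposite.opLinearEquiv Rᵐᵒᵖ : R ≃ₗ[Rᵐᵒᵖ] Rᵐᵒᵖ).symm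

instance {A M : Type*} [Ring A] [AddCommGroup M] [Module A M] [Module.Projective A M] (n : ℕ) :
    Module.Projective A (Fin n → M) :=
  Module.Projective.of_equiv (Finsupp.linearEquivFunOnFinite A M (Fin n))

/-- The pairing `a, c ↦ ∑ aⱼ cⱼ` as a homomorphism from `Rⁿ` to the dual of `Rⁿ`. -/
def dualDot (n : ℕ) : (Fin n → R) →ₗ[R] Dual R (Fin n → R) where
  toFun a := ({ toFun := fun c => ∑ j, a j * c j
                map_add' := fun c c' => by simp [mul_add, Finset.sum_add_distrib]
                map_smul' := fun r c => by simp [Finset.sum_mul, mul_assoc] } :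
              (Fin n → R) →ₗ[Rᵐᵒᵖ] R)
  map_add' a a' := Dual.ext fun c => by
    change ∑ j, (a j + a' j) * c j = ∑ j, a j * c j + ∑ j, a' j * c j
    simp [add_mul, Finset.sum_add_distrib]
  map_smul' r a := Dual.ext fun c => by
    change ∑ j, (r * a j) * c j = r * ∑ j, a j * c j
    simp [Finset.mul_sum, mul_assoc]

theorem dualDot_apply (n : ℕ) (a c : Fin n → R) : dualDot n a c = ∑ j, a j * c j := rfl

/-- A topological direct summand of `P ⊕ Q*` whose projection to `P` is contained in a finitely
generated submodule is the dual of a projective module. -/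
theorem exists_equiv_dual_of_hasFGImage (D : ElementaryData R) {L : Type u} [AddCommGroup L]
    [Module R L] [TopologicalSpace L] (i : L →L[R] D.Space) (r : D.Space →L[R] L)
    (h : ∀ x, r (i x) = x) (hi : HasFGImage (D.fstL.comp i : L →ₗ[R] Disc D.P)) :
    ∃ (Q : Type u) (_ : AddCommGroup Q) (_ : Module Rᵐᵒᵖ Q) (_ : Module.Projective Rᵐᵒᵖ Q),
      Nonempty (L ≃L[R] Dual R Q) := by
  obtain ⟨F, hF, hiF⟩ := hi
  -- Only `F` is seen by `L`, so `P` can be replaced by R^n. As R^n is its own dual, `L` becomes a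
  -- retract of the dual of R^n ⊕ Q, and the summand theorem for duals applies.
  obtain ⟨n, α, β, hαβ⟩ := exists_retract_on_fg hF
  let i' : L →L[R] Dual R ((Fin n → R) × D.Q) :=
    { toFun := fun x => Dual.map (LinearMap.fst _ _ _) (dualDot n (α (D.fstL (i x)))) +
        Dual.map (LinearMap.snd _ _ _) (D.sndL (i x))
      map_add' := fun x y => by
        simp only [map_add]
        abel
      map_smul' := fun c x => by simp
      cont := by
        have h1 : Continuous fun a : Disc D.P => dualDot n (α a) := continuous_of_discreteTopology
        have h2 := h1.comp (D.fstL.comp i).continuous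
        refine Continuous.add ((Dual.map _).continuous.comp h2) (by fun_prop) }
  let coord : Dual R ((Fin n → R) × D.Q) →L[R] Disc D.P :=
    { toFun := fun f => β fun j => f (Pi.single j 1, 0)
      map_add' := fun f g => (congrArg β rfl).trans (β.map_add _ _)
      map_smul' := fun c f => (congrArg β rfl).trans (β.map_smul _ _)
      cont := by
        have h1 : Continuous fun (f : Dual R ((Fin n → R) × D.Q)) (j : Fin n) =>
            Dual.eval R ((Pi.single j 1, 0) : (Fin n → R) × D.Q) f := by fun_prop
        have h2 : Continuous fun y : Fin n → Disc R => (show Disc D.P from β y) :=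
          continuous_of_discreteTopology
        exact h2.comp h1 }
  let r' : Dual R ((Fin n → R) × D.Q) →L[R] L :=
    r.comp (D.inlL.comp coord + D.inrL.comp (Dual.map (LinearMap.inr _ _ _)))
  refine Dual.exists_equiv_of_retract i' r' fun x => ?_
  have h1 : coord (i' x) = D.fstL (i x) := by
    refine Eq.trans ?_ (hαβ _ (hiF ⟨x, rfl⟩))
    refine congrArg β (funext fun j => ?_)
    change dualDot n (α (D.fstL (i x))) (Pi.single j 1) + D.sndL (i x) 0 = _
    have h0 : D.sndL (i x) 0 = 0 := LinearMap.map_zero (D.sndL (i x)).toHom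
    rw [h0, add_zero, dualDot_apply]
    simp [Pi.single_apply]
  have h2 : Dual.map (LinearMap.inr _ _ _) (i' x) = D.sndL (i x) := by
    ext q
    change dualDot n (α (D.fstL (i x))) 0 + D.sndL (i x) q = _
    simp [dualDot_apply]
  change r (D.inlL (coord (i' x)) + D.inrL (Dual.map (LinearMap.inr _ _ _) (i' x))) = x
  rw [h1, h2, D.inl_fst_add, h]

/-- A direct summand of `P ⊕ Q*` which contains `Q*` is elementary. -/
theorem isElementary_of_retract_of_contains_dual (D : ElementaryData R) {N : Type u}
    [AddCommGroup N] [Module R N] [TopologicalSpace N] (i : N →L[R] D.Space) (r : D.Space →L[R] N)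
    (h : ∀ x, r (i x) = x) (hQ : ∀ f, i (r (D.inrL f)) = D.inrL f) : IsElementary R N := by
  -- The idempotent `i ∘ r` fixes Q*, hence induces an honest idempotent `a` on the quotient `P`;
  -- the target is `a.range` plus Q*.
  let a : D.P →ₗ[R] D.P := (D.fstL.comp (i.comp (r.comp D.inlL)) : Disc D.P →ₗ[R] Disc D.P)
  have ha : ∀ x, D.fstL (i (r x)) = a (D.fstL x) := fun x => by
    conv_lhs => rw [← D.inl_fst_add x, map_add, map_add, map_add, hQ]
    exact add_zero _
  -- Write ir(y) = a(y) + w with w in Q*. Applying ir again gives ir(y) = ir(a(y)) + w, so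
  -- comparison of the Q* components shows that ir(a(y)) has none.
  have ha' : ∀ y, D.sndL (i (r (D.inlL (a y)))) = 0 := fun y => by
    have h1 : i (r (i (r (D.inlL y)))) = i (r (D.inlL y)) := by rw [h]
    have h2 := congrArg D.sndL h1
    conv_lhs at h2 => rw [← D.inl_fst_add (i (r (D.inlL y))), map_add, map_add, map_add, hQ]
    exact add_eq_right.1 h2
  have haa : ∀ y, a (a y) = a y := fun y => by
    have h1 : i (r (i (r (D.inlL y)))) = i (r (D.inlL y)) := by rw [h]
    exact (ha _).symm.trans (congrArg D.fstL h1)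
  have e : a.rangeRestrict ∘ₗ a.range.subtype = LinearMap.id := by
    ext ⟨_, x, rfl⟩
    exact haa x
  have : Module.Projective R a.range := Module.Projective.of_split _ _ e
  have hir : ∀ y ∈ a.range, ∀ f, i (r (D.inlL y + D.inrL f)) = D.inlL y + D.inrL f := by
    rintro _ ⟨y, rfl⟩ f
    rw [map_add, map_add, hQ]
    congr 1
    rw [← D.inl_fst_add (i _), ha', map_zero, add_zero]
    congr 1
    exact haa y
  let ρ : Disc D.P →L[R] Disc a.range := Disc.lift (M := Disc a.range) a.rangeRestrict
  let ι : Disc a.range →L[R] Disc D.P := Disc.lift (M := Disc D.P) a.range.subtype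
  have hιρ : ∀ x, ι (ρ (D.fstL (i x))) = D.fstL (i x) := fun x =>
    (ha (i x)).symm.trans (by rw [h])
  have hρι : ∀ y, ρ (ι y) = y := LinearMap.congr_fun e
  have hir : ∀ (y : Disc a.range) (f : Dual R D.Q),
      i (r (D.inlL (ι y) + D.inrL f)) = D.inlL (ι y) + D.inrL f := by
    rintro ⟨_, y, rfl⟩ f
    exact hir (a y) ⟨y, rfl⟩ f
  exact (isElementary_disc_prod_dual a.range D.Q).of_equiv
    { toFun := fun x => (ρ (D.fstL (i x)), D.sndL (i x))
      invFun := fun y => r (D.inlL (ι y.1) + D.inrL y.2)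
      map_add' := fun x y => by simp
      map_smul' := fun c x => by simp
      left_inv := fun x => by
        change r (D.inlL (ι (ρ (D.fstL (i x)))) + D.inrL (D.sndL (i x))) = x
        rw [hιρ, D.inl_fst_add, h]
      right_inv := fun y => by
        refine Prod.ext ?_ ?_
        · refine Eq.trans ?_ (hρι y.1)
          exact congrArg ρ ((congrArg D.fstL (hir y.1 y.2)).trans (add_zero _))
        · exact (congrArg D.sndL (hir y.1 y.2)).trans (zero_add _)
      continuous_toFun := by fun_prop
      continuous_invFun := by fun_prop }

end Elementary

end

section

variable {R : Type u} [Ring R]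

/-! ### The functor to the Calkin category: fullness and vanishing of morphisms. -/

section PhiProperties

variable {M M' : TateModule R}

theorem calkinMk_discretePart_idem (p : M.Presentation) :
    calkinMk (discretePart (p.i.comp p.r)) ≫ calkinMk (discretePart (p.i.comp p.r)) =
      calkinMk (discretePart (p.i.comp p.r)) := p.toCalkin.idem

theorem cls_eq_calkinClass (p : M.Presentation) :
    M.cls = calkinClass (discretePart (p.i.comp p.r)) (calkinMk_discretePart_idem p) :=
  K0.of_eq_of_iso (TateModule.Presentation.toCalkinIso M.presentation p)

/-- Presented by itself, P ⊕ Q* gives the identity of `P`, which the swindle kills. -/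
theorem cls_eq_zero_of_isElementary (h : IsElementary R M) : M.cls = 0 := by
  obtain ⟨D, ⟨e⟩⟩ := h
  let p : M.Presentation := ⟨D, e, e.symm, e.symm_apply_apply⟩
  have h1 : p.i.comp p.r = ContinuousLinearMap.id R D.Space := by
    ext x
    exact e.apply_symm_apply x
  rw [cls_eq_calkinClass p, ← calkinClass_id (P := D.P)]
  apply calkinClass_congr
  rw [h1]
  rfl

/-- A discrete projective module as a Tate module. -/
def discTate (P : Type u) [AddCommGroup P] [Module R P] [Module.Projective R P] : TateModule R :=
  ⟨Disc P, (isElementary_disc P).isTate⟩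

/-- The image of a discrete projective module in the Calkin category. -/
def phiDiscTateIso (P : Type u) [AddCommGroup P] [Module R P] [Module.Projective R P] :
    (Phi R).obj (discTate P) ≅ calkinImage (LinearMap.id : P →ₗ[R] P) (calkinMk_idem rfl) :=
  let D : ElementaryData R := ⟨P, PUnit.{u + 1}⟩
  TateModule.Presentation.toCalkinIso _ (⟨D, D.inlL, D.fstL, fun _ => rfl⟩ :
    (discTate P : TateModule R).Presentation)

/-- A representative P → P' extends by zero on the duals; compressing by the retractions does not
change the morphism, since a morphism of the idempotent completion absorbs the idempotents. -/
instance : (Phi R).Full where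
  map_surjective {M M'} φ := by
    let p := M.presentation
    let p' := M'.presentation
    obtain ⟨a, ha⟩ := calkinMk_surjective (P := p.D.P) (P' := p'.D.P) φ.f
    let F : p.D.Space →L[R] p'.D.Space :=
      p'.D.inlL.comp ((Disc.lift (M := Disc p'.D.P) a).comp p.D.fstL)
    let f : M →L[R] M' := p'.r.comp (F.comp p.i)
    refine ⟨f, Idempotents.Karoubi.hom_ext _ _ ?_⟩
    have hF : (Psi R).map (X := p.D) (Y := p'.D) F = φ.f := ha
    rw [← φ.comm, ← hF]
    change (Psi R).map _ = (Psi R).map _ ≫ (Psi R).map _ ≫ (Psi R).map _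
    rw [← Functor.map_comp, ← Functor.map_comp]
    rfl

theorem HasFGImage.of_comp_surjective {M N N' : Type*} [AddCommGroup M] [Module R M]
    [AddCommGroup N] [Module R N] [AddCommGroup N'] [Module R N'] {f : N →ₗ[R] N'} {g : M →ₗ[R] N}
    (hg : Function.Surjective g) (h : HasFGImage (f ∘ₗ g)) : HasFGImage f := by
  obtain ⟨F, hF, h⟩ := h
  refine ⟨F, hF, ?_⟩
  rintro _ ⟨x, rfl⟩
  obtain ⟨y, rfl⟩ := hg x
  exact h ⟨y, rfl⟩

theorem HasFGImage.of_finite {M N : Type*} [AddCommGroup M] [Module R M] [Module.Finite R M]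
    [AddCommGroup N] [Module R N] (f : M →ₗ[R] N) : HasFGImage f :=
  ⟨f.range, by rw [LinearMap.range_eq_map]; exact Module.Finite.fg_top.map f, le_rfl⟩

/-- Boundedness has to be checked only on `P`, since on the dual summand it follows from continuity.
-/
theorem ElementaryData.hasFGImage_of_comp_inP (D : ElementaryData R) {P : Type u} [AddCommGroup P]
    [Module R P] (φ : D.Space →L[R] Disc P)
    (h : HasFGImage ((φ : D.Space →ₗ[R] Disc P) ∘ₗ D.inP)) :
    HasFGImage (φ : D.Space →ₗ[R] Disc P) := by
  have h1 := Dual.hasFGImage_of_continuous (φ.comp D.inrL)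
  have h2 := (h.comp_right D.prP).add
    (h1.comp_right (D.sndL : D.Space →ₗ[R] Dual R D.Q))
  convert h2 using 1
  ext x
  change φ x = φ (D.inlL (D.fstL x)) + φ (D.inrL (D.sndL x))
  rw [← map_add, D.inl_fst_add]

/-- A homomorphism which vanishes in the Calkin category is bounded. -/
theorem hasFGImage_of_phi_map_eq_zero {h : M ⟶ M'} (h0 : (Phi R).map h = 0) {P : Type u}
    [AddCommGroup P] [Module R P] (φ : M' →L[R] Disc P) :
    HasFGImage ((φ.comp (show M →L[R] M' from h) : M →L[R] Disc P) : M →ₗ[R] Disc P) := by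
  let p := M.presentation
  let p' := M'.presentation
  let h' : M →L[R] M' := h
  have h1 : calkinMk (discretePart (p'.i.comp (h'.comp p.r))) = 0 :=
    congrArg Idempotents.Karoubi.Hom.f h0
  rw [calkinMk_eq_zero_iff] at h1
  have h2 : HasFGImage (((p'.D.fstL.comp (p'.i.comp (h'.comp p.r))) : p.D.Space →L[R] Disc p'.D.P) :
      p.D.Space →ₗ[R] Disc p'.D.P) := p.D.hasFGImage_of_comp_inP _ h1
  let ψ : p'.D.Space →L[R] Disc P := φ.comp p'.r
  have h3 := h2.comp_left ((ψ.comp p'.D.inlL : Disc p'.D.P →L[R] Disc P) :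
    Disc p'.D.P →ₗ[R] Disc P)
  -- The part of the map passing through the dual of `p'.D.Q` is bounded whatever `h` is; the
  -- hypothesis on `h` is needed only for the part through `p'.D.P`.
  have h4 := (Dual.hasFGImage_of_continuous (ψ.comp p'.D.inrL)).comp_right
    (p'.D.sndL.comp (p'.i.comp (h'.comp p.r)) : p.D.Space →ₗ[R] Dual R p'.D.Q)
  have hs : Function.Surjective (p.r : p.D.Space →ₗ[R] M) := fun x => ⟨p.i x, p.r_i x⟩
  refine HasFGImage.of_comp_surjective hs ?_
  convert h3.add h4 using 1
  ext x
  change φ (h' (p.r x)) = ψ (p'.D.inlL (p'.D.fstL (p'.i (h' (p.r x))))) +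
    ψ (p'.D.inrL (p'.D.sndL (p'.i (h' (p.r x)))))
  rw [← map_add, p'.D.inl_fst_add]
  exact congrArg φ (p'.r_i _).symm

end PhiProperties

/-! ### Class zero is equivalent to quasi-elementary. -/

section QuasiElementary

/-- A Tate module whose image in the Calkin category comes from a discrete projective module is
quasi-elementary. -/
theorem isQuasiElementary_of_phi_iso {M : TateModule R} {P : Type u} [AddCommGroup P] [Module R P]
    [Module.Projective R P] (e : (Phi R).obj M ≅ (Phi R).obj (discTate P)) :
    IsQuasiElementary R M := by
  obtain ⟨f', hf⟩ := (Phi R).map_surjective e.hom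
  obtain ⟨g', hg⟩ := (Phi R).map_surjective e.inv
  have hfg := hasFGImage_of_phi_map_eq_zero (h := 𝟙 _ - g' ≫ f')
    (by rw [Functor.map_sub, Functor.map_comp, hf, hg]; simp)
    (ContinuousLinearMap.id R (Disc P))
  have hgf : (Phi R).map (𝟙 _ - f' ≫ g') = 0 := by
    rw [Functor.map_sub, Functor.map_comp, hf, hg]; simp
  let f : M →L[R] Disc P := f'
  let g : Disc P →L[R] M := g'
  obtain ⟨F, hF, hfg⟩ := hfg
  replace hfg : ∀ y : Disc P, y - f (g y) ∈ F := fun y => hfg ⟨y, rfl⟩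
  -- The defect 1 - fg takes values in `F`, on which βα is the identity. Adjoining R^n to `M`
  -- therefore makes s = (f, β) split surjective, with section t = (g, α(1 - fg)).
  obtain ⟨n, α, β, hαβ⟩ := exists_retract_on_fg (P := Disc P) hF
  let N := M × Disc (Fin n → R)
  let βL : Disc (Fin n → R) →L[R] Disc P := Disc.lift (M := Disc P) β
  let s : N →L[R] Disc P := f.comp (ContinuousLinearMap.fst R _ _) +
    βL.comp (ContinuousLinearMap.snd R _ _)
  let αL : Disc P →L[R] Disc (Fin n → R) := Disc.lift (P := Disc P) (M := Disc (Fin n → R)) α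
  let t : Disc P →L[R] N := g.prod (αL.comp (ContinuousLinearMap.id R _ - f.comp g))
  have hst : ∀ y, s (t y) = y := fun y => by
    have : β (α (y - f (g y))) = y - f (g y) := hαβ _ (hfg y)
    change f (g y) + β (α (y - f (g y))) = y
    rw [this, add_sub_cancel]
  let E : N ≃L[R] Disc P × s.ker := ContinuousLinearEquiv.equivOfRightInverse s t hst
  have hN : IsTate R N := M.isTate.prod (isElementary_disc _).isTate
  obtain ⟨D, i, r, hri, -⟩ := hN.exists_retract
  let iL : s.ker →L[R] D.Space := i.comp s.ker.subtypeL
  let rL : D.Space →L[R] s.ker := (ContinuousLinearMap.snd R _ _).comp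
    ((E : N →L[R] Disc P × s.ker).comp r)
  have hL : ∀ x, rL (iL x) = x := fun x => by
    have h1 : r (i x.1) = x.1 := DFunLike.congr_fun hri x.1
    change (E (r (i x.1))).2 = x
    rw [h1]
    refine Subtype.ext ?_
    change x.1 - t (s x.1) = x.1
    have h2 : s x.1 = 0 := x.2
    rw [h2, map_zero, sub_zero]
  -- On the kernel f(x₁) = -β(x₂), hence x = (x₁ - gf(x₁), 0) + (-gβ(x₂), x₂). The first term
  -- becomes bounded after projection to `D.P` because 1 - gf dies under Φ; the second factors
  -- through R^n.
  have hfin : HasFGImage (D.fstL.comp iL : s.ker →ₗ[R] Disc D.P) := by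
    let φ : N →L[R] Disc D.P := D.fstL.comp i
    have h1 := hasFGImage_of_phi_map_eq_zero hgf (φ.comp (ContinuousLinearMap.inl R M _))
    have : Module.Finite R (Disc (Fin n → R)) := inferInstanceAs (Module.Finite R (Fin n → R))
    have h2 := HasFGImage.of_finite (M := Disc (Fin n → R)) (φ.comp
      (((-(g.comp βL)).prod (ContinuousLinearMap.id R _)) : Disc (Fin n → R) →L[R] N) :
        Disc (Fin n → R) →ₗ[R] Disc D.P)
    have h3 := (h1.comp_right (LinearMap.fst R M (Disc (Fin n → R)) ∘ₗ s.ker.subtype)).add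
      (h2.comp_right (LinearMap.snd R M (Disc (Fin n → R)) ∘ₗ s.ker.subtype))
    convert h3 using 1
    ext ⟨x, hx⟩
    have hx : f x.1 + βL x.2 = 0 := hx
    change φ x = φ (x.1 - g (f x.1), 0) + φ (-(g (βL x.2)), x.2)
    rw [← map_add, Prod.mk_add_mk, eq_neg_of_add_eq_zero_left hx]
    simp
  obtain ⟨Q, _, _, _, ⟨e'⟩⟩ := exists_equiv_dual_of_hasFGImage D iL rL hL hfin
  exact ⟨n, (isElementary_disc_prod_dual P Q).of_equiv
    (E.trans ((ContinuousLinearEquiv.refl R _).prodCongr e'))⟩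

/-- If the direct sum of `M` and a discrete free module is elementary, then `M` is
quasi-elementary. -/
theorem isQuasiElementary_of_prod_free {M : TateModule R} {S : Type u}
    (h : IsElementary R (M × Disc (S →₀ R))) : IsQuasiElementary R M := by
  obtain ⟨D, ⟨e⟩⟩ := h
  let eL : M × Disc (S →₀ R) →L[R] D.Space := e
  let eR : D.Space →L[R] M × Disc (S →₀ R) := e.symm
  -- The image of the dual in the free summand lies in a finitely generated `F`, contained in a
  -- coordinate summand R^n. Replacing the free module by R^n leaves a direct summand that still
  -- contains the whole dual.
  let φ : Dual R D.Q →L[R] Disc (S →₀ R) :=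
    (ContinuousLinearMap.snd R M (Disc (S →₀ R))).comp (eR.comp D.inrL)
  obtain ⟨F, hF, hφ⟩ := Dual.hasFGImage_of_continuous φ
  obtain ⟨n, α, β, hαβ, hβα⟩ := exists_retract_on_fg_finsupp (A := R) (S := S) hF
  let αL : Disc (S →₀ R) →L[R] Disc (Fin n → R) := Disc.lift (M := Disc (Fin n → R)) α
  let βL : Disc (Fin n → R) →L[R] Disc (S →₀ R) := Disc.lift (M := Disc (S →₀ R)) β
  refine ⟨n, isElementary_of_retract_of_contains_dual D
    (N := M × Disc (Fin n → R))
    (eL.comp ((ContinuousLinearMap.id R M).prodMap βL))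
    (((ContinuousLinearMap.id R M).prodMap αL).comp eR) (fun x => ?_) fun f => ?_⟩
  · change ((e.symm (e (x.1, βL x.2))).1, αL (e.symm (e (x.1, βL x.2))).2) = x
    rw [e.symm_apply_apply]
    exact Prod.ext rfl (hβα x.2)
  · have h1 : βL (αL (eR (D.inrL f)).2) = (eR (D.inrL f)).2 := hαβ _ (hφ ⟨f, rfl⟩)
    change e ((eR (D.inrL f)).1, βL (αL (eR (D.inrL f)).2)) = D.inrL f
    rw [h1]
    exact e.apply_symm_apply _

/-- The direct sum of two Tate modules. -/
def TateModule.prod (M N : TateModule R) : TateModule R := ⟨M × N, M.isTate.prod N.isTate⟩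

/-- The direct sum of two Tate modules as a bicone. -/
def TateModule.prodBicone (M N : TateModule R) : BinaryBicone M N where
  pt := M.prod N
  fst := ContinuousLinearMap.fst R M N
  snd := ContinuousLinearMap.snd R M N
  inl := ContinuousLinearMap.inl R M N
  inr := ContinuousLinearMap.inr R M N
  inl_fst := rfl
  inl_snd := rfl
  inr_fst := rfl
  inr_snd := rfl

/-- The direct sum of two Tate modules is a biproduct. -/
def TateModule.isBilimitProdBicone (M N : TateModule R) : (M.prodBicone N).IsBilimit :=
  isBinaryBilimitOfTotal _ <| by
    refine ContinuousLinearMap.ext fun x => ?_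
    exact Prod.ext (add_zero _) (zero_add _)

theorem cls_prod (M N : TateModule R) : (M.prod N).cls = M.cls + N.cls := by
  have h := K0.isAdditiveInvariant_of M N (M.prodBicone N) ⟨M.isBilimitProdBicone N⟩
  have h' := congrArg (K0.map (Phi R)) h
  rw [map_add, K0.map_of, K0.map_of, K0.map_of] at h'
  exact h'

/-- If the class vanishes, adding a free discrete module makes the image under Φ that of a discrete
module. This makes M plus a free module elementary, and the free module is then reduced to finite
rank. The converse is additivity together with the vanishing on elementary modules. -/
theorem cls_eq_zero_iff (M : TateModule R) : M.cls = 0 ↔ IsQuasiElementary R M := by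
  constructor
  · intro h
    obtain ⟨S, ⟨e⟩⟩ := exists_biprod_free_iso h
    let P := S →₀ R
    have := preservesBinaryBiproduct_of_preservesBiproduct (Phi R) M (discTate P)
    let e' : (Phi R).obj (M.prod (discTate P)) ≅ (Phi R).obj (discTate P) :=
      biprod.uniqueUpToIso _ _
          (isBinaryBilimitOfPreserves (Phi R) (M.isBilimitProdBicone (discTate P))) ≪≫
        biprod.mapIso (Iso.refl _) (phiDiscTateIso P) ≪≫ e ≪≫ (phiDiscTateIso P).symm
    obtain ⟨n, h1⟩ := isQuasiElementary_of_phi_iso e'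
    -- The stabilising free module and the extra R^n are merged into one free module before cutting
    -- down.
    let T := S ⊕ ULift.{u} (Fin n)
    refine isQuasiElementary_of_prod_free (S := T) (h1.of_equiv ?_)
    let e1 : (T →₀ R) ≃ₗ[R] (S →₀ R) × (Fin n → R) :=
      (Finsupp.sumFinsuppLEquivProdFinsupp R).trans ((LinearEquiv.refl R _).prodCongr
        ((Finsupp.domLCongr Equiv.ulift).trans (Finsupp.linearEquivFunOnFinite R R (Fin n))))
    exact ((ContinuousLinearEquiv.refl R M).prodCongr
      ((Disc.congr e1).trans Disc.prodEquiv.symm)).trans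
        (ContinuousLinearEquiv.prodAssoc R M (Disc P) (Disc (Fin n → R))).symm
  · rintro ⟨n, h⟩
    let F : TateModule R := discTate (Fin n → R)
    have h1 : (M.prod F).cls = 0 := cls_eq_zero_of_isElementary h
    have h2 : F.cls = 0 := cls_eq_zero_of_isElementary (isElementary_disc (R := R) (Fin n → R))
    rwa [cls_prod, h2, add_zero] at h1

end QuasiElementary

end

section

variable {R : Type u} [Ring R]

/-! ### K₀ of Tate modules and injectivity of the comparison map. -/

section K0Tate

theorem k0_of_prod (M N : TateModule R) : K0.of (M.prod N) = K0.of M + K0.of N :=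
  K0.isAdditiveInvariant_of M N (M.prodBicone N) ⟨M.isBilimitProdBicone N⟩

instance : HasZeroObject (TateModule R) where
  zero := ⟨discTate PUnit.{u + 1}, (IsZero.iff_id_eq_zero _).2 <|
    ContinuousLinearMap.ext fun _ => Subsingleton.elim (α := PUnit.{u + 1}) _ _⟩

/-- Isomorphic topological modules define isomorphic objects. -/
def TateModule.isoOfEquiv {M N : TateModule R} (e : M ≃L[R] N) : M ≅ N where
  hom := (e : M →L[R] N)
  inv := (e.symm : N →L[R] M)
  hom_inv_id := ContinuousLinearMap.ext e.symm_apply_apply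
  inv_hom_id := ContinuousLinearMap.ext e.apply_symm_apply

theorem k0_of_equiv {M N : TateModule R} (e : M ≃L[R] N) : K0.of M = K0.of N :=
  K0.of_eq_of_iso (TateModule.isoOfEquiv e)

/-- The homomorphism `P ⊕ Q* → P' ⊕ Q'*` defined by homomorphisms `P → P'` and `Q' → Q`. -/
def ElementaryData.map {D D' : ElementaryData R} (f : D.P →ₗ[R] D'.P) (g : D'.Q →ₗ[Rᵐᵒᵖ] D.Q) :
    D.Space →L[R] D'.Space :=
  (Disc.lift (M := Disc D'.P) f).prodMap (Dual.map g)

/-- An elementary Tate module. -/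
def ElementaryData.tate (D : ElementaryData R) : TateModule R :=
  ⟨D.Space, IsElementary.isTate ⟨D, ⟨.refl R _⟩⟩⟩

/-- The swindle inside Tate modules: both `P` and `Q` are replaced by countable direct sums, and the
transposed shift acts on the dual side, so D ⊕ D' ≅ D'. -/
theorem k0_of_isElementary {M : TateModule R} (h : IsElementary R M) : K0.of M = 0 := by
  obtain ⟨D, ⟨e⟩⟩ := h
  rw [k0_of_equiv (N := D.tate) e]
  let D' : ElementaryData R := ⟨ℕ →₀ D.P, ℕ →₀ D.Q⟩
  let b : BinaryBicone D.tate D'.tate :=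
    { pt := D'.tate
      inl := ElementaryData.map (D := D) (D' := D') (Finsupp.lsingle 0) (Finsupp.lapply 0)
      fst := ElementaryData.map (D := D') (D' := D) (Finsupp.lapply 0) (Finsupp.lsingle 0)
      inr := ElementaryData.map (D := D') (D' := D') (shiftRight R D.P) (shiftLeft _ D.Q)
      snd := ElementaryData.map (D := D') (D' := D') (shiftLeft R D.P) (shiftRight _ D.Q)
      inl_fst := ContinuousLinearMap.ext fun x => Prod.ext (Finsupp.single_eq_same)
        (Dual.ext fun q => congrArg x.2 (Finsupp.single_eq_same))
      inl_snd := ContinuousLinearMap.ext fun x => Prod.ext (shiftLeft_single_zero R D.P _)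
        (Dual.ext fun q => (congrArg x.2 (shiftRight_apply_zero _ D.Q q)).trans
          (LinearMap.map_zero (Dual.toHom x.2)))
      inr_fst := ContinuousLinearMap.ext fun x => Prod.ext (shiftRight_apply_zero R D.P _)
        (Dual.ext fun q => (congrArg x.2 (shiftLeft_single_zero _ D.Q q)).trans
          (LinearMap.map_zero (Dual.toHom x.2)))
      inr_snd := ContinuousLinearMap.ext fun x => Prod.ext (shiftLeft_shiftRight R D.P _)
        (Dual.ext fun q => congrArg x.2 (shiftLeft_shiftRight _ D.Q q)) }
  have hb : b.IsBilimit := isBinaryBilimitOfTotal b <| ContinuousLinearMap.ext fun x =>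
    Prod.ext (single_zero_add_shiftRight R D.P x.1)
      (Dual.ext fun q => (Dual.map_add x.2 _ _).symm.trans
        (congrArg x.2 (single_zero_add_shiftRight _ D.Q q)))
  have h1 := K0.isAdditiveInvariant_of _ _ b ⟨hb⟩
  exact add_eq_right.1 h1.symm

theorem exists_k0_of_add_eq_zero (M : TateModule R) :
    ∃ N : TateModule R, K0.of M + K0.of N = 0 := by
  obtain ⟨N, _, _, _, h⟩ := M.isTate
  let N' : TateModule R := ⟨N, IsTate.of_prod_left h⟩
  refine ⟨N', ?_⟩
  rw [← k0_of_prod]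
  exact k0_of_isElementary h

/-- Complements provide negatives: a Tate module and its complement have an elementary sum, of class
zero. -/
theorem exists_eq_k0_of (x : K0 (TateModule R)) : ∃ M : TateModule R, x = K0.of M := by
  induction x using K0.induction with
  | zero => exact ⟨_, (k0_of_isElementary (M := discTate R) (isElementary_disc R)).symm⟩
  | of M => exact ⟨M, rfl⟩
  | neg x h =>
    obtain ⟨M, rfl⟩ := h
    obtain ⟨N, hN⟩ := exists_k0_of_add_eq_zero M
    exact ⟨N, neg_eq_of_add_eq_zero_right hN⟩
  | add x y hx hy =>
    obtain ⟨M, rfl⟩ := hx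
    obtain ⟨N, rfl⟩ := hy
    exact ⟨_, (k0_of_prod M N).symm⟩

theorem k0_of_eq_zero_of_isQuasiElementary {M : TateModule R} (h : IsQuasiElementary R M) :
    K0.of M = 0 := by
  obtain ⟨n, h⟩ := h
  let F : TateModule R := discTate (Fin n → R)
  have h1 : K0.of (M.prod F) = 0 := k0_of_isElementary h
  have h2 : K0.of F = 0 := k0_of_isElementary (isElementary_disc (R := R) (Fin n → R))
  rwa [k0_of_prod, h2, add_zero] at h1

/-- An element of the kernel is the class of one module; that module is quasi-elementary, and such
modules vanish already in K₀. -/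
theorem k0_map_phi_injective : Function.Injective (K0.map (Phi R)) := by
  rw [injective_iff_map_eq_zero]
  intro x hx
  obtain ⟨M, rfl⟩ := exists_eq_k0_of x
  rw [K0.map_of] at hx
  exact k0_of_eq_zero_of_isQuasiElementary ((cls_eq_zero_iff M).1 hx)

end K0Tate

end

section

variable {R : Type u} [Ring R]

/-! ### Laurent polynomial modules, truncation and commutators. -/

section Toeplitz

variable {X Y Z : Type u} [AddCommGroup X] [Module R X] [AddCommGroup Y] [Module R Y]
  [AddCommGroup Z] [Module R Z]

variable (R X) in
/-- The shift of `X[t, t⁻¹] = ℤ →₀ X` by `n`, i.e. multiplication by `tⁿ`. -/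
def shift (n : ℤ) : (ℤ →₀ X) →ₗ[R] (ℤ →₀ X) := Finsupp.lmapDomain X R (· + n)

@[simp] theorem shift_single (n i : ℤ) (x : X) :
    shift R X n (Finsupp.single i x) = Finsupp.single (i + n) x := Finsupp.mapDomain_single

theorem shift_apply (n i : ℤ) (x : ℤ →₀ X) : shift R X n x i = x (i - n) := by
  have := Finsupp.mapDomain_apply (add_left_injective n) x (i - n)
  rw [sub_add_cancel] at this
  exact this

variable (R X) in
/-- The part of negative degree. -/
def negPart : (ℤ →₀ X) →ₗ[R] (ℕ →₀ X) :=
  Finsupp.lcomapDomain Int.negSucc fun _ _ h => Int.negSucc.inj h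

variable (R X) in
/-- The inclusion of the part of negative degree. -/
def ofNegPart : (ℕ →₀ X) →ₗ[R] (ℤ →₀ X) := Finsupp.lmapDomain X R Int.negSucc

theorem negPart_comp_ofNegPart : negPart R X ∘ₗ ofNegPart R X = LinearMap.id :=
  LinearMap.ext fun x => Finsupp.comapDomain_mapDomain _ (fun _ _ h => Int.negSucc.inj h) x

variable (R X) in
/-- The truncation `X[t, t⁻¹] → t⁻¹ X[t⁻¹]` as an endomorphism of `X[t, t⁻¹]`. -/
def trunc : (ℤ →₀ X) →ₗ[R] (ℤ →₀ X) := ofNegPart R X ∘ₗ negPart R X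

theorem trunc_apply_of_neg {i : ℤ} (hi : i < 0) (x : ℤ →₀ X) : trunc R X x i = x i := by
  obtain ⟨k, rfl⟩ := Int.eq_negSucc_of_lt_zero hi
  exact Finsupp.mapDomain_apply (fun _ _ h => Int.negSucc.inj h) _ k

theorem trunc_apply_of_nonneg {i : ℤ} (hi : 0 ≤ i) (x : ℤ →₀ X) : trunc R X x i = 0 := by
  refine Finsupp.mapDomain_of_notMem_range _ _ ?_
  rintro ⟨k, rfl⟩
  exact absurd hi (by simp)

theorem trunc_single_of_neg {i : ℤ} (hi : i < 0) (x : X) :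
    trunc R X (Finsupp.single i x) = Finsupp.single i x := by
  ext j
  rcases lt_or_ge j 0 with hj | hj
  · rw [trunc_apply_of_neg hj]
  · rw [trunc_apply_of_nonneg hj, Finsupp.single_eq_of_ne (by lia)]

theorem trunc_single_of_nonneg {i : ℤ} (hi : 0 ≤ i) (x : X) :
    trunc R X (Finsupp.single i x) = 0 := by
  ext j
  rcases lt_or_ge j 0 with hj | hj
  · rw [trunc_apply_of_neg hj, Finsupp.single_eq_of_ne (by lia)]; rfl
  · rw [trunc_apply_of_nonneg hj]; rfl

theorem trunc_comp_trunc : trunc R X ∘ₗ trunc R X = trunc R X := by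
  change ofNegPart R X ∘ₗ (negPart R X ∘ₗ ofNegPart R X) ∘ₗ negPart R X = _
  rw [negPart_comp_ofNegPart]
  rfl

/-- The map `X[t, t⁻¹] → Y[t, t⁻¹]` defined by `f : X → Y`. -/
def laurentMap (f : X →ₗ[R] Y) : (ℤ →₀ X) →ₗ[R] (ℤ →₀ Y) := Finsupp.mapRange.linearMap f

@[simp] theorem laurentMap_single (f : X →ₗ[R] Y) (i : ℤ) (x : X) :
    laurentMap f (Finsupp.single i x) = Finsupp.single i (f x) := by
  simp [laurentMap]

theorem laurentMap_comp (f : X →ₗ[R] Y) (g : Y →ₗ[R] Z) :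
    laurentMap (g ∘ₗ f) = laurentMap g ∘ₗ laurentMap f :=
  Finsupp.lhom_ext fun i x => by simp

theorem trunc_comp_laurentMap (f : X →ₗ[R] Y) :
    trunc R Y ∘ₗ laurentMap f = laurentMap f ∘ₗ trunc R X :=
  Finsupp.lhom_ext fun i x => by
    rcases lt_or_ge i 0 with hi | hi
    · simp [trunc_single_of_neg hi]
    · simp [trunc_single_of_nonneg hi]

/-- Compatibility with multiplication by the powers of `t`. -/
def IsShiftEquivariant (g : (ℤ →₀ X) →ₗ[R] (ℤ →₀ Y)) : Prop :=
  ∀ n x, g (shift R X n x) = shift R Y n (g x)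

namespace IsShiftEquivariant

theorem of_single {g : (ℤ →₀ X) →ₗ[R] (ℤ →₀ Y)}
    (h : ∀ n i x, g (Finsupp.single (i + n) x) = shift R Y n (g (Finsupp.single i x))) :
    IsShiftEquivariant g := fun n x => by
  have : g ∘ₗ shift R X n = shift R Y n ∘ₗ g := by
    refine Finsupp.lhom_ext fun i x => ?_
    simp [h]
  exact LinearMap.congr_fun this x

theorem comp {g : (ℤ →₀ Y) →ₗ[R] (ℤ →₀ Z)} {f : (ℤ →₀ X) →ₗ[R] (ℤ →₀ Y)}
    (hg : IsShiftEquivariant g) (hf : IsShiftEquivariant f) : IsShiftEquivariant (g ∘ₗ f) :=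
  fun n x => by rw [LinearMap.comp_apply, hf, hg]; rfl

theorem add {f g : (ℤ →₀ X) →ₗ[R] (ℤ →₀ Y)}
    (hf : IsShiftEquivariant f) (hg : IsShiftEquivariant g) : IsShiftEquivariant (f + g) :=
  fun n x => by rw [LinearMap.add_apply, hf, hg, ← map_add]; rfl

theorem sub {f g : (ℤ →₀ X) →ₗ[R] (ℤ →₀ Y)}
    (hf : IsShiftEquivariant f) (hg : IsShiftEquivariant g) : IsShiftEquivariant (f - g) :=
  fun n x => by rw [LinearMap.sub_apply, hf, hg, ← map_sub]; rfl

theorem id : IsShiftEquivariant (LinearMap.id : (ℤ →₀ X) →ₗ[R] _) := fun _ _ => rfl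

theorem laurentMap (f : X →ₗ[R] Y) : IsShiftEquivariant (laurentMap f) :=
  of_single fun n i x => by simp

theorem shift (m : ℤ) : IsShiftEquivariant (shift R X m) :=
  of_single fun n i x => by simp [add_right_comm]

/-- Maps of Laurent polynomial modules commute with the truncation modulo maps whose image is
finitely generated, if the source is finitely generated. -/
theorem hasFGImage_commutator [Module.Finite R X] {g : (ℤ →₀ X) →ₗ[R] (ℤ →₀ Y)}
    (hg : IsShiftEquivariant g) : HasFGImage (trunc R Y ∘ₗ g - g ∘ₗ trunc R X) := by
  classical
  obtain ⟨d, hd⟩ : ∃ d : ℕ, ∀ (x : X) (i : ℤ), (i < -d ∨ (d : ℤ) ≤ i) →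
      g (Finsupp.single 0 x) i = 0 := by
    obtain ⟨G, hG⟩ := Module.Finite.fg_top (R := R) (M := X)
    let T : Finset ℤ := G.biUnion fun x => (g (Finsupp.single 0 x)).support
    -- A common bound for the degrees occurring in the images of finitely many generators in degree
    -- 0; the `+ 1` makes the upper bound strict.
    refine ⟨T.sup Int.natAbs + 1, fun x i hi => ?_⟩
    have hx : x ∈ Submodule.span R (G : Set X) := by rw [hG]; trivial
    induction hx using Submodule.span_induction with
    | mem x hx =>
      by_contra hne
      have h1 : i ∈ T := Finset.mem_biUnion.2 ⟨x, hx, Finsupp.mem_support_iff.2 hne⟩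
      have h2 : i.natAbs ≤ T.sup Int.natAbs := Finset.le_sup (f := Int.natAbs) h1
      lia
    | zero => simp
    | add x y _ _ hx hy => simp [hx, hy]
    | smul c x _ hx => rw [← Finsupp.smul_single, map_smul, Finsupp.smul_apply, hx, smul_zero]
  set h := trunc R Y ∘ₗ g - g ∘ₗ trunc R X with h_def
  -- Since `g` moves degrees by at most `d`, for i outside [-d, d) the image of degree i lies
  -- entirely on the side of zero where i is, and there truncation commutes with `g`.
  have h0 : ∀ (i : ℤ) (x : X), (i < -d ∨ (d : ℤ) ≤ i) → h (Finsupp.single i x) = 0 := by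
    intro i x hi
    have e : g (Finsupp.single i x) = TateK.shift R Y i (g (Finsupp.single 0 x)) := by
      rw [← hg]; simp
    rw [h_def, LinearMap.sub_apply, LinearMap.comp_apply, LinearMap.comp_apply, sub_eq_zero]
    ext j
    rcases hi with hi | hi
    · rw [trunc_single_of_neg (by lia)]
      rcases lt_or_ge j 0 with hj | hj
      · rw [trunc_apply_of_neg hj]
      · rw [trunc_apply_of_nonneg hj, e, shift_apply, hd _ _ (by lia)]
    · rw [trunc_single_of_nonneg (by lia), map_zero]
      rcases lt_or_ge j 0 with hj | hj
      · rw [trunc_apply_of_neg hj, e, shift_apply, hd _ _ (by lia)]; rfl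
      · rw [trunc_apply_of_nonneg hj]; rfl
  refine ⟨⨆ i ∈ Finset.Ico (-(d : ℤ)) d, (h ∘ₗ Finsupp.lsingle i).range,
    Submodule.fg_biSup _ _ fun i _ => ?_, ?_⟩
  · rw [LinearMap.range_eq_map]
    exact Module.Finite.fg_top.map _
  · rintro _ ⟨x, rfl⟩
    induction x using Finsupp.induction_linear with
    | zero => rw [map_zero]; exact zero_mem _
    | add x y hx hy => rw [map_add]; exact add_mem hx hy
    | single i x =>
      by_cases hi : i ∈ Finset.Ico (-(d : ℤ)) d
      · exact Submodule.mem_iSup_of_mem i (Submodule.mem_iSup_of_mem hi ⟨x, rfl⟩)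
      · rw [h0 i x (by rw [Finset.mem_Ico] at hi; lia)]
        exact zero_mem _

theorem calkinMk_comm_trunc [Module.Finite R X] [Module.Projective R X] [Module.Projective R Y]
    {g : (ℤ →₀ X) →ₗ[R] (ℤ →₀ Y)} (hg : IsShiftEquivariant g) :
    calkinMk g ≫ calkinMk (trunc R Y) = calkinMk (trunc R X) ≫ calkinMk g := by
  rw [← calkinMk_comp, ← calkinMk_comp, calkinMk_eq_iff]
  exact hg.hasFGImage_commutator

end IsShiftEquivariant

/-! ### The clutching construction for an idempotent modulo bounded maps. -/

section ProjectiveOfIdempotent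

variable {P : Type u} [AddCommGroup P] [Module R P] {F : Type u} [AddCommGroup F] [Module R F]
  (a : P →ₗ[R] P) (j : F →ₗ[R] P) (k : P →ₗ[R] F)

/-- The operator `1 - a + t a`. -/
def clutching : (ℤ →₀ P) →ₗ[R] (ℤ →₀ P) :=
  LinearMap.id - laurentMap a + shift R P 1 ∘ₗ laurentMap a

/-- The operator `1 - a + t⁻¹ a`. -/
def clutchingInv : (ℤ →₀ P) →ₗ[R] (ℤ →₀ P) :=
  LinearMap.id - laurentMap a + shift R P (-1) ∘ₗ laurentMap a

variable (R P) in
/-- The operator `2 - t - t⁻¹`. -/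
def diffSq : (ℤ →₀ P) →ₗ[R] (ℤ →₀ P) := LinearMap.id - shift R P 1 + (LinearMap.id - shift R P (-1))

/-- The surjection `(x, z) ↦ (1 - a + t a) x + j z`. -/
def clutchingSurj : (ℤ →₀ P × F) →ₗ[R] (ℤ →₀ P) :=
  clutching a ∘ₗ laurentMap (LinearMap.fst R P F) + laurentMap (j ∘ₗ LinearMap.snd R P F)

/-- The section `y ↦ ((1 - a + t⁻¹ a) y, (2 - t - t⁻¹) k y)`. -/
def clutchingSection : (ℤ →₀ P) →ₗ[R] (ℤ →₀ P × F) :=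
  laurentMap (LinearMap.inl R P F) ∘ₗ clutchingInv a +
    laurentMap (LinearMap.inr R P F ∘ₗ k) ∘ₗ diffSq R P

/-- The map `(x, z) ↦ (k x, z)`. -/
def clutchingFinite : (ℤ →₀ P × F) →ₗ[R] (ℤ →₀ F × F) :=
  laurentMap (k.prodMap LinearMap.id)

/-- The map `(w, z) ↦ ((2 - t - t⁻¹) j w - (1 - a + t⁻¹ a) j z, z)`. -/
def clutchingOfFinite : (ℤ →₀ F × F) →ₗ[R] (ℤ →₀ P × F) :=
  laurentMap (LinearMap.inl R P F) ∘ₗ (diffSq R P ∘ₗ laurentMap (j ∘ₗ LinearMap.fst R F F) -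
    clutchingInv a ∘ₗ laurentMap (j ∘ₗ LinearMap.snd R F F)) +
      laurentMap (LinearMap.inr R P F ∘ₗ LinearMap.snd R F F)

variable {a j k}

/-- If a were idempotent, u and v would be mutually inverse; in general (1 - a)² + (t + t⁻¹)a(1 - a)
+ a² = 1 - (2 - t - t⁻¹)(a - a²), so the defect factors through `F`. -/
theorem clutching_mul_inv (h : j ∘ₗ k = a - a ∘ₗ a) :
    clutching a ∘ₗ clutchingInv a = LinearMap.id - diffSq R P ∘ₗ laurentMap (j ∘ₗ k) := by
  rw [h]
  refine Finsupp.lhom_ext fun i x => ?_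
  simp only [clutching, clutchingInv, diffSq, LinearMap.comp_apply, LinearMap.add_apply,
    LinearMap.sub_apply, LinearMap.id_apply, map_add, map_sub, laurentMap_single, shift_single,
    Finsupp.single_sub, neg_add_cancel_right]
  abel

theorem clutchingInv_mul (h : j ∘ₗ k = a - a ∘ₗ a) :
    clutchingInv a ∘ₗ clutching a = LinearMap.id - diffSq R P ∘ₗ laurentMap (j ∘ₗ k) := by
  rw [h]
  refine Finsupp.lhom_ext fun i x => ?_
  simp only [clutching, clutchingInv, diffSq, LinearMap.comp_apply, LinearMap.add_apply,
    LinearMap.sub_apply, LinearMap.id_apply, map_add, map_sub, laurentMap_single, shift_single,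
    Finsupp.single_sub, add_neg_cancel_right]
  abel

theorem laurentMap_comp_diffSq (f : X →ₗ[R] Y) :
    laurentMap f ∘ₗ diffSq R X = diffSq R Y ∘ₗ laurentMap f :=
  Finsupp.lhom_ext fun i x => by simp [diffSq]

theorem laurentMap_diffSq_laurentMap (f : X →ₗ[R] Y) (g : Y →ₗ[R] Z) :
    laurentMap g ∘ₗ diffSq R Y ∘ₗ laurentMap f = diffSq R Z ∘ₗ laurentMap (g ∘ₗ f) := by
  rw [← LinearMap.comp_assoc, laurentMap_comp_diffSq, LinearMap.comp_assoc, ← laurentMap_comp]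

theorem laurentMap_fst_section :
    laurentMap (LinearMap.fst R P F) ∘ₗ clutchingSection a k = clutchingInv a := by
  rw [clutchingSection, LinearMap.comp_add, ← LinearMap.comp_assoc, ← LinearMap.comp_assoc,
    ← laurentMap_comp, ← laurentMap_comp]
  refine Finsupp.lhom_ext fun i x => ?_
  simp [clutchingInv, diffSq]

theorem laurentMap_snd_section :
    laurentMap (LinearMap.snd R P F) ∘ₗ clutchingSection a k = diffSq R F ∘ₗ laurentMap k := by
  rw [clutchingSection, LinearMap.comp_add, ← LinearMap.comp_assoc, ← LinearMap.comp_assoc,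
    ← laurentMap_comp, ← laurentMap_comp]
  refine Finsupp.lhom_ext fun i x => ?_
  simp [clutchingInv, diffSq]

/-- The second coordinate j(2 - t - t⁻¹)k of the composite cancels exactly the defect of uv. -/
theorem clutchingSurj_comp_section (h : j ∘ₗ k = a - a ∘ₗ a) :
    clutchingSurj a j ∘ₗ clutchingSection a k = LinearMap.id := by
  rw [clutchingSurj, LinearMap.add_comp, LinearMap.comp_assoc, laurentMap_fst_section,
    clutching_mul_inv h, laurentMap_comp (LinearMap.snd R P F) j, LinearMap.comp_assoc,
    laurentMap_snd_section, laurentMap_diffSq_laurentMap, sub_add_cancel]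

/-- The correction term vanishes on the kernel of the surjection, so there the identity factors
through (F ⊕ F)[t,t⁻¹]. This makes the kernel finitely generated when `F` is, however large `P` may
be. -/
theorem clutchingOfFinite_comp_finite (h : j ∘ₗ k = a - a ∘ₗ a) :
    clutchingOfFinite a j ∘ₗ clutchingFinite k = LinearMap.id -
      laurentMap (LinearMap.inl R P F) ∘ₗ clutchingInv a ∘ₗ clutchingSurj a j := by
  have h1 : (LinearMap.id : (ℤ →₀ P × F) →ₗ[R] _) =
      laurentMap (LinearMap.inl R P F) ∘ₗ laurentMap (LinearMap.fst R P F) +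
        laurentMap (LinearMap.inr R P F ∘ₗ LinearMap.snd R P F) :=
    Finsupp.lhom_ext fun i x => by simp [← Finsupp.single_add]
  have h2 := clutchingInv_mul h
  have h3 : LinearMap.fst R F F ∘ₗ k.prodMap LinearMap.id = k ∘ₗ LinearMap.fst R P F := rfl
  have h4 : LinearMap.snd R F F ∘ₗ k.prodMap LinearMap.id = LinearMap.snd R P F := rfl
  rw [clutchingOfFinite, clutchingFinite, clutchingSurj, LinearMap.add_comp, LinearMap.comp_assoc,
    LinearMap.sub_comp, LinearMap.comp_assoc, LinearMap.comp_assoc, ← laurentMap_comp,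
    ← laurentMap_comp, ← laurentMap_comp, LinearMap.comp_assoc, LinearMap.comp_assoc,
    LinearMap.comp_assoc, h3, h4, h1, LinearMap.comp_add, ← LinearMap.comp_assoc _ (clutching a),
    h2, LinearMap.sub_comp, LinearMap.id_comp, LinearMap.comp_assoc, ← laurentMap_comp]
  simp only [LinearMap.comp_add, LinearMap.comp_sub, LinearMap.comp_assoc, ← laurentMap_comp]
  abel

/-- Away from degrees -1 and 0, truncation commutes with multiplication by t and t⁻¹, and the
identity reduces to the formula for uv. The two boundary degrees leave `a` in degree 0 and a
correction through `F`. -/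
theorem clutching_trunc_inv (h : j ∘ₗ k = a - a ∘ₗ a) :
    clutching a ∘ₗ trunc R P ∘ₗ clutchingInv a = trunc R P -
      trunc R P ∘ₗ diffSq R P ∘ₗ laurentMap (j ∘ₗ k) +
      Finsupp.lsingle 0 ∘ₗ a ∘ₗ Finsupp.lapply 0 - (Finsupp.lsingle 0 ∘ₗ j) ∘ₗ
        k ∘ₗ (Finsupp.lapply 0 - Finsupp.lapply (-1)) := by
  have h' : ∀ x, j (k x) = a x - a (a x) := LinearMap.congr_fun h
  refine Finsupp.lhom_ext fun i x => ?_
  simp only [clutching, clutchingInv, diffSq, LinearMap.comp_apply, LinearMap.add_apply,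
    LinearMap.sub_apply, LinearMap.id_apply, map_add, map_sub, laurentMap_single, shift_single,
    Finsupp.single_sub, h', Finsupp.lsingle_apply,
    Finsupp.lapply_apply]
  have hi : i < -1 ∨ i = -1 ∨ i = 0 ∨ 0 < i := by lia
  rcases hi with hi | rfl | rfl | hi
  · have e1 := fun y : P => trunc_single_of_neg (R := R) (show i < 0 by lia) y
    have e2 := fun y : P => trunc_single_of_neg (R := R) (show i + 1 < 0 by lia) y
    have e3 := fun y : P => trunc_single_of_neg (R := R) (show i + -1 < 0 by lia) y
    have e4 : (Finsupp.single i x : ℤ →₀ P) 0 = 0 := Finsupp.single_eq_of_ne (by lia)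
    have e5 : (Finsupp.single i x : ℤ →₀ P) (-1) = 0 := Finsupp.single_eq_of_ne (by lia)
    simp only [e1, e2, e3, e4, e5, map_zero, laurentMap_single, shift_single,
      Finsupp.single_zero, neg_add_cancel_right]
    abel
  · have e1 := fun y : P => trunc_single_of_neg (R := R) (show (-1 : ℤ) < 0 by lia) y
    have e2 := fun y : P => trunc_single_of_nonneg (R := R) (show (0 : ℤ) ≤ 0 by lia) y
    have e3 := fun y : P => trunc_single_of_neg (R := R) (show (-1 : ℤ) + -1 < 0 by lia) y
    have e4 : (Finsupp.single (-1) x : ℤ →₀ P) 0 = 0 := Finsupp.single_eq_of_ne (by lia)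
    simp only [e1, e2, e3, e4, Finsupp.single_eq_same, map_zero, laurentMap_single, shift_single,
      Finsupp.single_zero, neg_add_cancel_right, neg_add_cancel]
    abel
  · have e1 := fun y : P => trunc_single_of_nonneg (R := R) (show (0 : ℤ) ≤ 0 by lia) y
    have e2 := fun y : P => trunc_single_of_nonneg (R := R) (show 0 ≤ (0 : ℤ) + 1 by lia) y
    have e3 := fun y : P => trunc_single_of_neg (R := R) (show (0 : ℤ) + -1 < 0 by lia) y
    have e4 : (Finsupp.single 0 x : ℤ →₀ P) (-1) = 0 := Finsupp.single_eq_of_ne (by lia)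
    simp only [e1, e2, e3, e4, Finsupp.single_eq_same, map_zero, laurentMap_single, shift_single,
      Finsupp.single_zero, neg_add_cancel_right]
    abel
  · have e1 := fun y : P => trunc_single_of_nonneg (R := R) (show 0 ≤ i by lia) y
    have e2 := fun y : P => trunc_single_of_nonneg (R := R) (show 0 ≤ i + 1 by lia) y
    have e3 := fun y : P => trunc_single_of_nonneg (R := R) (show 0 ≤ i + -1 by lia) y
    have e4 : (Finsupp.single i x : ℤ →₀ P) 0 = 0 := Finsupp.single_eq_of_ne (by lia)
    have e5 : (Finsupp.single i x : ℤ →₀ P) (-1) = 0 := Finsupp.single_eq_of_ne (by lia)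
    simp only [e1, e2, e3, e4, e5, map_zero, Finsupp.single_zero]
    abel

/-- The second coordinate contributes Θ(2 - t - t⁻¹)jk, which cancels the same term in uΘv; what
remains beyond Θ and `a` factors through `F`. -/
theorem clutchingSurj_trunc_section (h : j ∘ₗ k = a - a ∘ₗ a) :
    clutchingSurj a j ∘ₗ trunc R (P × F) ∘ₗ clutchingSection a k = trunc R P +
      Finsupp.lsingle 0 ∘ₗ a ∘ₗ Finsupp.lapply 0 - (Finsupp.lsingle 0 ∘ₗ j) ∘ₗ
        k ∘ₗ (Finsupp.lapply 0 - Finsupp.lapply (-1)) := by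
  have e1 : laurentMap (LinearMap.fst R P F) ∘ₗ trunc R (P × F) ∘ₗ clutchingSection a k =
      trunc R P ∘ₗ clutchingInv a := by
    rw [← LinearMap.comp_assoc, ← trunc_comp_laurentMap, LinearMap.comp_assoc,
      laurentMap_fst_section]
  have e2 : laurentMap (j ∘ₗ LinearMap.snd R P F) ∘ₗ trunc R (P × F) ∘ₗ clutchingSection a k =
      trunc R P ∘ₗ diffSq R P ∘ₗ laurentMap (j ∘ₗ k) := by
    rw [← LinearMap.comp_assoc, ← trunc_comp_laurentMap, LinearMap.comp_assoc, laurentMap_comp _ j,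
      LinearMap.comp_assoc, laurentMap_snd_section, laurentMap_diffSq_laurentMap]
  rw [clutchingSurj, LinearMap.add_comp, LinearMap.comp_assoc, e1, e2, clutching_trunc_inv h]
  abel

end ProjectiveOfIdempotent

end Toeplitz

end

section

variable {R : Type u} [Ring R]

/-! ### Classes of Toeplitz operators with idempotent symbol. -/

section ToeplitzClass

theorem calkinMk_negPart_comp_ofNegPart (X : Type u) [AddCommGroup X] [Module R X]
    [Module.Projective R X] :
    calkinMk (ofNegPart R X) ≫ calkinMk (negPart R X) = 𝟙 _ := by
  rw [← calkinMk_comp, negPart_comp_ofNegPart, calkinMk_id]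

theorem calkinMk_trunc (X : Type u) [AddCommGroup X] [Module R X] [Module.Projective R X] :
    calkinMk (trunc R X) = calkinMk (negPart R X) ≫ calkinMk (ofNegPart R X) := rfl

/-- The symbol commutes with truncation modulo bounded maps, so its compression to negative degrees
remains idempotent in the Calkin category. -/
theorem calkinMk_toeplitz_idem {X : Type u} [AddCommGroup X] [Module R X] [Module.Projective R X]
    [Module.Finite R X] {q : (ℤ →₀ X) →ₗ[R] (ℤ →₀ X)} (hq : IsShiftEquivariant q)
    (hqq : q ∘ₗ q = q) :
    calkinMk (negPart R X ∘ₗ q ∘ₗ ofNegPart R X) ≫ calkinMk (negPart R X ∘ₗ q ∘ₗ ofNegPart R X) =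
      calkinMk (negPart R X ∘ₗ q ∘ₗ ofNegPart R X) := by
  have h1 := hq.calkinMk_comm_trunc
  rw [calkinMk_trunc] at h1
  have h2 := calkinMk_idem hqq
  have h3 := calkinMk_negPart_comp_ofNegPart (R := R) X
  simp only [calkinMk_comp, Category.assoc] at h1 h2 h3 ⊢
  rw [← reassoc_of% h1, h3, Category.comp_id, reassoc_of% h2]

/-- The module W[t,t⁻¹] is the direct sum of the images of fg and σs. Because `X` is finitely
generated, `f` commutes with truncation Θ modulo bounded maps, so Θ preserves the image of fg even
though `W` may be infinite. The class of Θ, which is zero, is the sum of the class on that image,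
transported to `X`, and the class sΘσ on the quotient. -/
theorem calkinClass_toeplitz_add {W V : Type u} [AddCommGroup W] [Module R W]
    [Module.Projective R W] [AddCommGroup V] [Module R V] [Module.Projective R V]
    {X : Type u} [AddCommGroup X] [Module R X] [Module.Projective R X] [Module.Finite R X]
    {f : (ℤ →₀ X) →ₗ[R] (ℤ →₀ W)} {g : (ℤ →₀ W) →ₗ[R] (ℤ →₀ X)}
    {s : (ℤ →₀ W) →ₗ[R] (ℤ →₀ V)} {σ : (ℤ →₀ V) →ₗ[R] (ℤ →₀ W)}
    (hf : IsShiftEquivariant f) (hgf : IsShiftEquivariant (g ∘ₗ f)) (hsσ : s ∘ₗ σ = LinearMap.id)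
    (hfg : f ∘ₗ g + σ ∘ₗ s = LinearMap.id) (hfgf : f ∘ₗ g ∘ₗ f = f) (hgfg : g ∘ₗ f ∘ₗ g = g)
    (hq : (g ∘ₗ f) ∘ₗ g ∘ₗ f = g ∘ₗ f) :
    ∃ h : calkinMk (s ∘ₗ trunc R W ∘ₗ σ) ≫ calkinMk (s ∘ₗ trunc R W ∘ₗ σ) =
        calkinMk (s ∘ₗ trunc R W ∘ₗ σ),
      calkinClass _ (calkinMk_toeplitz_idem hgf hq) + calkinClass _ h = 0 := by
  have cfΘ := hf.calkinMk_comm_trunc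
  have cqΘ := hgf.calkinMk_comm_trunc
  have cΘ := calkinMk_idem (trunc_comp_trunc (R := R) (X := W))
  have cΘN := calkinMk_idem (trunc_comp_trunc (R := R) (X := X))
  have cσs : calkinMk σ ≫ calkinMk s = 𝟙 _ := by rw [← calkinMk_comp, hsσ, calkinMk_id]
  have csσ : calkinMk s ≫ calkinMk σ = 𝟙 _ - calkinMk g ≫ calkinMk f := by
    rw [← calkinMk_comp, ← calkinMk_comp, ← calkinMk_id, ← hfg, calkinMk_add, add_sub_cancel_left]
  have cfgf : calkinMk f ≫ calkinMk g ≫ calkinMk f = calkinMk f := by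
    rw [← calkinMk_comp, ← calkinMk_comp, LinearMap.comp_assoc, hfgf]
  have cgfg : calkinMk g ≫ calkinMk f ≫ calkinMk g = calkinMk g := by
    rw [← calkinMk_comp, ← calkinMk_comp, LinearMap.comp_assoc, hgfg]
  have cfs : calkinMk f ≫ calkinMk s = 0 := by
    have h1 : calkinMk s ≫ calkinMk σ ≫ calkinMk s = calkinMk s := by rw [cσs, Category.comp_id]
    rw [reassoc_of% csσ, Preadditive.sub_comp, Category.id_comp, sub_eq_self] at h1
    rw [← cfgf, Category.assoc, Category.assoc, ← Category.assoc (calkinMk g), h1, comp_zero]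
  rw [calkinMk_comp] at cqΘ
  simp only [Category.assoc] at cqΘ
  have h₁ : calkinMk (trunc R W ∘ₗ f ∘ₗ g) ≫ calkinMk (trunc R W ∘ₗ f ∘ₗ g) =
      calkinMk (trunc R W ∘ₗ f ∘ₗ g) := by
    simp only [calkinMk_comp, Category.assoc, cfΘ]
    rw [reassoc_of% cqΘ, cfgf, reassoc_of% cΘN]
  have hc₂ : calkinMk (σ ∘ₗ s ∘ₗ trunc R W) = calkinMk (trunc R W) -
      calkinMk (trunc R W) ≫ calkinMk (f ∘ₗ g) := by
    rw [calkinMk_comp, calkinMk_comp, calkinMk_comp, Category.assoc, csσ, Preadditive.comp_sub,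
      Category.comp_id]
  have h₂ : calkinMk (σ ∘ₗ s ∘ₗ trunc R W) ≫ calkinMk (σ ∘ₗ s ∘ₗ trunc R W) =
      calkinMk (σ ∘ₗ s ∘ₗ trunc R W) := by
    simp only [hc₂, calkinMk_comp, Preadditive.comp_sub, Preadditive.sub_comp, Category.assoc, cΘ,
      reassoc_of% cΘ, cfΘ, reassoc_of% cfΘ, cfgf]
    abel
  -- Additivity for Θ along the image of fg. The remaining equalities `E2` to `E4` move the two
  -- summands to the operators in the statement.
  have E1 := calkinClass_eq_add (p := f ∘ₗ g) cΘ
    (by simp only [calkinMk_comp, Category.assoc, cfgf])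
    (by simp only [calkinMk_comp, Category.assoc, cfΘ, reassoc_of% cfΘ, cfgf]) h₁ h₂ rfl hc₂
  rw [calkinClass_of_idem trunc_comp_trunc] at E1
  have hb : calkinMk (trunc R X ∘ₗ g ∘ₗ f) ≫ calkinMk (trunc R X ∘ₗ g ∘ₗ f) =
      calkinMk (trunc R X ∘ₗ g ∘ₗ f) := by
    simp only [calkinMk_comp, Category.assoc]
    rw [reassoc_of% cqΘ, cqΘ, reassoc_of% cqΘ, reassoc_of% cfgf, reassoc_of% cΘN]
  have E2 := calkinClass_of_retract (b := trunc R X ∘ₗ g ∘ₗ f) (b' := trunc R W ∘ₗ f ∘ₗ g) f g hb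
    (by
      refine Eq.trans ?_ hb
      simp only [calkinMk_comp, Category.assoc]
      rw [reassoc_of% cqΘ, reassoc_of% cqΘ, reassoc_of% cfgf]) h₁
    (by simp only [calkinMk_comp, Category.assoc, cfΘ, reassoc_of% cgfg])
  -- Passage from the truncated operator on all degrees to its compression to the negative degrees.
  have E3 := calkinClass_of_retract (b := negPart R X ∘ₗ (g ∘ₗ f) ∘ₗ ofNegPart R X)
    (b' := trunc R X ∘ₗ g ∘ₗ f) (ofNegPart R X) (negPart R X) (calkinMk_toeplitz_idem hgf hq)
    (by rw [reassoc_of% calkinMk_negPart_comp_ofNegPart, calkinMk_toeplitz_idem hgf hq]) hb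
    (by
      rw [calkinMk_comp (g ∘ₗ f), calkinMk_comp f g, Category.assoc, cqΘ]
      have e : calkinMk (trunc R X) = calkinMk (trunc R X) ≫ calkinMk (trunc R X) := cΘN.symm
      rw [e, Category.assoc, ← cqΘ]
      simp only [calkinMk_comp, Category.assoc, calkinMk_trunc])
  have hbs : calkinMk (s ∘ₗ trunc R W ∘ₗ σ) ≫ calkinMk (s ∘ₗ trunc R W ∘ₗ σ) =
      calkinMk (s ∘ₗ trunc R W ∘ₗ σ) := by
    simp only [calkinMk_comp, Category.assoc, reassoc_of% csσ, Preadditive.sub_comp,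
      Category.id_comp, reassoc_of% cfΘ, cfs, comp_zero, sub_zero, reassoc_of% cΘ]
  have E4 := calkinClass_of_retract (b := s ∘ₗ trunc R W ∘ₗ σ) (b' := σ ∘ₗ s ∘ₗ trunc R W) σ s hbs
    (by rw [reassoc_of% cσs, hbs]) h₂
    (by
      rw [hc₂]
      simp only [calkinMk_comp, Category.assoc, csσ, reassoc_of% csσ, Preadditive.comp_sub,
        Preadditive.sub_comp, Category.comp_id, Category.id_comp, cfΘ, reassoc_of% cfΘ, cfgf]
      abel)
  refine ⟨hbs, ?_⟩
  rw [E3, E2, E4]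
  exact E1.symm

/-- The operator is block diagonal: Θ in negative degrees, `a` in degree 0, zero in positive
degrees. The first block is an honest idempotent, of class zero. -/
theorem calkinClass_trunc_add {P : Type u} [AddCommGroup P] [Module R P] [Module.Projective R P]
    {a : P →ₗ[R] P} (ha : calkinMk a ≫ calkinMk a = calkinMk a)
    (h : calkinMk (trunc R P + Finsupp.lsingle (0 : ℤ) ∘ₗ a ∘ₗ Finsupp.lapply (0 : ℤ)) ≫
      calkinMk (trunc R P + Finsupp.lsingle (0 : ℤ) ∘ₗ a ∘ₗ Finsupp.lapply (0 : ℤ)) =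
      calkinMk (trunc R P + Finsupp.lsingle (0 : ℤ) ∘ₗ a ∘ₗ Finsupp.lapply (0 : ℤ))) :
    calkinClass _ h = calkinClass a ha := by
  have h0 : (Finsupp.lapply (0 : ℤ) : (ℤ →₀ P) →ₗ[R] P) ∘ₗ Finsupp.lsingle (0 : ℤ) = LinearMap.id := by
    ext; simp
  let π : (ℤ →₀ P) →ₗ[R] (ℤ →₀ P) := Finsupp.lsingle (0 : ℤ) ∘ₗ Finsupp.lapply (0 : ℤ)
  have hππ : π ∘ₗ π = π := LinearMap.ext fun x => by simp [π]
  have c0 : calkinMk (Finsupp.lsingle (0 : ℤ) : P →ₗ[R] ℤ →₀ P) ≫ calkinMk (Finsupp.lapply (0 : ℤ)) = 𝟙 _ := by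
    rw [← calkinMk_comp, h0, calkinMk_id]
  have ha0 : calkinMk (Finsupp.lsingle (0 : ℤ) ∘ₗ a ∘ₗ Finsupp.lapply (0 : ℤ) : (ℤ →₀ P) →ₗ[R] (ℤ →₀ P)) ≫
      calkinMk (Finsupp.lsingle (0 : ℤ) ∘ₗ a ∘ₗ Finsupp.lapply (0 : ℤ)) =
      calkinMk (Finsupp.lsingle (0 : ℤ) ∘ₗ a ∘ₗ Finsupp.lapply (0 : ℤ)) := by
    simp only [calkinMk_comp, Category.assoc, reassoc_of% c0, reassoc_of% ha]
  have hcπ : (trunc R P + Finsupp.lsingle (0 : ℤ) ∘ₗ a ∘ₗ Finsupp.lapply (0 : ℤ)) ∘ₗ π =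
      Finsupp.lsingle (0 : ℤ) ∘ₗ a ∘ₗ Finsupp.lapply (0 : ℤ) :=
    LinearMap.ext fun x => by simp [π, trunc_single_of_nonneg]
  have hπc : π ∘ₗ (trunc R P + Finsupp.lsingle (0 : ℤ) ∘ₗ a ∘ₗ Finsupp.lapply (0 : ℤ)) =
      Finsupp.lsingle (0 : ℤ) ∘ₗ a ∘ₗ Finsupp.lapply (0 : ℤ) :=
    LinearMap.ext fun x => by simp [π, trunc_apply_of_nonneg]
  have hπcπ : π ∘ₗ Finsupp.lsingle (0 : ℤ) ∘ₗ a ∘ₗ Finsupp.lapply (0 : ℤ) =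
      Finsupp.lsingle (0 : ℤ) ∘ₗ a ∘ₗ Finsupp.lapply (0 : ℤ) :=
    LinearMap.ext fun x => by simp [π]
  have E6 := calkinClass_eq_add (p := π) (c₁ := Finsupp.lsingle (0 : ℤ) ∘ₗ a ∘ₗ Finsupp.lapply (0 : ℤ))
    (c₂ := trunc R P) h (calkinMk_idem hππ)
    (by rw [← calkinMk_comp _ π, hπc, ← calkinMk_comp, ← calkinMk_comp, hcπ, ← hcπ,
      LinearMap.comp_assoc, hππ]) ha0
    (calkinMk_idem trunc_comp_trunc) (by rw [← calkinMk_comp, hcπ])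
    (by rw [← calkinMk_comp, hπc, ← calkinMk_sub, add_sub_cancel_right])
  have E7 := calkinClass_of_retract (b := a) (b' := Finsupp.lsingle (0 : ℤ) ∘ₗ a ∘ₗ Finsupp.lapply (0 : ℤ))
    (Finsupp.lsingle (0 : ℤ)) (Finsupp.lapply (0 : ℤ)) ha (by rw [reassoc_of% c0, ha]) ha0
    (by simp only [calkinMk_comp, Category.assoc])
  rw [E6, E7, calkinClass_of_idem trunc_comp_trunc, add_zero]

theorem laurentMap_id (X : Type u) [AddCommGroup X] [Module R X] :
    laurentMap (LinearMap.id : X →ₗ[R] X) = LinearMap.id :=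
  Finsupp.lhom_ext fun i x => by simp

section Equivariance

variable {P F : Type u} [AddCommGroup P] [Module R P] [AddCommGroup F] [Module R F]
  (a : P →ₗ[R] P) (j : F →ₗ[R] P) (k : P →ₗ[R] F)

theorem isShiftEquivariant_diffSq : IsShiftEquivariant (diffSq R P) :=
  (IsShiftEquivariant.id.sub (.shift 1)).add (IsShiftEquivariant.id.sub (.shift (-1)))

theorem isShiftEquivariant_clutchingInv : IsShiftEquivariant (clutchingInv a) :=
  (IsShiftEquivariant.id.sub (.laurentMap a)).add
    ((IsShiftEquivariant.shift (-1)).comp (.laurentMap a))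

theorem isShiftEquivariant_clutchingSurj : IsShiftEquivariant (clutchingSurj a j) :=
  (((IsShiftEquivariant.id.sub (.laurentMap a)).add
    ((IsShiftEquivariant.shift 1).comp (.laurentMap a))).comp (.laurentMap _)).add (.laurentMap _)

theorem isShiftEquivariant_clutchingSection : IsShiftEquivariant (clutchingSection a k) :=
  ((IsShiftEquivariant.laurentMap _).comp (isShiftEquivariant_clutchingInv a)).add
    ((IsShiftEquivariant.laurentMap _).comp isShiftEquivariant_diffSq)

theorem isShiftEquivariant_clutchingOfFinite : IsShiftEquivariant (clutchingOfFinite a j) :=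
  ((IsShiftEquivariant.laurentMap _).comp ((isShiftEquivariant_diffSq.comp (.laurentMap _)).sub
    ((isShiftEquivariant_clutchingInv a).comp (.laurentMap _)))).add (.laurentMap _)

end Equivariance

/-- The kernel of the surjection `clutchingSurj` is the image of an idempotent matrix. -/
theorem exists_clutching_data {P : Type u} [AddCommGroup P] [Module R P]
    {a : P →ₗ[R] P} {n : ℕ} {j : (Fin n → R) →ₗ[R] P} {k : P →ₗ[R] (Fin n → R)}
    (hjk : j ∘ₗ k = a - a ∘ₗ a) :
    ∃ (N : ℕ) (f : (ℤ →₀ (Fin N → R)) →ₗ[R] (ℤ →₀ P × (Fin n → R)))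
      (g : (ℤ →₀ P × (Fin n → R)) →ₗ[R] (ℤ →₀ (Fin N → R))),
      IsShiftEquivariant f ∧ IsShiftEquivariant g ∧
      f ∘ₗ g + clutchingSection a k ∘ₗ clutchingSurj a j = LinearMap.id ∧
      f ∘ₗ g ∘ₗ f = f ∧ g ∘ₗ f ∘ₗ g = g := by
  let ε : ((Fin n → R) × (Fin n → R)) ≃ₗ[R] (Fin (n + n) → R) :=
    (LinearEquiv.sumArrowLequivProdArrow (Fin n) (Fin n) R R).symm.trans
      (LinearEquiv.funCongrLeft R R finSumFinEquiv.symm)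
  have hsσ := clutchingSurj_comp_section hjk
  have hs := isShiftEquivariant_clutchingSurj a j
  have hσ := isShiftEquivariant_clutchingSection a k
  have hδγ := clutchingOfFinite_comp_finite hjk
  generalize clutchingSurj a j = s at *
  generalize clutchingSection a k = σ at *
  -- The projection to the kernel of `s` along the image of σ.
  obtain ⟨p, hp⟩ : ∃ p, p = LinearMap.id - σ ∘ₗ s := ⟨_, rfl⟩
  have hsp : ∀ x, s (p x) = 0 := fun x => by
    have := LinearMap.congr_fun hsσ (s x)
    simp only [LinearMap.comp_apply, LinearMap.id_apply] at this
    rw [hp]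
    simp [this]
  have hpp : ∀ x, p (p x) = p x := fun x => by
    have := LinearMap.congr_fun hp (p x)
    simp only [LinearMap.sub_apply, LinearMap.comp_apply, LinearMap.id_apply, hsp, map_zero] at this
    exact this.trans (sub_zero _)
  have heq_p : IsShiftEquivariant p := hp ▸ IsShiftEquivariant.id.sub (hσ.comp hs)
  let f₀ := clutchingOfFinite a j ∘ₗ laurentMap ε.symm.toLinearMap
  let g₀ := laurentMap ε.toLinearMap ∘ₗ clutchingFinite k
  -- On the image of `p` the factorisation through R^(n+n)[t,t⁻¹] is the identity. Hence f = p f₀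
  -- and g = g₀ p satisfy fg = p, and gf is the wanted idempotent matrix.
  have hfgp : ∀ x, f₀ (g₀ (p x)) = p x := fun x => by
    have h1 := LinearMap.congr_fun (laurentMap_comp ε.toLinearMap ε.symm.toLinearMap)
      (clutchingFinite k (p x))
    have h2 : ε.symm.toLinearMap ∘ₗ ε.toLinearMap = LinearMap.id :=
      LinearMap.ext fun x => ε.symm_apply_apply x
    rw [h2, laurentMap_id] at h1
    have h3 := LinearMap.congr_fun hδγ (p x)
    simp only [LinearMap.comp_apply, LinearMap.sub_apply, hsp, map_zero, LinearMap.id_apply] at h3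
    rw [sub_zero] at h3
    exact (congrArg (clutchingOfFinite a j) h1.symm).trans h3
  refine ⟨n + n, p ∘ₗ f₀, g₀ ∘ₗ p, heq_p.comp
    ((isShiftEquivariant_clutchingOfFinite a j).comp (.laurentMap _)),
    ((IsShiftEquivariant.laurentMap _).comp (.laurentMap _)).comp heq_p, LinearMap.ext fun x => ?_,
    LinearMap.ext fun x => ?_, LinearMap.ext fun x => ?_⟩
  · simp only [LinearMap.add_apply, LinearMap.comp_apply, hfgp, hpp]
    rw [hp]
    simp
  · simp only [LinearMap.comp_apply, hfgp, hpp]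
  · simp only [LinearMap.comp_apply, hfgp, hpp]

/-- Every class of the Calkin category is, up to sign, the class of a Toeplitz operator whose symbol
is an idempotent matrix over `R[t, t⁻¹]`. -/
theorem exists_toeplitz {P : Type u} [AddCommGroup P] [Module R P] [Module.Projective R P]
    {a : P →ₗ[R] P} (ha : calkinMk a ≫ calkinMk a = calkinMk a) :
    ∃ (N : ℕ) (q : (ℤ →₀ (Fin N → R)) →ₗ[R] (ℤ →₀ (Fin N → R))) (hq : IsShiftEquivariant q)
      (hqq : q ∘ₗ q = q),
      calkinClass _ (calkinMk_toeplitz_idem hq hqq) + calkinClass a ha = 0 := by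
  -- Idempotency in the Calkin category says that a - a² is bounded, hence factors through some R^n.
  obtain ⟨n, j, k, hjk⟩ : ∃ (n : ℕ) (j : (Fin n → R) →ₗ[R] P) (k : P →ₗ[R] (Fin n → R)),
      j ∘ₗ k = a - a ∘ₗ a := by
    have h := ha.symm
    rw [← calkinMk_comp, calkinMk_eq_iff] at h
    obtain ⟨F, hF, hr⟩ := h
    obtain ⟨n, α, β, hαβ⟩ := exists_retract_on_fg hF
    exact ⟨n, β, α ∘ₗ (a - a ∘ₗ a), LinearMap.ext fun x => hαβ _ (hr ⟨x, rfl⟩)⟩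
  obtain ⟨N, f, g, hf, hg, hfg, hfgf, hgfg⟩ := exists_clutching_data hjk
  have hqq : (g ∘ₗ f) ∘ₗ g ∘ₗ f = g ∘ₗ f := by rw [LinearMap.comp_assoc, hfgf]
  obtain ⟨h, E⟩ := calkinClass_toeplitz_add hf (hg.comp hf) (clutchingSurj_comp_section hjk) hfg
    hfgf hgfg hqq
  refine ⟨N, g ∘ₗ f, hg.comp hf, hqq, ?_⟩
  -- The correction term factors through R^n, so it disappears in the Calkin category.
  have h1 : calkinMk (clutchingSurj a j ∘ₗ trunc R _ ∘ₗ clutchingSection a k) = calkinMk (trunc R P +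
      Finsupp.lsingle (0 : ℤ) ∘ₗ a ∘ₗ Finsupp.lapply (0 : ℤ)) := by
    rw [calkinMk_eq_iff, clutchingSurj_trunc_section hjk, sub_sub_cancel_left]
    have h2 : HasFGImage (Finsupp.lsingle (0 : ℤ) ∘ₗ j : (Fin n → R) →ₗ[R] (ℤ →₀ P)) :=
      HasFGImage.of_finite _
    exact (h2.comp_right _).neg
  have h2 := h
  rw [h1] at h2
  rw [calkinClass_congr h1 h h2, calkinClass_trunc_add ha] at E
  exact E

end ToeplitzClass

end

section

variable {R : Type u} [Ring R]

/-! ### Shift equivariant maps as matrices over R[t,t⁻¹]. -/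

section LaurentVec

variable (R) in
/-- Vectors of Laurent polynomials as Laurent polynomials with vector coefficients. -/
def laurentVec (N : ℕ) : (Fin N → LaurentPolynomial R) ≃ₗ[R] (ℤ →₀ (Fin N → R)) where
  toFun x := Finsupp.onFinset (Finset.univ.biUnion fun j => (x j).coeff.support)
    (fun i j => (x j).coeff i) fun i hi => by
      obtain ⟨j, hj⟩ := Function.ne_iff.1 hi
      exact Finset.mem_biUnion.2 ⟨j, Finset.mem_univ j, Finsupp.mem_support_iff.2 hj⟩
  invFun y j := AddMonoidAlgebra.ofCoeff (y.mapRange (fun v => v j) rfl)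
  map_add' x y := Finsupp.ext fun i => rfl
  map_smul' c x := Finsupp.ext fun i => rfl
  left_inv x := funext fun j => LaurentPolynomial.ext fun i => rfl
  right_inv y := Finsupp.ext fun i => rfl

@[simp] theorem laurentVec_apply {N : ℕ} (x : Fin N → LaurentPolynomial R) (i : ℤ) (j : Fin N) :
    laurentVec R N x i j = (x j).coeff i := rfl

@[simp] theorem coeff_laurentVec_symm {N : ℕ} (y : ℤ →₀ (Fin N → R)) (i : ℤ) (j : Fin N) :
    ((laurentVec R N).symm y j).coeff i = y i j := rfl

theorem laurentVec_single_smul {N : ℕ} (n : ℤ) (r : R) (x : Fin N → LaurentPolynomial R) :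
    laurentVec R N (AddMonoidAlgebra.single n r • x) = r • shift R _ n (laurentVec R N x) := by
  ext i j
  rw [Finsupp.smul_apply, Pi.smul_apply, shift_apply, laurentVec_apply, laurentVec_apply]
  have := AddMonoidAlgebra.coeff_single_mul_add (x j) r n (i - n)
  rw [add_sub_cancel] at this
  exact this

/-- The linear map of Laurent polynomial modules defined by a shift equivariant map. -/
def IsShiftEquivariant.toLinearMap {N N' : ℕ} {q : (ℤ →₀ (Fin N → R)) →ₗ[R] (ℤ →₀ (Fin N' → R))}
    (hq : IsShiftEquivariant q) :
    (Fin N → LaurentPolynomial R) →ₗ[LaurentPolynomial R] (Fin N' → LaurentPolynomial R) where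
  toFun x := (laurentVec R N').symm (q (laurentVec R N x))
  map_add' x y := by simp only [map_add]
  map_smul' a x := by
    refine (laurentVec R N').injective ?_
    rw [LinearEquiv.apply_symm_apply]
    induction a using AddMonoidAlgebra.induction_linear with
    | zero => simp
    | add a b ha hb =>
      rw [RingHom.id_apply] at ha hb ⊢
      rw [add_smul, add_smul, map_add, map_add, map_add, ha, hb]
    | single n r =>
      rw [RingHom.id_apply, laurentVec_single_smul, laurentVec_single_smul, map_smul, hq,
        LinearEquiv.apply_symm_apply]

end LaurentVec

/-! ### Extension of scalars from R[t,t⁻¹] to R((t)). -/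

section Inclusion

@[simp] theorem laurentInclusion_single (n : ℤ) (r : R) :
    laurentInclusion R (AddMonoidAlgebra.single n r) = HahnSeries.single n r := by
  refine (AddMonoidAlgebra.liftNC_single _ _ _ _).trans ?_
  change HahnSeries.C r * HahnSeries.single n 1 = _
  simp [HahnSeries.C_apply]

@[simp] theorem coeff_laurentInclusion (a : LaurentPolynomial R) (i : ℤ) :
    (laurentInclusion R a).coeff i = a.coeff i := by
  classical
  induction a using AddMonoidAlgebra.induction_linear with
  | zero => simp
  | add a b ha hb => simp [ha, hb]
  | single n r =>
    rw [laurentInclusion_single, HahnSeries.coeff_single, AddMonoidAlgebra.coeff_single,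
      Finsupp.single_apply]
    rcases eq_or_ne i n with rfl | h
    · simp
    · rw [if_neg h, if_neg h.symm]

end Inclusion

namespace LaurentExtension

variable {K : Type u} [AddCommGroup K] [Module (LaurentPolynomial R) K]

variable (R) in
/-- The element `1 ⊗ x`. -/
def of : K →+ LaurentExtension R K where
  toFun x := Submodule.Quotient.mk (1 ⊗ₜ[ℤ] x)
  map_zero' := by rw [TensorProduct.tmul_zero]; rfl
  map_add' x y := by rw [TensorProduct.tmul_add]; rfl

theorem of_smul (a : LaurentPolynomial R) (x : K) : of R (a • x) = laurentInclusion R a • of R x := by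
  have h : (((1 : LaurentSeries R) * laurentInclusion R a) ⊗ₜ[ℤ] x -
      (1 : LaurentSeries R) ⊗ₜ[ℤ] (a • x)) ∈ laurentRelations R K :=
    Submodule.subset_span ⟨1, a, x, rfl⟩
  rw [← Submodule.Quotient.eq, one_mul] at h
  refine h.symm.trans ?_
  change _ = Submodule.Quotient.mk (laurentInclusion R a • (1 ⊗ₜ[ℤ] x))
  rw [TensorProduct.smul_tmul', smul_eq_mul, mul_one]

theorem hom_ext {V : Type*} [AddCommGroup V] [Module (LaurentSeries R) V]
    {f g : LaurentExtension R K →ₗ[LaurentSeries R] V} (h : ∀ x, f (of R x) = g (of R x)) :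
    f = g := by
  refine Submodule.linearMap_qext _ (LinearMap.ext fun z => ?_)
  induction z using TensorProduct.induction_on with
  | zero => simp
  | add z z' hz hz' => rw [map_add, map_add, hz, hz']
  | tmul s x =>
    have e : (s ⊗ₜ[ℤ] x : TensorProduct ℤ (LaurentSeries R) K) = s • (1 ⊗ₜ[ℤ] x) := by
      rw [TensorProduct.smul_tmul', smul_eq_mul, mul_one]
    rw [e, map_smul, map_smul]
    exact congrArg (s • ·) (h x)

/-- The map `s ⊗ x ↦ s φ(x)`. -/
def liftTensor {V : Type*} [AddCommGroup V] [Module (LaurentSeries R) V] (φ : K →+ V) :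
    TensorProduct ℤ (LaurentSeries R) K →ₗ[LaurentSeries R] V :=
  let ψ : TensorProduct ℤ (LaurentSeries R) K →+ V :=
    TensorProduct.liftAddHom ((smulAddHom (LaurentSeries R) V).compl₂ φ) fun r m n => by
      change (r • m) • φ n = m • φ (r • n)
      rw [map_zsmul, smul_assoc, smul_comm]
  { ψ with
    map_smul' := fun c z => by
      change ψ (c • z) = c • ψ z
      induction z using TensorProduct.induction_on with
      | zero => rw [smul_zero, map_zero, smul_zero]
      | add z z' hz hz' => rw [smul_add, map_add, map_add, hz, hz', smul_add]
      | tmul s x =>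
        rw [TensorProduct.smul_tmul']
        exact mul_smul c s (φ x) }

/-- The universal property of the extension of scalars to `R((t))`. -/
def lift {V : Type*} [AddCommGroup V] [Module (LaurentSeries R) V] (φ : K →+ V)
    (hφ : ∀ a x, φ (a • x) = laurentInclusion R a • φ x) :
    LaurentExtension R K →ₗ[LaurentSeries R] V :=
  (laurentRelations R K).liftQ (liftTensor φ) <| by
    refine Submodule.span_le.2 ?_
    rintro _ ⟨s, a, x, rfl⟩
    change liftTensor φ _ = 0
    rw [map_sub, sub_eq_zero]
    change (s * laurentInclusion R a) • φ x = s • φ (a • x)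
    rw [hφ, mul_smul]

@[simp] theorem lift_of {V : Type*} [AddCommGroup V] [Module (LaurentSeries R) V] (φ : K →+ V)
    (hφ : ∀ a x, φ (a • x) = laurentInclusion R a • φ x) (x : K) : lift φ hφ (of R x) = φ x :=
  one_smul _ (φ x)

/-- The coordinates of `R((t)) ⊗ K` defined by a linear map `K → R[t, t⁻¹]^N`. -/
def toVec {N : ℕ} (α : K →ₗ[LaurentPolynomial R] (Fin N → LaurentPolynomial R)) :
    LaurentExtension R K →ₗ[LaurentSeries R] (Fin N → LaurentSeries R) :=
  lift
    { toFun := fun x j => laurentInclusion R (α x j)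
      map_zero' := by ext; simp
      map_add' := fun x y => by ext; simp }
    fun a x => by
      funext j
      simp

@[simp] theorem toVec_of {N : ℕ} (α : K →ₗ[LaurentPolynomial R] (Fin N → LaurentPolynomial R))
    (x : K) : toVec α (of R x) = fun j => laurentInclusion R (α x j) := lift_of _ _ x

/-- The map `R((t))^N → R((t)) ⊗ K` defined by a linear map `R[t, t⁻¹]^N → K`. -/
def ofVec {N : ℕ} (β : (Fin N → LaurentPolynomial R) →ₗ[LaurentPolynomial R] K) :
    (Fin N → LaurentSeries R) →ₗ[LaurentSeries R] LaurentExtension R K :=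
  ∑ j, (LinearMap.proj j).smulRight (of R (β (Pi.single j 1)))

theorem ofVec_apply {N : ℕ} (β : (Fin N → LaurentPolynomial R) →ₗ[LaurentPolynomial R] K)
    (f : Fin N → LaurentSeries R) : ofVec β f = ∑ j, f j • of R (β (Pi.single j 1)) := by
  simp [ofVec]

theorem ofVec_inclusion {N : ℕ} (β : (Fin N → LaurentPolynomial R) →ₗ[LaurentPolynomial R] K)
    (y : Fin N → LaurentPolynomial R) :
    ofVec β (fun j => laurentInclusion R (y j)) = of R (β y) := by
  rw [ofVec_apply]
  simp only [← of_smul]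
  rw [← map_sum]
  simp only [← map_smul]
  rw [← map_sum]
  congr 2
  ext1 i
  simp [Finset.sum_apply, Pi.single_apply]

/-- A retract of R[t,t⁻¹]^N remains a retract of R((t))^N after extension of scalars; linear maps
out of the extension are determined on the elements 1 ⊗ x. -/
theorem ofVec_toVec {N : ℕ} {α : K →ₗ[LaurentPolynomial R] (Fin N → LaurentPolynomial R)}
    {β : (Fin N → LaurentPolynomial R) →ₗ[LaurentPolynomial R] K} (h : ∀ x, β (α x) = x)
    (z : LaurentExtension R K) : ofVec β (toVec α z) = z := by
  have : ofVec β ∘ₗ toVec α = LinearMap.id := hom_ext fun x => by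
    rw [LinearMap.comp_apply, toVec_of, ofVec_inclusion, h]
    rfl
  exact LinearMap.congr_fun this z

end LaurentExtension

end

section

variable {R : Type u} [Ring R]

/-! ### R((t))^N as an elementary Tate module, and its direct summands. -/

section LaurentTopology

open Filter Topology

attribute [local instance] laurentTopology

theorem continuousAt_laurent_iff {X : Type*} [TopologicalSpace X] {F : X → LaurentSeries R}
    {x : X} : ContinuousAt F x ↔ ∀ n : ℤ, ∀ᶠ y in 𝓝 x, ∀ m < n, (F y).coeff m = (F x).coeff m := by
  refine ⟨fun h n => h.eventually
    (p := fun g : LaurentSeries R => ∀ m < n, g.coeff m = (F x).coeff m) ?_, fun h => ?_⟩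
  · refine IsOpen.mem_nhds (s := {g : LaurentSeries R | ∀ m < n, g.coeff m = (F x).coeff m})
      (fun f hf => ⟨n, fun g hg m hm => (hg m hm).trans (hf m hm)⟩) fun m _ => rfl
  · refine (nhds_basis_opens _).tendsto_right_iff.2 fun U hU => ?_
    obtain ⟨n, hn⟩ := hU.2 _ hU.1
    exact (h n).mono fun y hy => hn _ hy

theorem eventually_coeff_eq {N : ℕ} (f : Fin N → LaurentSeries R) (n : ℤ) :
    ∀ᶠ g in 𝓝 f, ∀ j, ∀ m < n, (g j).coeff m = (f j).coeff m :=
  eventually_all.2 fun j => continuousAt_laurent_iff.1 (continuous_apply j).continuousAt n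

theorem continuous_of_coeff_eq {N : ℕ} {X : Type*} [TopologicalSpace X] [DiscreteTopology X]
    {F : (Fin N → LaurentSeries R) → X}
    (h : ∃ n : ℤ, ∀ f g : Fin N → LaurentSeries R,
      (∀ j, ∀ m < n, (g j).coeff m = (f j).coeff m) → F g = F f) : Continuous F := by
  obtain ⟨n, hn⟩ := h
  refine continuous_iff_continuousAt.2 fun f => ?_
  refine tendsto_const_nhds.congr' ((eventually_coeff_eq f n).mono fun g hg => (hn f g hg).symm)

theorem eventually_eq_of_discrete {X Y : Type*} [TopologicalSpace X] [TopologicalSpace Y]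
    [DiscreteTopology Y] {F : X → Y} (hF : Continuous F) (x : X) : ∀ᶠ y in 𝓝 x, F y = F x :=
  (hF.tendsto x).eventually (eventually_of_mem ((isOpen_discrete {F x}).mem_nhds rfl) fun _ h => h)

theorem coeff_mul_eq_zero_of_lt {f c : LaurentSeries R} {a : ℤ} (hf : ∀ m < a, f.coeff m = 0)
    {m : ℤ} (hm : m < a + c.order) : (f * c).coeff m = 0 := by
  rw [HahnSeries.coeff_mul]
  refine Finset.sum_eq_zero fun ij hij => ?_
  obtain ⟨-, -, h⟩ := Finset.mem_antidiagonal.1 hij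
  rcases lt_or_ge ij.1 a with h1 | h1
  · rw [hf _ h1, zero_mul]
  · rw [HahnSeries.coeff_eq_zero_of_lt_order (x := c) (i := ij.2) (by lia), mul_zero]

/-- A linear form is ∑ gⱼ cⱼ for finitely many fixed series. If their orders are at least b,
coefficients of the argument up to degree n - b determine those of the value up to degree n. This
yields continuity into the weakest topology on the extension. -/
theorem continuous_linearMap_laurent {N : ℕ}
    (φ : (Fin N → LaurentSeries R) →ₗ[LaurentSeries R] LaurentSeries R) : Continuous φ := by
  refine continuous_iff_continuousAt.2 fun f => continuousAt_laurent_iff.2 fun n => ?_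
  let c : Fin N → LaurentSeries R := fun j => φ (Pi.single j 1)
  have hφ : ∀ g, φ g = ∑ j, g j * c j := fun g => by
    have : g = ∑ j, g j • Pi.single j (1 : LaurentSeries R) := by
      ext1 i
      simp [Finset.sum_apply, Pi.single_apply]
    conv_lhs => rw [this]
    simp [c]
  obtain ⟨b, hb⟩ : ∃ b : ℤ, ∀ j, b ≤ (c j).order := by
    obtain ⟨b, hb⟩ := (Set.finite_range fun j => (c j).order).bddBelow
    exact ⟨b, fun j => hb ⟨j, rfl⟩⟩
  refine (eventually_coeff_eq f (n - b)).mono fun g hg m hm => ?_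
  rw [← sub_eq_zero, ← HahnSeries.coeff_sub, ← map_sub, hφ, HahnSeries.coeff_sum]
  refine Finset.sum_eq_zero fun j _ => coeff_mul_eq_zero_of_lt (a := n - b) (fun m hm => ?_) ?_
  · rw [Pi.sub_apply, HahnSeries.coeff_sub, hg j m hm, sub_self]
  · have := hb j
    lia

variable {K : Type u} [AddCommGroup K] [Module (LaurentPolynomial R) K] {N : ℕ}

theorem LaurentExtension.smul_def (r : R) (z : LaurentExtension R K) :
    r • z = (HahnSeries.C r : LaurentSeries R) • z := rfl

/-- `LaurentExtension.toVec` as a continuous map. -/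
def LaurentExtension.toVecL
    (α : K →ₗ[LaurentPolynomial R] (Fin N → LaurentPolynomial R)) :
    LaurentExtension R K →L[R] (Fin N → LaurentSeries R) where
  toFun := toVec α
  map_add' := map_add _
  map_smul' r z := by
    rw [smul_def, map_smul]
    ext1 j
    exact HahnSeries.C_mul_eq_smul
  cont := continuous_pi fun j =>
    continuous_iInf_dom (i := LinearMap.proj j ∘ₗ toVec α) continuous_induced_dom

/-- `LaurentExtension.ofVec` as a continuous map. -/
def LaurentExtension.ofVecL
    (β : (Fin N → LaurentPolynomial R) →ₗ[LaurentPolynomial R] K) :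
    (Fin N → LaurentSeries R) →L[R] LaurentExtension R K where
  toFun := ofVec β
  map_add' := map_add _
  map_smul' r z := by
    rw [RingHom.id_apply, smul_def, ← map_smul]
    congr 1
    ext1 j
    exact HahnSeries.C_mul_eq_smul.symm
  cont := continuous_iInf_rng.2 fun φ => continuous_induced_rng.2
    (continuous_linearMap_laurent (φ ∘ₗ ofVec β))

variable (R) in
/-- The elementary Tate module isomorphic to `R((t))^N`. -/
def laurentData (N : ℕ) : ElementaryData R := ⟨ℕ →₀ (Fin N → R), ℕ →₀ (Fin N → R)⟩

variable (R N) in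
/-- The polar part of a vector of Laurent series. -/
def polarPart : (Fin N → LaurentSeries R) →ₗ[R] (ℕ →₀ (Fin N → R)) where
  toFun h := Finsupp.ofSupportFinite (fun m j => (h j).coeff (Int.negSucc m)) <| by
    obtain ⟨b, hb⟩ := (Set.finite_range fun j => (h j).order).bddBelow
    refine (Set.finite_Iio b.natAbs).subset fun m hm => ?_
    obtain ⟨j, hj⟩ := Function.ne_iff.1 hm
    have h1 : b ≤ (h j).order := hb ⟨j, rfl⟩
    have h2 : (h j).order ≤ Int.negSucc m :=
      le_of_not_gt fun hlt => hj (HahnSeries.coeff_eq_zero_of_lt_order hlt)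
    change m < b.natAbs
    lia
  map_add' h h' := Finsupp.ext fun m => rfl
  map_smul' r h := Finsupp.ext fun m => rfl

variable (R N) in
/-- The part of nonnegative degree of a vector of Laurent series, as an element of the dual of a
free right module. -/
def regularPart : (Fin N → LaurentSeries R) →ₗ[R] Dual R (ℕ →₀ (Fin N → R)) where
  toFun h := Finsupp.lsum ℕ fun m : ℕ => (dualDot N fun j => (h j).coeff m).toHom
  map_add' h h' := by
    refine Dual.ext fun q => ?_
    change (q.sum fun m v => ∑ j, ((h + h') j).coeff m * v j) =
      (q.sum fun m v => ∑ j, (h j).coeff m * v j) + q.sum fun m v => ∑ j, (h' j).coeff m * v j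
    rw [← Finsupp.sum_add]
    simp [add_mul, Finset.sum_add_distrib]
  map_smul' r h := by
    refine Dual.ext fun q => ?_
    change (q.sum fun m v => ∑ j, ((r • h) j).coeff m * v j) =
      r * q.sum fun m v => ∑ j, (h j).coeff m * v j
    rw [Finsupp.mul_sum]
    simp [Finset.mul_sum, mul_assoc]

theorem regularPart_apply (h : Fin N → LaurentSeries R) (q : ℕ →₀ (Fin N → R)) :
    regularPart R N h q = q.sum fun m v => ∑ j, (h j).coeff m * v j := rfl

/-- The Laurent series with given polar part and regular part. -/
def ofParts (p : ℕ →₀ (Fin N → R)) (f : Dual R (ℕ →₀ (Fin N → R))) (j : Fin N) : LaurentSeries R :=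
  HahnSeries.ofSuppBddBelow
    (fun i : ℤ => match i with
      | Int.ofNat m => f (Finsupp.single m (Pi.single j 1))
      | Int.negSucc m => p m j) <| by
    obtain ⟨b, hb⟩ := p.support.bddAbove
    refine ⟨Int.negSucc b, fun i hi => ?_⟩
    cases i with
    | ofNat m => exact (Int.negSucc_lt_zero b).le.trans (Int.natCast_nonneg m)
    | negSucc m =>
      have h1 : m ∈ p.support := Finsupp.mem_support_iff.2 fun h0 => hi (congrFun h0 j)
      have := hb h1
      lia

/-- The decomposition of a vector of Laurent series into its parts. -/
def toLaurentData (N : ℕ) : (Fin N → LaurentSeries R) →L[R] (laurentData R N).Space :=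
  (laurentData R N).inlL.comp
      { polarPart R N with
        cont := continuous_of_coeff_eq ⟨0, fun f g h => Finsupp.ext fun m => funext fun j =>
          h j _ (Int.negSucc_lt_zero m)⟩ } +
    (laurentData R N).inrL.comp
      { regularPart R N with
        cont := Dual.continuous_of_eval fun q => by
          obtain ⟨b, hb⟩ := q.support.bddAbove
          -- Evaluation at `q` involves only coefficients in degrees of its support, all at most
          -- `b`.
          refine continuous_of_coeff_eq ⟨b + 1, fun f g h => ?_⟩
          change (q.sum fun m v => ∑ j, (g j).coeff m * v j) =
            q.sum fun m v => ∑ j, (f j).coeff m * v j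
          refine Finset.sum_congr rfl fun m hm => Finset.sum_congr rfl fun j _ => ?_
          rw [h j m]
          have := hb hm
          lia }

/-- The vector of Laurent series with given parts. -/
def ofLaurentData (N : ℕ) : (laurentData R N).Space →L[R] (Fin N → LaurentSeries R) where
  toFun x j := ofParts x.1 x.2 j
  map_add' x y := by
    ext j i
    cases i <;> rfl
  map_smul' r x := by
    ext j i
    cases i <;> rfl
  cont := by
    refine continuous_pi fun j => continuous_iff_continuousAt.2 fun x =>
      continuousAt_laurent_iff.2 fun n => ?_
    have h1 := eventually_eq_of_discrete (laurentData R N).fstL.continuous x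
    -- Only finitely many nonnegative degrees lie below `n`; each coefficient there is an evaluation
    -- of the dual part, hence locally constant.
    have h2 : ∀ᶠ y in 𝓝 x, ∀ m < n.toNat,
        Dual.eval R (Q := ℕ →₀ (Fin N → R)) (Finsupp.single m (Pi.single j 1))
          ((laurentData R N).sndL y) =
        Dual.eval R (Q := ℕ →₀ (Fin N → R)) (Finsupp.single m (Pi.single j 1))
          ((laurentData R N).sndL x) :=
      (Set.finite_Iio n.toNat).eventually_all.2 fun m _ => eventually_eq_of_discrete
        ((Dual.eval R _).continuous.comp (laurentData R N).sndL.continuous) x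
    filter_upwards [h1, h2] with y hy1 hy2 i hi
    cases i with
    | ofNat m => exact hy2 m (by lia)
    | negSucc m => exact congrFun (DFunLike.congr_fun (F := ℕ →₀ (Fin N → R)) hy1 m) j

theorem ofLaurentData_toLaurentData (h : Fin N → LaurentSeries R) :
    ofLaurentData N (toLaurentData N h) = h := by
  ext j i
  cases i with
  | ofNat m =>
    change (0 + regularPart R N h) (Finsupp.single m (Pi.single j 1)) = _
    rw [zero_add, regularPart_apply, Finsupp.sum_single_index (by simp)]
    simp [Pi.single_apply]
  | negSucc m =>
    change (polarPart R N h + 0) m j = _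
    rw [add_zero]
    rfl

theorem prP_toLaurentData (h : Fin N → LaurentSeries R) :
    (laurentData R N).prP (toLaurentData N h) = polarPart R N h := add_zero _

/-- The discrete summand consists of Laurent polynomials, so an operator defined over R[t,t⁻¹] can
be computed there without completing. -/
theorem ofLaurentData_inP (p : ℕ →₀ (Fin N → R)) :
    ofLaurentData N ((laurentData R N).inP p) =
      fun j => laurentInclusion R ((laurentVec R N).symm (ofNegPart R _ p) j) := by
  ext j i
  rw [coeff_laurentInclusion, coeff_laurentVec_symm]
  cases i with
  | ofNat m =>
    have : (Int.ofNat m) ∉ Set.range Int.negSucc := by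
      rintro ⟨k, hk⟩
      cases hk
    exact (congrFun (Finsupp.mapDomain_of_notMem_range p _ this) j).symm
  | negSucc m =>
    exact (congrFun (Finsupp.mapDomain_apply (fun _ _ h => Int.negSucc.inj h) p m) j).symm

theorem polarPart_laurentInclusion (y : Fin N → LaurentPolynomial R) :
    polarPart R N (fun j => laurentInclusion R (y j)) = negPart R _ (laurentVec R N y) := by
  ext m j
  exact coeff_laurentInclusion _ _

/-- A Toeplitz operator whose symbol is an idempotent matrix represents the class of the Tate module
defined by the image of the matrix. -/
theorem exists_cls_laurentExtension {N : ℕ} {q : (ℤ →₀ (Fin N → R)) →ₗ[R] (ℤ →₀ (Fin N → R))}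
    (hq : IsShiftEquivariant q) (hqq : q ∘ₗ q = q) :
    ∃ (P : Type u) (_ : AddCommGroup P) (_ : Module (LaurentPolynomial R) P)
      (_ : Module.Finite (LaurentPolynomial R) P) (_ : Module.Projective (LaurentPolynomial R) P)
      (h : IsTate R (LaurentExtension R P)),
      (TateModule.mk (LaurentExtension R P) h).cls =
        calkinClass _ (calkinMk_toeplitz_idem hq hqq) := by
  let q' := hq.toLinearMap
  have hq' : ∀ x, q' (q' x) = q' x := fun x => by
    change (laurentVec R N).symm (q (laurentVec R N ((laurentVec R N).symm _))) = _
    rw [LinearEquiv.apply_symm_apply]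
    exact congrArg (laurentVec R N).symm (LinearMap.congr_fun hqq _)
  let K := LinearMap.range q'
  let α : K →ₗ[LaurentPolynomial R] (Fin N → LaurentPolynomial R) := K.subtype
  let β : (Fin N → LaurentPolynomial R) →ₗ[LaurentPolynomial R] K := q'.rangeRestrict
  have hβα : ∀ x, β (α x) = x := by
    rintro ⟨_, x, rfl⟩
    exact Subtype.ext (hq' x)
  have hfin : Module.Finite (LaurentPolynomial R) K := .of_surjective β fun x => ⟨α x, hβα x⟩
  have hproj : Module.Projective (LaurentPolynomial R) K :=
    .of_split α β (LinearMap.ext hβα)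
  let i := (toLaurentData N).comp (LaurentExtension.toVecL α)
  let r := (LaurentExtension.ofVecL β).comp (ofLaurentData N)
  have hri : ∀ x, r (i x) = x := fun x => by
    change LaurentExtension.ofVec β (ofLaurentData N (toLaurentData N (LaurentExtension.toVec α x))) = x
    rw [ofLaurentData_toLaurentData, LaurentExtension.ofVec_toVec hβα]
  have h : IsTate R (LaurentExtension R K) :=
    IsTate.of_retract ⟨laurentData R N, ⟨ContinuousLinearEquiv.refl R _⟩⟩ i r hri
  refine ⟨K, inferInstance, inferInstance, hfin, hproj, h, ?_⟩
  let p : (TateModule.mk (LaurentExtension R K) h).Presentation := ⟨laurentData R N, i, r, hri⟩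
  rw [cls_eq_calkinClass p]
  -- The discrete component equals the Toeplitz operator exactly: include negative degrees, apply
  -- the matrix, take the polar part.
  have e : discretePart (p.i.comp p.r) = negPart R _ ∘ₗ q ∘ₗ ofNegPart R (Fin N → R) := by
    refine LinearMap.ext fun x => ?_
    change (laurentData R N).prP (toLaurentData N (LaurentExtension.toVec α
      (LaurentExtension.ofVec β (ofLaurentData N ((laurentData R N).inP x))))) = _
    refine (congrArg (fun z => (laurentData R N).prP (toLaurentData N (LaurentExtension.toVec α
      (LaurentExtension.ofVec β z)))) (ofLaurentData_inP x)).trans ?_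
    rw [LaurentExtension.ofVec_inclusion, LaurentExtension.toVec_of]
    refine (prP_toLaurentData _).trans ((polarPart_laurentInclusion _).trans ?_)
    change negPart R _ (laurentVec R N ((laurentVec R N).symm (q (laurentVec R N
      ((laurentVec R N).symm _))))) = _
    rw [LinearEquiv.apply_symm_apply, LinearEquiv.apply_symm_apply]
    rfl
  exact calkinClass_congr (congrArg calkinMk e) _ _

end LaurentTopology

end

/-! ### Surjectivity, smallness and the conclusion. -/

section

variable {R : Type u} [Ring R]

theorem IsGrothendieckGroup.of_addEquiv {A : Type v} [Category A] [Preadditive A]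
    {K : Type*} {K' : Type u} [AddCommGroup K] [AddCommGroup K'] {cls : A → K}
    (h : IsGrothendieckGroup.{_, _, w} cls) (e : K ≃+ K') :
    IsGrothendieckGroup.{_, _, w} fun X => e (cls X) := by
  refine ⟨fun X Y b hb => (congrArg e (h.1 X Y b hb)).trans (map_add e _ _), fun G _ φ hφ => ?_⟩
  obtain ⟨f, hf, huniq⟩ := h.2 G φ hφ
  refine ⟨f.comp e.symm.toAddMonoidHom, fun X => ?_, fun g hg => ?_⟩
  · simp [hf]
  · rw [← huniq (g.comp e.toAddMonoidHom) hg]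
    ext x
    simp

/-- The clutching construction yields the negative of a given class, so it is applied to `-y`. -/
theorem exists_toeplitz_eq (y : KMinusOne R) :
    ∃ (N : ℕ) (q : (ℤ →₀ (Fin N → R)) →ₗ[R] (ℤ →₀ (Fin N → R))) (hq : IsShiftEquivariant q)
      (hqq : q ∘ₗ q = q), calkinClass _ (calkinMk_toeplitz_idem hq hqq) = y := by
  obtain ⟨P, _, _, _, a, ha, h⟩ := exists_eq_calkinClass (-y)
  obtain ⟨N, q, hq, hqq, h'⟩ := exists_toeplitz ha
  rw [← h] at h'
  exact ⟨N, q, hq, hqq, by rwa [add_neg_eq_zero] at h'⟩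

theorem exists_cls_laurentExtension_eq (y : KMinusOne R) :
    ∃ (P : Type u) (_ : AddCommGroup P) (_ : Module (LaurentPolynomial R) P)
      (_ : Module.Finite (LaurentPolynomial R) P) (_ : Module.Projective (LaurentPolynomial R) P)
      (h : IsTate R (LaurentExtension R P)), (TateModule.mk (LaurentExtension R P) h).cls = y := by
  obtain ⟨N, q, hq, hqq, rfl⟩ := exists_toeplitz_eq y
  exact exists_cls_laurentExtension hq hqq

variable (R) in
theorem k0_map_phi_bijective : Function.Bijective (K0.map (Phi R)) := by
  refine ⟨k0_map_phi_injective, fun y => ?_⟩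
  obtain ⟨P, _, _, _, _, h, rfl⟩ := exists_cls_laurentExtension_eq y
  exact ⟨K0.of (TateModule.mk (LaurentExtension R P) h), K0.map_of _ _⟩

/-- Idempotent matrices over R[t,t⁻¹] of all finite sizes form a type in the universe of `R`, and
they exhaust the group. -/
instance : Small.{u} (KMinusOne R) :=
  small_of_surjective
    (f := fun x : Σ N : ℕ, {q : (ℤ →₀ (Fin N → R)) →ₗ[R] (ℤ →₀ (Fin N → R)) //
      IsShiftEquivariant q ∧ q ∘ₗ q = q} => calkinClass _ (calkinMk_toeplitz_idem x.2.2.1 x.2.2.2))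
    fun y => by
      obtain ⟨N, q, hq, hqq, rfl⟩ := exists_toeplitz_eq y
      exact ⟨⟨N, q, hq, hqq⟩, rfl⟩

end

end TateK

end

theorem mainTheorem5 (R : Type u) [Ring R] :
    (∀ M : TateK.TateModule R, M.cls = 0 ↔ TateK.IsQuasiElementary R M) ∧
    (∃ (K : Type u) (_ : AddCommGroup K) (cls : TateK.TateModule R → K),
      TateK.IsGrothendieckGroup.{u, u + 1, w} cls) ∧
    Function.Bijective (TateK.K0.map (TateK.Phi R)) ∧
    (∀ x : TateK.K0 (TateK.TateModule R),
      ∃ (P : Type u) (_ : AddCommGroup P) (_ : Module (LaurentPolynomial R) P)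
        (_ : Module.Finite (LaurentPolynomial R) P)
        (_ : Module.Projective (LaurentPolynomial R) P)
        (h : TateK.IsTate R (TateK.LaurentExtension R P)),
        TateK.K0.of (TateK.TateModule.mk (TateK.LaurentExtension R P) h) = x) := by
  have hbij := TateK.k0_map_phi_bijective R
  refine ⟨TateK.cls_eq_zero_iff, ?_, hbij, fun x => ?_⟩
  -- The universal property of the large group is transported along the comparison isomorphism to a
  -- small model of K₋₁(R).
  · exact ⟨Shrink.{u} (TateK.KMinusOne R), inferInstance, _,
      TateK.K0.isGrothendieckGroup.of_addEquiv
        ((AddEquiv.ofBijective _ hbij).trans Shrink.addEquiv.symm)⟩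
  · obtain ⟨P, i₁, i₂, i₃, i₄, h, hP⟩ :=
      TateK.exists_cls_laurentExtension_eq (TateK.K0.map (TateK.Phi R) x)
    exact ⟨P, i₁, i₂, i₃, i₄, h, hbij.1 ((TateK.K0.map_of _ _).trans hP)⟩
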